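/- Let $\mathcal H$ be a separable, infinite-dimensional complex Hilbert space, let $\mathcal L(\mathcal H)$ be the algebra of bounded linear operators on $\mathcal H$, and let $\mathbb F\subset\mathcal L(\mathcal H)$ be the ideal of finite-rank operators. If $\mathcal J\subset\mathcal L(\mathcal H)$ is a two-sided ideal and $\mathcal M\subset\mathcal H$ is an infinite-dimensional closed subspace, $A\in\mathcal L(\mathcal M)$ is said to belong to $\mathcal J(\mathcal M)$ if $\varphi A\varphi^{-1}\in\mathcal J$ for some Hilbert space isomorphism $\varphi$ of $\mathcal M$ onto $\mathcal H$. An operator on a Hilbert space is diagonalizable if the space has an orthonormal basis consisting of eigenvectors of the operator. **Theorem 3.1.** Let $T'\in\mathcal L(\mathcal H)$, let $\varepsilon>0$, and let $\mathcal J$ be a (not necessarily closed) two-sided ideal of $\mathcal L(\mathcal H)$ with $\mathbb F\subsetneq\mathcal J\subsetneq\mathcal L(\mathcal H)$. Then there exist a scalar $\beta\in\mathbb C$, an invertible operator $S\in\mathcal L(\mathcal H)$, and infinite-dimensional, pairwise orthogonal closed subspaces $\mathcal M_1,\mathcal M_2,\mathcal M_3$ of $\mathcal H$ with $\mathcal M_1\oplus\mathcal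 M_2\oplus\mathcal M_3=\mathcal H$ such that the matrix of $S^{-1}(T'-\beta 1_{\mathcal H})S$ relative to this decomposition has the form $$\begin{pmatrix} T_{1,1}&T_{1,2}&T_{1,3}\\ R_{2,1}&T_{2,2}&T_{2,3}\\ R_{3,1}&R_{3,2}&T_{3,3}\end{pmatrix},$$ where a) $T_{1,1}\in\mathcal J(\mathcal M_1)$, $T_{3,3}\in\mathcal J(\mathcal M_3)$, $\|T_{1,1}\|<\varepsilon$ and $\|T_{3,3}\|<\varepsilon$; b) $R_{2,1}$, $R_{3,1}$ and $R_{3,2}$ are operators of rank at most one; c) $T_{1,1}$ and $T_{3,3}$ are diagonalizable normal operators. -/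

import Mathlib

section Defs

variable {H : Type*} [NormedAddCommGroup H] [InnerProductSpace ℂ H]

/-- The two-sided ideal of finite-rank operators in the algebra of bounded operators on `H`. -/
def finiteRankIdeal (H : Type*) [NormedAddCommGroup H] [InnerProductSpace ℂ H] :
    TwoSidedIdeal (H →L[ℂ] H) :=
  TwoSidedIdeal.mk' {A : H →L[ℂ] H | FiniteDimensional ℂ (LinearMap.range (A : H →ₗ[ℂ] H))}
    (by
      have h : LinearMap.range ((0 : H →L[ℂ] H) : H →ₗ[ℂ] H) = ⊥ := by
        simp
      change FiniteDimensional ℂ (LinearMap.range ((0 : H →L[ℂ] H) : H →ₗ[ℂ] H))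
      rw [h]
      infer_instance)
    (by
      intro A B hA hB
      have : FiniteDimensional ℂ (LinearMap.range (A : H →ₗ[ℂ] H)) := hA
      have : FiniteDimensional ℂ (LinearMap.range (B : H →ₗ[ℂ] H)) := hB
      refine Submodule.finiteDimensional_of_le
        (S₂ := LinearMap.range (A : H →ₗ[ℂ] H) ⊔ LinearMap.range (B : H →ₗ[ℂ] H)) ?_
      rintro _ ⟨x, rfl⟩
      exact Submodule.add_mem_sup ⟨x, rfl⟩ ⟨x, rfl⟩)
    (by
      intro A hA
      have : FiniteDimensional ℂ (LinearMap.range (A : H →ₗ[ℂ] H)) := hA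
      refine Submodule.finiteDimensional_of_le (S₂ := LinearMap.range (A : H →ₗ[ℂ] H)) ?_
      rintro _ ⟨x, rfl⟩
      exact ⟨-x, by simp⟩)
    (by
      intro A B hB
      have : FiniteDimensional ℂ (LinearMap.range (B : H →ₗ[ℂ] H)) := hB
      refine Submodule.finiteDimensional_of_le
        (S₂ := (LinearMap.range (B : H →ₗ[ℂ] H)).map (A : H →ₗ[ℂ] H)) ?_
      rintro _ ⟨x, rfl⟩
      exact ⟨B x, ⟨x, rfl⟩, rfl⟩)
    (by
      intro A B hA
      have : FiniteDimensional ℂ (LinearMap.range (A : H →ₗ[ℂ] H)) := hA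
      refine Submodule.finiteDimensional_of_le (S₂ := LinearMap.range (A : H →ₗ[ℂ] H)) ?_
      rintro _ ⟨x, rfl⟩
      exact ⟨B x, rfl⟩)

/-- Membership of an operator `A` on a Hilbert space `K` in the copy of the ideal `J` of operators
on `H`: for some Hilbert space isomorphism `φ : K → H`, the operator `φ A φ⁻¹` lies in `J`. -/
def MemIdealCopy (J : TwoSidedIdeal (H →L[ℂ] H)) {K : Type*} [NormedAddCommGroup K]
    [InnerProductSpace ℂ K] (A : K →L[ℂ] K) : Prop :=
  ∃ φ : K ≃ₗᵢ[ℂ] H,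
    (φ.toContinuousLinearEquiv : K →L[ℂ] H) ∘L A ∘L
      (φ.symm.toContinuousLinearEquiv : H →L[ℂ] K) ∈ J

/-- A bounded operator is diagonalizable if the space has an orthonormal (Hilbert) basis
consisting of eigenvectors of it. -/
def IsDiagonalizable {K : Type*} [NormedAddCommGroup K] [InnerProductSpace ℂ K]
    (A : K →L[ℂ] K) : Prop :=
  ∃ (ι : Type) (e : HilbertBasis ι ℂ K) (d : ι → ℂ), ∀ i, A (e i) = d i • e i

/-- The `(i, j)` entry `M j → M i` of the matrix of the operator `A` with respect to an orthogonal
decomposition of `H` into the closed subspaces `M i`. -/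
noncomputable def blockEntry [CompleteSpace H] (M : Fin 3 → ClosedSubmodule ℂ H)
    (A : H →L[ℂ] H) (i j : Fin 3) : (M j).toSubmodule →L[ℂ] (M i).toSubmodule :=
  (M i).toSubmodule.orthogonalProjectionOnto ∘L A ∘L (M j).toSubmodule.subtypeL

/-- A closed subspace of a Hilbert space is a Hilbert space. -/
instance closedSubmoduleCompleteSpace [CompleteSpace H] (M : ClosedSubmodule ℂ H) :
    CompleteSpace M.toSubmodule :=
  M.isClosed.completeSpace_coe

end Defs

open Filter Topology InnerProductSpace
open ContinuousLinearMap (adjoint)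

set_option linter.unusedSectionVars false

/-! ### Decreasing ranges and finite-dimensional kernels -/

section LinearAlgebra

variable {E : Type*} [AddCommGroup E] [Module ℂ E]

/-! Write `A = T' - β`. The required block form says that an orthonormal basis `b n` of the first
summand satisfies `C (b n) = lam n • b n + c n • v + xi n • x` with fixed `v` in the second summand
and `x` in the third, and that an orthonormal basis `f n` of the third satisfies `adjoint C (f n) =
mu n • f n + d n • w + eta n • y` with fixed `w` in the second and `y` in the first. A similarity
moves `h`, `v`, `x` by an operator and `g`, `w`, `y` by its inverse adjoint, so it preserves all
pairings between the two groups. One therefore looks for sequences `h`, `g`, close to orthonormal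
ones, that satisfy such relations for `A` and `adjoint A`, with `h` orthogonal to `g` and `w`, `v`
orthogonal to `g` and `y`, and `x` orthogonal to `w` and `y`. With mild nondegeneracy this suffices:
`exists_similarity` supplies the similarity, whose key factor is the block unitriangular operator of
`exists_unipotent`.

Choice of `β`. By Liouville's theorem some `T' - β` is not invertible up to a finite-rank idempotent
(`exists_not_browder`). Taking `β` of largest modulus makes `A` a limit of invertible operators `A -
κ n` (`exists_not_browder_resolventSeq`). Then neither `A` nor its adjoint is bounded below on any
subspace of finite codimension: for limits of invertibles the contrary would make them invertible up
to finite rank (`exists_browder_of_not_singularOn`).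

Approximate eigenvectors. `exists_eigen_family` builds a backward orbit `u k` with `(D - κ) u (k +
1)` close to `u k`, where `κ` runs through tiny scalars, and at each stage adds a large multiple of
a unit vector that `D` nearly kills. Products of the factors `D - κ` applied to `u k` converge to a
vector `h`; leaving out one factor gives in the limit a vector that this factor maps to `h`, and
after rescaling it is close to a unit vector. The scalars may decay as fast as desired, so the
diagonal blocks fall into the ideal (`exists_decay_memIdealCopy`).

Coupling. For the orthogonality relations, `exists_coupled_families` first treats the adjoint and
then runs the construction on vectors orthogonal to more and more of `w`, `adjoint B w`, and so on.
This applies directly when `A` and its adjoint have finite-dimensional kernels and finite ascents.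
The other cases use invariant subspaces (`hasCoupledFamilies_of_split`) or a rank-one perturbation
`B` of `A` for which `B` and its adjoint have eigenvectors `p` and `p'` (`RankOneSplit`); this
perturbation is the source of the error directions `x` and `y`. -/

theorem map_iInf_eq_of_finiteDimensional_ker (T : E →ₗ[ℂ] E) [FiniteDimensional ℂ T.ker]
    (R : ℕ → Submodule ℂ E) (hmono : Antitone R) (hR : ∀ j, (R j).map T = R (j + 1)) :
    (⨅ j, R j).map T = ⨅ j, R j ∧
      ((∀ j, ∃ x ∈ R j, T x = 0 ∧ x ≠ 0) → ∃ x ∈ ⨅ j, R j, T x = 0 ∧ x ≠ 0) := by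
  obtain ⟨J, hJ⟩ := IsArtinian.monotone_stabilizes (R := ℂ) (M := T.ker)
    ⟨fun j => OrderDual.toDual ((R j).comap T.ker.subtype), fun i j hij =>
      Submodule.comap_mono (hmono hij)⟩
  -- The traces of the kernel on the `R j` decrease inside a finite-dimensional space, so they are
  -- constant from `J` on. Two preimages of one vector differ by a kernel vector, hence a preimage
  -- in `R J` lies in every `R j`.
  have key : ∀ x ∈ R J, T x = 0 → x ∈ ⨅ j, R j := by
    intro x hx hTx
    rw [Submodule.mem_iInf]
    intro j
    rcases le_total j J with h | h
    · exact hmono h hx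
    · have h1 := hJ j h
      have h2 : (R J).comap T.ker.subtype = (R j).comap T.ker.subtype := h1
      have h3 : (⟨x, hTx⟩ : T.ker) ∈ (R J).comap T.ker.subtype := hx
      rw [h2] at h3
      exact h3
  refine ⟨le_antisymm ?_ ?_, ?_⟩
  · rintro _ ⟨x, hx, rfl⟩
    rw [Submodule.mem_iInf]
    intro j
    have hx' : x ∈ ⨅ j, R j := hx
    exact hmono (Nat.le_succ j) ((hR j).le ⟨x, (Submodule.mem_iInf _).1 hx' j, rfl⟩)
  · intro y hy
    have hy' := (Submodule.mem_iInf _).1 hy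
    have hpre : ∀ j, ∃ x ∈ R j, T x = y := fun j => (hR j).ge (hy' (j + 1))
    obtain ⟨x, hx, hxy⟩ := hpre J
    refine ⟨x, ?_, hxy⟩
    refine (Submodule.mem_iInf _).2 fun j => ?_
    rcases le_total j J with h | h
    · exact hmono h hx
    · obtain ⟨x', hx', hxy'⟩ := hpre j
      have h1 := key (x - x') (sub_mem hx (hmono h hx')) (by simp [hxy, hxy'])
      have h2 := add_mem ((Submodule.mem_iInf _).1 h1 j) hx'
      simpa using h2
  · intro h
    obtain ⟨x, hx, h1, h2⟩ := h J
    exact ⟨x, key x hx h1, h1, h2⟩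

theorem finiteDimensional_comap {F : Type*} [AddCommGroup F] [Module ℂ F] (T : E →ₗ[ℂ] F)
    [FiniteDimensional ℂ T.ker] (W : Submodule ℂ F) [FiniteDimensional ℂ W] :
    FiniteDimensional ℂ (W.comap T) := by
  let T' : W.comap T →ₗ[ℂ] W := T.restrict fun x hx => hx
  have hk : FiniteDimensional ℂ T'.ker := by
    let f : T'.ker →ₗ[ℂ] T.ker :=
      { toFun := fun x => ⟨x.1.1, congrArg Subtype.val x.2⟩
        map_add' := fun _ _ => rfl
        map_smul' := fun _ _ => rfl }
    refine FiniteDimensional.of_injective f fun x y h => ?_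
    have h' : x.1.1 = y.1.1 := congrArg (fun z : T.ker => (z : E)) h
    exact Subtype.ext (Subtype.ext h')
  have hr : FiniteDimensional ℂ T'.range := inferInstance
  have h := T'.quotKerEquivRange
  have : FiniteDimensional ℂ (W.comap T ⧸ T'.ker) := h.symm.finiteDimensional
  exact Module.Finite.of_submodule_quotient T'.ker

theorem finiteDimensional_ker_pow (T : E →ₗ[ℂ] E) [FiniteDimensional ℂ T.ker] (k : ℕ) :
    FiniteDimensional ℂ (T ^ k).ker := by
  induction k with
  | zero =>
    have : (T ^ 0).ker = ⊥ := by ext x; simp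
    rw [this]; infer_instance
  | succ k ih =>
    have : (T ^ (k + 1)).ker = (T ^ k).ker.comap T := by
      ext x; simp [pow_succ]
    rw [this]
    exact finiteDimensional_comap T _

end LinearAlgebra

/-! ### Operators not bounded below on finite-codimensional subspaces -/

section Singular

variable {E : Type*} [NormedAddCommGroup E] [InnerProductSpace ℂ E]

/-- `D` is not bounded below on any finite-codimensional part of `Y`. -/
def SingularOn (D : E →L[ℂ] E) (Y : Submodule ℂ E) : Prop :=
  ∀ G : Submodule ℂ E, FiniteDimensional ℂ G → ∀ ε : ℝ, 0 < ε →
    ∃ z ∈ Y, z ∈ Gᗮ ∧ ‖z‖ = 1 ∧ ‖D z‖ < ε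

theorem exists_bound_of_not_singularOn {D : E →L[ℂ] E} {Y : Submodule ℂ E}
    (h : ¬ SingularOn D Y) : ∃ G : Submodule ℂ E, FiniteDimensional ℂ G ∧ ∃ c : ℝ, 0 < c ∧
      ∀ z ∈ Y, z ∈ Gᗮ → c * ‖z‖ ≤ ‖D z‖ := by
  unfold SingularOn at h
  push Not at h
  obtain ⟨G, hG, c, hc, h⟩ := h
  refine ⟨G, hG, c, hc, fun z hz hzG => ?_⟩
  by_cases h0 : z = 0
  · simp [h0]
  have hn : 0 < ‖z‖ := norm_pos_iff.2 h0
  have h1 := h (((‖z‖⁻¹ : ℝ) : ℂ) • z) (Y.smul_mem _ hz) (Gᗮ.smul_mem _ hzG) (by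
    rw [norm_smul, Complex.norm_real, norm_inv, norm_norm, inv_mul_cancel₀ hn.ne'])
  rw [map_smul, norm_smul, Complex.norm_real, norm_inv, norm_norm, inv_mul_eq_div,
    le_div_iff₀ hn] at h1
  exact h1

/-- Orthogonality to `G` is absorbed into the arbitrary finite-dimensional subspace of the
definition, so finite codimension does not matter. -/
theorem SingularOn.mono_orthogonal {D : E →L[ℂ] E} {Y Y' : Submodule ℂ E} (h : SingularOn D Y)
    (G : Submodule ℂ E) [FiniteDimensional ℂ G] (hY : Y ⊓ Gᗮ ≤ Y') : SingularOn D Y' := by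
  intro F hF ε hε
  obtain ⟨z, hz, hzG, h1, h2⟩ := h (F ⊔ G) inferInstance ε hε
  rw [← Submodule.inf_orthogonal] at hzG
  exact ⟨z, hY ⟨hz, hzG.2⟩, hzG.1, h1, h2⟩

theorem SingularOn.mono {D : E →L[ℂ] E} {Y Y' : Submodule ℂ E} (h : SingularOn D Y)
    (hY : Y ≤ Y') : SingularOn D Y' :=
  h.mono_orthogonal ⊥ (inf_le_left.trans hY)

/-- Finite-codimensional perturbation together with a finite-rank change of the operator. -/
theorem SingularOn.of_restrict {D : E →L[ℂ] E} {Y : Submodule ℂ E} [CompleteSpace Y]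
    (hD : ∀ x ∈ Y, D x ∈ Y) (h : ¬ SingularOn D Y) : ¬ SingularOn (D.restrict hD) ⊤ := by
  obtain ⟨G, hG, c, hc, h⟩ := exists_bound_of_not_singularOn h
  intro hs
  obtain ⟨z, -, hz, h1, h2⟩ := hs (G.map (Y.orthogonalProjectionOnto : E →ₗ[ℂ] Y))
    inferInstance c hc
  have h3 := h z z.2 (by
    intro g hg
    have := hz _ ⟨g, hg, rfl⟩
    rw [← this]
    simp)
  have : ‖(z : E)‖ = 1 := h1
  rw [this, mul_one] at h3
  exact absurd h2 (not_lt.2 h3)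

theorem pow_succ_clm_apply (D : E →L[ℂ] E) (k : ℕ) (x : E) : (D ^ (k + 1)) x = (D ^ k) (D x) := by
  rw [pow_succ]; rfl

theorem pow_succ_clm_apply' (D : E →L[ℂ] E) (k : ℕ) (x : E) :
    (D ^ (k + 1)) x = D ((D ^ k) x) := by
  rw [pow_succ']; rfl

variable [CompleteSpace E] {a : E →L[ℂ] E} {G : Submodule ℂ E} [FiniteDimensional ℂ G] {c : ℝ}

/-- `Y` is the sum of `Y ⊓ Gᗮ`, on which `a` is bounded below, and the finite-dimensional projection
of `G` into `Y`; a closed subspace plus a finite-dimensional one is closed. -/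
theorem isClosed_map_of_bound (hc : 0 < c) (hG : ∀ z ∈ Gᗮ, c * ‖z‖ ≤ ‖a z‖)
    (Y : Submodule ℂ E) (hY : IsClosed (Y : Set E)) :
    IsClosed (Y.map (a : E →ₗ[ℂ] E) : Set E) := by
  have : CompleteSpace Y := hY.completeSpace_coe
  let F : Submodule ℂ E := G.map ((Y.starProjection : E →L[ℂ] E) : E →ₗ[ℂ] E)
  have hF : F ≤ Y := by
    rintro _ ⟨g, -, rfl⟩
    exact Submodule.starProjection_apply_mem _ _
  let Y0 : Submodule ℂ E := Y ⊓ Gᗮ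
  have hY0 : IsClosed (Y0 : Set E) := hY.inter (Submodule.isClosed_orthogonal G)
  have : CompleteSpace Y0 := hY0.completeSpace_coe
  have hsum : Y = Y0 ⊔ F := by
    refine le_antisymm ?_ (sup_le inf_le_left hF)
    intro y hy
    have h1 : y = (y - F.starProjection y) + F.starProjection y := by abel
    rw [h1]
    refine Submodule.add_mem_sup ⟨sub_mem hy (hF (Submodule.starProjection_apply_mem _ _)), ?_⟩
      (Submodule.starProjection_apply_mem _ _)
    intro g hg
    have h2 : y - F.starProjection y ∈ Fᗮ := Submodule.sub_starProjection_mem_orthogonal _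
    have h3 : y - F.starProjection y ∈ Y :=
      sub_mem hy (hF (Submodule.starProjection_apply_mem _ _))
    have h4 := h2 (Y.starProjection g) ⟨g, hg, rfl⟩
    rw [Submodule.inner_starProjection_left_eq_right,
      Submodule.starProjection_eq_self_iff.2 h3] at h4
    exact h4
  have hcl : IsClosed (Y0.map (a : E →ₗ[ℂ] E) : Set E) := by
    let f : Y0 →L[ℂ] E := a ∘L Y0.subtypeL
    have hf : AntilipschitzWith (Real.toNNReal c⁻¹) f := by
      refine ContinuousLinearMap.antilipschitz_of_bound f fun x => ?_
      rw [Real.coe_toNNReal _ (inv_nonneg.2 hc.le), inv_mul_eq_div, le_div_iff₀ hc, mul_comm]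
      exact hG x x.2.2
    have := hf.isClosed_range f.uniformContinuous
    convert this using 1
    ext y
    simp [f]
  rw [hsum, Submodule.map_sup]
  exact Submodule.isClosed_sup_finiteDimensional _ _ hcl

/-- A kernel vector orthogonal to `G` vanishes by the bound, so the kernel embeds in `G`. -/
theorem finiteDimensional_ker_of_bound (hc : 0 < c) (hG : ∀ z ∈ Gᗮ, c * ‖z‖ ≤ ‖a z‖) :
    FiniteDimensional ℂ (a : E →ₗ[ℂ] E).ker := by
  let f : (a : E →ₗ[ℂ] E).ker →ₗ[ℂ] G :=
    (G.orthogonalProjectionOnto : E →ₗ[ℂ] G) ∘ₗ (a : E →ₗ[ℂ] E).ker.subtype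
  refine FiniteDimensional.of_injective f ?_
  rw [← LinearMap.ker_eq_bot, eq_bot_iff]
  rintro ⟨x, hx⟩ h
  have h1 : x ∈ Gᗮ := (Submodule.orthogonalProjectionOnto_eq_zero_iff).1 h
  have h2 := hG x h1
  have h3 : a x = 0 := hx
  rw [h3, norm_zero] at h2
  have : ‖x‖ = 0 := le_antisymm (by nlinarith [norm_nonneg x]) (norm_nonneg x)
  simpa using this

end Singular

/-! ### Limits of invertible operators: the semi-Fredholm dichotomy -/

section NearSingular

variable {E : Type*} [NormedAddCommGroup E] [InnerProductSpace ℂ E] [CompleteSpace E]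

/-- `r n` inverts `a - κ n`, and `κ` tends to zero. -/
structure ResolventSeq (a : E →L[ℂ] E) (κ : ℕ → ℂ) (r : ℕ → E →L[ℂ] E) : Prop where
  tendsto : Tendsto κ atTop (𝓝 0)
  right : ∀ n x, a (r n x) = x + κ n • r n x
  left : ∀ n x, r n (a x) = x + κ n • r n x

namespace ResolventSeq

variable {a : E →L[ℂ] E} {κ : ℕ → ℂ} {r : ℕ → E →L[ℂ] E}

theorem comm (h : ResolventSeq a κ r) (n : ℕ) (x : E) : a (r n x) = r n (a x) := by
  rw [h.right, h.left]

theorem comm_pow (h : ResolventSeq a κ r) (n k : ℕ) (x : E) :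
    (a ^ k) (r n x) = r n ((a ^ k) x) := by
  induction k generalizing x with
  | zero => simp
  | succ k ih => rw [pow_succ, mul_apply_eq_comp, h.comm, ih]; rfl

theorem eq_zero_of_eigen (h : ResolventSeq a κ r) {n : ℕ} {x : E} (hx : a x = κ n • x) :
    x = 0 := by
  have := h.left n x
  rw [hx, map_smul] at this
  simpa using this.symm

end ResolventSeq

/-- A surjective operator with nontrivial kernel has eigenvectors for all small eigenvalues. -/
theorem exists_eigen_of_surjective {a : E →L[ℂ] E} (hs : Function.Surjective a) {w : E}
    (hw : a w = 0) (hw0 : w ≠ 0) :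
    ∀ᶠ κ : ℂ in 𝓝 0, ∃ z : E, z ≠ 0 ∧ a z = κ • z := by
  let N : Submodule ℂ E := (a : E →ₗ[ℂ] E).kerᗮ
  have hker : IsClosed ((a : E →ₗ[ℂ] E).ker : Set E) := a.isClosed_ker
  have : CompleteSpace (a : E →ₗ[ℂ] E).ker := hker.completeSpace_coe
  have : CompleteSpace N := (Submodule.isClosed_orthogonal _).completeSpace_coe
  let f : N →L[ℂ] E := a ∘L N.subtypeL
  have hinj : f.ker = ⊥ := by
    rw [eq_bot_iff]
    rintro ⟨x, hx⟩ h
    have h1 : x ∈ (a : E →ₗ[ℂ] E).ker := h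
    have h2 := hx x h1
    rw [inner_self_eq_zero] at h2
    simpa using h2
  have hsurj : f.range = ⊤ := by
    rw [eq_top_iff]
    rintro y -
    obtain ⟨x, rfl⟩ := hs y
    let K := (a : E →ₗ[ℂ] E).ker
    refine ⟨⟨x - K.starProjection x, Submodule.sub_starProjection_mem_orthogonal _⟩, ?_⟩
    have h1 : a (K.starProjection x) = 0 := Submodule.starProjection_apply_mem K x
    change a (x - K.starProjection x) = a x
    rw [map_sub, h1, sub_zero]
  let e := ContinuousLinearEquiv.ofBijective f hinj hsurj
  let s : E →L[ℂ] E := N.subtypeL ∘L (e.symm : E →L[ℂ] N)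
  have has : ∀ y, a (s y) = y := fun y => ContinuousLinearEquiv.ofBijective_apply_symm_apply f hinj hsurj y
  have hev : ∀ᶠ κ : ℂ in 𝓝 0, ‖κ • s‖ < 1 := by
    have : Tendsto (fun κ : ℂ => ‖κ • s‖) (𝓝 0) (𝓝 0) := by
      have hc : Continuous fun κ : ℂ => ‖κ • s‖ := by fun_prop
      simpa using hc.tendsto 0
    exact this.eventually (gt_mem_nhds one_pos)
  filter_upwards [hev] with κ hκ
  let u := Units.oneSub (κ • s) hκ
  have hu : ∀ x, x = κ • s x → x = 0 := by
    intro x hx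
    have h1 : (u : E →L[ℂ] E) x = 0 := by
      change x - κ • s x = 0
      rw [← hx, sub_self]
    have h2 : ((↑u⁻¹ : E →L[ℂ] E) * (u : E →L[ℂ] E)) x = 0 := by
      rw [mul_apply_eq_comp, h1, map_zero]
    rwa [Units.inv_mul] at h2
  -- Here `s` is a bounded right inverse of `a`. Applying `a` to `z - κ • s z = w` turns the kernel
  -- vector `w` into an eigenvector for `κ`.
  let z : E := (↑u⁻¹ : E →L[ℂ] E) w
  have hz : z - κ • s z = w := by
    have h2 : ((u : E →L[ℂ] E) * (↑u⁻¹ : E →L[ℂ] E)) w = w := by rw [Units.mul_inv]; rfl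
    exact h2
  refine ⟨z, ?_, ?_⟩
  · rintro h
    rw [h] at hz
    simp at hz
    exact hw0 hz.symm
  · have h1 : a (z - κ • s z) = 0 := by rw [hz, hw]
    rw [map_sub, map_smul, has, sub_eq_zero] at h1
    exact h1

/-- If `a` is a limit of invertible operators `a - κ n` and is not singular, then it is invertible
up to a finite-rank idempotent on whose range `a` is nilpotent. -/
theorem exists_browder_of_not_singularOn {a : E →L[ℂ] E} {κ : ℕ → ℂ} {r : ℕ → E →L[ℂ] E}
    (h : ResolventSeq a κ r) (hs : ¬ SingularOn a ⊤) :
    ∃ (K : ℕ) (P X : E →L[ℂ] E), FiniteDimensional ℂ (P : E →ₗ[ℂ] E).range ∧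
      a * X = 1 - P ∧ X * a = 1 - P ∧ P * X = 0 ∧ X * P = 0 ∧ a ^ K * P = 0 := by
  obtain ⟨G, hGf, c, hc, hG'⟩ := exists_bound_of_not_singularOn hs
  have hG : ∀ z ∈ Gᗮ, c * ‖z‖ ≤ ‖a z‖ := fun z hz => hG' z trivial hz
  have hkf : FiniteDimensional ℂ (a : E →ₗ[ℂ] E).ker := finiteDimensional_ker_of_bound hc hG
  let R : ℕ → Submodule ℂ E := fun j => ((a : E →ₗ[ℂ] E) ^ j).range
  have hR : ∀ j, (R j).map (a : E →ₗ[ℂ] E) = R (j + 1) := by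
    intro j
    change _ = ((a : E →ₗ[ℂ] E) ^ (j + 1)).range
    rw [pow_succ', Module.End.mul_eq_comp, LinearMap.range_comp]
  have hmono : Antitone R := (a : E →ₗ[ℂ] E).iterateRange.monotone
  have hcl : ∀ j, IsClosed (R j : Set E) := by
    intro j
    induction j with
    | zero => 
      have : R 0 = ⊤ := by simp [R, Module.End.one_eq_id]
      rw [this]; exact isClosed_univ
    | succ j ih => rw [← hR]; exact isClosed_map_of_bound hc hG _ ih
  have hpow : ∀ j x, ((a : E →ₗ[ℂ] E) ^ j) x = (a ^ j) x := by
    intro j x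
    rw [← ContinuousLinearMap.toLinearMap_pow]; rfl
  -- If the kernel meets the range of every power, `a` maps the intersection of these ranges onto
  -- itself with nonzero kernel, so all small scalars are eigenvalues; this contradicts the
  -- existence of `r n`. Otherwise `a` is injective on some `R K`.
  by_cases hcase : ∀ j, ∃ x ∈ R j, a x = 0 ∧ x ≠ 0
  · exfalso
    obtain ⟨h1, h2⟩ := map_iInf_eq_of_finiteDimensional_ker (a : E →ₗ[ℂ] E) R hmono hR
    obtain ⟨w, hw, hw0, hw1⟩ := h2 hcase
    set V : Submodule ℂ E := ⨅ j, R j with hV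
    have hVc : IsClosed (V : Set E) := by
      rw [hV, Submodule.coe_iInf]
      exact isClosed_iInter hcl
    have : CompleteSpace V := hVc.completeSpace_coe
    have hinv : ∀ x ∈ V, a x ∈ V := fun x hx => h1.le ⟨x, hx, rfl⟩
    have hsurj : Function.Surjective (a.restrict hinv) := by
      rintro ⟨y, hy⟩
      obtain ⟨x, hx, hxy⟩ := h1.ge hy
      exact ⟨⟨x, hx⟩, Subtype.ext hxy⟩
    have hev := exists_eigen_of_surjective hsurj (w := ⟨w, hw⟩) (Subtype.ext hw0)
      (by simpa using hw1)
    obtain ⟨n, z, hz0, hz⟩ := (h.tendsto.eventually hev).exists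
    refine hz0 (Subtype.ext ?_)
    exact h.eq_zero_of_eigen (n := n) (congrArg Subtype.val hz)
  · push Not at hcase
    obtain ⟨K, hK⟩ := hcase
    have hKc : CompleteSpace (R K) := (hcl K).completeSpace_coe
    have hinv : ∀ x ∈ R K, a x ∈ R K := fun x hx => hmono (Nat.le_succ K) ((hR K).le ⟨x, hx, rfl⟩)
    let b : R K →L[ℂ] R K := a.restrict hinv
    have hbinj : Function.Injective b := by
      rw [← b.coe_coe, ← LinearMap.ker_eq_bot, eq_bot_iff]
      rintro ⟨x, hx⟩ hxb
      have : a x = 0 := congrArg Subtype.val (hxb : b ⟨x, hx⟩ = 0)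
      exact Subtype.ext (hK x hx this)
    have hbrange : IsClosed (Set.range b) := by
      have : Set.range b = Subtype.val ⁻¹' (R (K + 1) : Set E) := by
        ext ⟨y, hy⟩
        constructor
        · rintro ⟨x, hx⟩
          rw [← hx]
          exact (hR K).le ⟨x, x.2, rfl⟩
        · intro h'
          obtain ⟨x, hx, hxy⟩ := (hR K).ge h'
          exact ⟨⟨x, hx⟩, Subtype.ext hxy⟩
      rw [this]
      exact (hcl _).preimage continuous_subtype_val
    obtain ⟨C, hC⟩ := b.antilipschitz_of_injective_of_isClosed_range hbinj hbrange
    have hCb : ∀ x ∈ R K, ‖x‖ ≤ C * ‖a x‖ := fun x hx =>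
      b.bound_of_antilipschitz hC ⟨x, hx⟩
    have hRr : ∀ n, ∀ x ∈ R K, r n x ∈ R K := by
      rintro n _ ⟨x, rfl⟩
      exact ⟨r n x, by rw [hpow, hpow, h.comm_pow]⟩
    -- The vectors `r n y` are bounded because `a` is bounded below on `R K`. Hence `a (r n y) - y =
    -- κ n • r n y` tends to zero and `y` lies in the closed range.
    have hbsurj : Function.Surjective b := by
      intro y
      have hy : y ∈ closure (Set.range b) := by
        rw [mem_closure_iff_seq_limit]
        refine ⟨fun n => b ⟨r n y, hRr n y y.2⟩, fun n => ⟨_, rfl⟩, ?_⟩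
        rw [tendsto_iff_norm_sub_tendsto_zero]
        have hev : ∀ᶠ n in atTop, (C : ℝ) * ‖κ n‖ ≤ 1 / 2 := by
          have : Tendsto (fun n => (C : ℝ) * ‖κ n‖) atTop (𝓝 0) := by
            simpa using (h.tendsto.norm).const_mul (C : ℝ)
          exact this.eventually (ge_mem_nhds (by norm_num))
        have hlim : Tendsto (fun n => ‖κ n‖ * (2 * C * ‖y‖)) atTop (𝓝 0) := by
          simpa using (h.tendsto.norm).mul_const (2 * C * ‖y‖)
        refine squeeze_zero' (.of_forall fun n => norm_nonneg _) ?_ hlim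
        filter_upwards [hev] with n hn
        have h1 : a (r n y) - y = κ n • r n (y : E) := by rw [h.right]; abel
        have h2 : ‖b ⟨r n y, hRr n y y.2⟩ - y‖ = ‖κ n‖ * ‖r n (y : E)‖ := by
          rw [← norm_smul, ← h1]; rfl
        rw [h2]
        have h3 := hCb _ (hRr n y y.2)
        have h4 : ‖a (r n y)‖ ≤ ‖y‖ + ‖κ n‖ * ‖r n (y : E)‖ := by
          rw [h.right, ← norm_smul]; exact norm_add_le _ _
        have h5 : ‖r n (y : E)‖ ≤ 2 * C * ‖y‖ := by
          have h6 : (C : ℝ) * ‖a (r n y)‖ ≤ C * (‖y‖ + ‖κ n‖ * ‖r n (y : E)‖) :=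
            mul_le_mul_of_nonneg_left h4 C.2
          nlinarith [norm_nonneg (r n (y : E))]
        exact mul_le_mul_of_nonneg_left h5 (norm_nonneg _)
      rwa [hbrange.closure_eq] at hy
    let eb := ContinuousLinearEquiv.ofBijective b (LinearMap.ker_eq_bot.2 hbinj)
      (LinearMap.range_eq_top.2 hbsurj)
    let i : R K →L[ℂ] R K := eb.symm
    have hbi : ∀ y, b (i y) = y := fun y => ContinuousLinearEquiv.ofBijective_apply_symm_apply b _ _ y
    have hib : ∀ y, i (b y) = y := fun y => eb.symm_apply_apply y
    have hbik : ∀ k y, (b ^ k) ((i ^ k) y) = y := by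
      intro k
      induction k with
      | zero => intro y; rfl
      | succ k ih => intro y; rw [pow_succ_clm_apply', pow_succ_clm_apply, ih, hbi]
    have hibk : ∀ k y, (i ^ k) ((b ^ k) y) = y := by
      intro k
      induction k with
      | zero => intro y; rfl
      | succ k ih => intro y; rw [pow_succ_clm_apply', pow_succ_clm_apply, ih, hib]
    have hbk : ∀ k (y : R K), (((b ^ k) y : R K) : E) = (a ^ k) y := by
      intro k
      induction k with
      | zero => intro y; rfl
      | succ k ih => intro y; rw [pow_succ_clm_apply, pow_succ_clm_apply, ih]; rfl
    have hi_a : ∀ x : R K, (a (i x) : E) = x := fun x => congrArg Subtype.val (hbi x)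
    let A : E →L[ℂ] R K := (a ^ K).codRestrict (R K) fun x => ⟨x, hpow K x⟩
    have hAa : ∀ x, A (a x) = b (A x) := by
      intro x
      refine Subtype.ext ?_
      change (a ^ K) (a x) = a ((a ^ K) x)
      rw [← pow_succ_clm_apply, ← pow_succ_clm_apply']
    have hAR : ∀ y : R K, A y = (b ^ K) y := fun y => Subtype.ext (hbk K y).symm
    -- `Q` is the idempotent onto `R K` along the kernel of `a ^ K`, and `X` is the inverse of `a`
    -- on `R K` preceded by `Q`.
    let Q : E →L[ℂ] E := (R K).subtypeL ∘L (i ^ K) ∘L A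
    let X : E →L[ℂ] E := (R K).subtypeL ∘L i ∘L (i ^ K) ∘L A
    have hQ : ∀ x, Q x = (i ^ K) (A x) := fun x => rfl
    have hX : ∀ x, X x = i ((i ^ K) (A x)) := fun x => rfl
    have hcomm : ∀ k y, (i ^ k) (i y) = i ((i ^ k) y) := by
      intro k y
      rw [← pow_succ_clm_apply, ← pow_succ_clm_apply']
    have hQR : ∀ y : R K, Q y = y := by
      intro y; rw [hQ, hAR, hibk]
    refine ⟨K, 1 - Q, X, ?_, ?_, ?_, ?_, ?_, ?_⟩
    · have hfin := finiteDimensional_ker_pow (a : E →ₗ[ℂ] E) K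
      refine Submodule.finiteDimensional_of_le (S₂ := ((a : E →ₗ[ℂ] E) ^ K).ker) ?_
      rintro _ ⟨x, rfl⟩
      change ((a : E →ₗ[ℂ] E) ^ K) (x - Q x) = 0
      rw [hpow, map_sub, hQ, ← hbk, hbik]
      exact sub_self _
    · ext x
      simp only [sub_sub_cancel, mul_apply_eq_comp]
      rw [hX, hi_a, hQ]
    · ext x
      simp only [sub_sub_cancel, mul_apply_eq_comp]
      rw [hX, hAa, hQ]
      rw [← hcomm, hib]
    · ext x
      simp only [mul_apply_eq_comp, sub_apply, one_apply_eq_self, zero_apply]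
      rw [hX, hQR, sub_self]
    · ext x
      simp only [mul_apply_eq_comp, sub_apply, one_apply_eq_self, zero_apply]
      rw [hX]
      have : A (x - Q x) = 0 := by
        rw [map_sub, hQ, hAR, hbik, sub_self]
      rw [this]; simp
    · ext x
      simp only [mul_apply_eq_comp, sub_apply, one_apply_eq_self, zero_apply]
      rw [map_sub, hQ, ← hbk, hbik]
      exact sub_self _

end NearSingular

/-! ### Browder operators and the choice of the scalar -/

section Browder

variable {E : Type*} [NormedAddCommGroup E] [InnerProductSpace ℂ E] [CompleteSpace E]

/-- A dense-range operator which is a limit of invertible ones and is not singular is invertible. -/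
theorem exists_inverse_of_not_singularOn {a : E →L[ℂ] E} {κ : ℕ → ℂ} {r : ℕ → E →L[ℂ] E}
    (h : ResolventSeq a κ r) (hs : ¬ SingularOn a ⊤) (hd : DenseRange a) :
    ∃ X : E →L[ℂ] E, a * X = 1 ∧ X * a = 1 := by
  obtain ⟨K, P, X, -, h1, h2, -, -, h5⟩ := exists_browder_of_not_singularOn h hs
  have hc : Commute a P := by
    have h3 : P = 1 - a * X := by rw [h1]; abel
    have h4 : P = 1 - X * a := by rw [h2]; abel
    change a * P = P * a
    nth_rewrite 1 [h4]
    rw [h3]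
    noncomm_ring
  have h6 : P * a ^ K = 0 := by rw [← h5]; exact (hc.pow_left K).symm.eq
  have hdK : DenseRange (a ^ K) := by
    have : ∀ k : ℕ, DenseRange (⇑(a ^ k)) := by
      intro k
      induction k with
      | zero => exact Function.surjective_id.denseRange
      | succ k ih =>
        have : ⇑(a ^ (k + 1)) = a ∘ (a ^ k) := by
          funext x; exact pow_succ_clm_apply' a k x
        rw [this]
        exact hd.comp ih a.continuous
    exact this K
  have hP : P = 0 := by
    have : (P : E → E) = 0 := hdK.equalizer P.continuous continuous_zero (by
      funext x
      exact congrArg (fun f : E →L[ℂ] E => f x) h6)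
    ext x
    exact congrFun this x
  rw [hP, sub_zero] at h1 h2
  exact ⟨X, h1, h2⟩

/-- `P` and `X` exhibit `a` as invertible up to a finite-rank idempotent. -/
structure BrowderData (a P X : E →L[ℂ] E) : Prop where
  fin : FiniteDimensional ℂ (P : E →ₗ[ℂ] E).range
  right : a * X = 1 - P
  left : X * a = 1 - P
  zero_left : P * X = 0
  zero_right : X * P = 0

/-- Nothing is asked of `a` on the range of `P`; nilpotency there is dropped so that the property is
stable under small scalar shifts. -/
def Browder (a : E →L[ℂ] E) : Prop := ∃ P X, BrowderData a P X

theorem Browder.of_not_singularOn {a : E →L[ℂ] E} {κ : ℕ → ℂ} {r : ℕ → E →L[ℂ] E}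
    (h : ResolventSeq a κ r) (hs : ¬ SingularOn a ⊤) : Browder a := by
  obtain ⟨K, P, X, h0, h1, h2, h3, h4, -⟩ := exists_browder_of_not_singularOn h hs
  exact ⟨P, X, h0, h1, h2, h3, h4⟩

theorem BrowderData.of_right_inverse {a X : E →L[ℂ] E} (h1 : a * X = 1) (h2 : X * a = 1) :
    BrowderData a 0 X := by
  refine ⟨?_, by simpa using h1, by simpa using h2, by simp, by simp⟩
  have : ((0 : E →L[ℂ] E) : E →ₗ[ℂ] E).range = ⊥ := by simp
  rw [this]; infer_instance

/-- A Neumann series inverts the shifted operator where `X` inverts `a`. The idempotent `P` survives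
unchanged because `X` and `P` annihilate each other. -/
theorem BrowderData.perturb {a P X : E →L[ℂ] E} (h : BrowderData a P X) {δ : ℂ}
    (hδ : ‖δ • X‖ < 1) :
    BrowderData (a - δ • 1) P (X * Ring.inverse (1 - δ • X)) := by
  have hu : IsUnit (1 - δ • X) := isUnit_one_sub_of_norm_lt_one hδ
  obtain ⟨u, hu'⟩ := hu
  rw [← hu', Ring.inverse_unit]
  have hPu : P * ↑u⁻¹ = P := by
    have : P * (u : E →L[ℂ] E) = P := by
      rw [hu', mul_sub, mul_smul_comm, h.zero_left]; simp
    calc P * ↑u⁻¹ = P * u * ↑u⁻¹ := by rw [this]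
      _ = P := by rw [mul_assoc, Units.mul_inv, mul_one]
  have hXu : X * ↑u⁻¹ = ↑u⁻¹ * X := by
    have : Commute X (u : E →L[ℂ] E) := by
      rw [hu']
      exact (Commute.one_right X).sub_right ((Commute.refl X).smul_right δ)
    exact this.units_inv_right.eq
  have huP : ↑u⁻¹ * P = P := by
    have : (u : E →L[ℂ] E) * P = P := by
      rw [hu', sub_mul, smul_mul_assoc, h.zero_right]; simp
    calc ↑u⁻¹ * P = ↑u⁻¹ * (u * P) := by rw [this]
      _ = P := by rw [← mul_assoc, Units.inv_mul, one_mul]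
  refine ⟨h.fin, ?_, ?_, ?_, ?_⟩
  · have : (a - δ • 1) * X = u - P := by
      rw [hu', sub_mul, h.right]; simp only [smul_mul_assoc, one_mul]; abel
    rw [← mul_assoc, this, sub_mul, Units.mul_inv, hPu]
  · have : X * (a - δ • 1) = u - P := by
      rw [hu', mul_sub, h.left]; simp only [mul_smul_comm, mul_one]; abel
    rw [hXu, mul_assoc, this, mul_sub, Units.inv_mul, huP]
  · rw [← mul_assoc, h.zero_left, zero_mul]
  · rw [mul_assoc, huP, h.zero_right]

/-- Computing `X * a * X'` in two ways gives `X - X' = X * P' - P * X'`. -/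
theorem BrowderData.finiteDimensional_sub {a P X P' X' : E →L[ℂ] E} (h : BrowderData a P X)
    (h' : BrowderData a P' X') :
    FiniteDimensional ℂ ((X - X' : E →L[ℂ] E) : E →ₗ[ℂ] E).range := by
  have h1 : X - X' = X * P' - P * X' := by
    have h2 : X * (a * X') = X * a * X' := (mul_assoc _ _ _).symm
    rw [h'.right, h.left, mul_sub, sub_mul, mul_one, one_mul, sub_eq_sub_iff_add_eq_add] at h2
    rw [sub_eq_sub_iff_add_eq_add, h2]
    abel
  have m1 : P ∈ finiteRankIdeal E := by simpa [finiteRankIdeal] using h.fin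
  have m2 : P' ∈ finiteRankIdeal E := by simpa [finiteRankIdeal] using h'.fin
  have m3 : X - X' ∈ finiteRankIdeal E := by
    rw [h1]
    exact (finiteRankIdeal E).sub_mem ((finiteRankIdeal E).mul_mem_left _ _ m2)
      ((finiteRankIdeal E).mul_mem_right _ _ m1)
  simpa [finiteRankIdeal] using m3

/-- Hahn–Banach in the quotient by the closure of the finite-rank operators. The identity is not in
that closure, since operators at distance less than one from it are invertible. -/
theorem exists_functional_finiteRank (hE : ¬ FiniteDimensional ℂ E) :
    ∃ φ : (E →L[ℂ] E) →L[ℂ] ℂ, φ 1 ≠ 0 ∧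
      ∀ F : E →L[ℂ] E, FiniteDimensional ℂ (F : E →ₗ[ℂ] E).range → φ F = 0 := by
  let W : Submodule ℂ (E →L[ℂ] E) :=
    { carrier := {F | F ∈ finiteRankIdeal E}
      add_mem' := fun h h' => (finiteRankIdeal E).add_mem h h'
      zero_mem' := (finiteRankIdeal E).zero_mem
      smul_mem' := fun c F h => by
        have := (finiteRankIdeal E).mul_mem_left (c • 1) F h
        simpa using this }
  let W' := W.topologicalClosure
  have : IsClosed (W' : Set (E →L[ℂ] E)) := W.isClosed_topologicalClosure
  have h1 : (1 : E →L[ℂ] E) ∉ W' := by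
    intro h1
    obtain ⟨F, hF, hd⟩ := Metric.mem_closure_iff.1 h1 1 one_pos
    have hu : IsUnit F := by
      have := isUnit_one_sub_of_norm_lt_one (x := 1 - F) (by rwa [dist_eq_norm] at hd)
      simpa using this
    obtain ⟨-, hs⟩ := ContinuousLinearMap.isUnit_iff_bijective.1 hu
    have hF' : FiniteDimensional ℂ (F : E →ₗ[ℂ] E).range := by
      simpa [finiteRankIdeal] using (show F ∈ finiteRankIdeal E from hF)
    have htop : (F : E →ₗ[ℂ] E).range = ⊤ := LinearMap.range_eq_top.2 hs
    rw [htop] at hF'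
    exact hE (Module.Finite.equiv (Submodule.topEquiv (R := ℂ) (M := E)))
  have hne : ‖(W'.mkQL (1 : E →L[ℂ] E))‖ ≠ 0 := by
    rw [norm_ne_zero_iff]
    intro h
    exact h1 ((Submodule.Quotient.mk_eq_zero W').1 h)
  obtain ⟨g, -, hg⟩ := exists_dual_vector ℂ (W'.mkQL (1 : E →L[ℂ] E)) hne
  refine ⟨g ∘L W'.mkQL, ?_, fun F hF => ?_⟩
  · change g (W'.mkQL 1) ≠ 0
    rw [hg]
    exact fun h => hne (Complex.ofReal_eq_zero.1 h)
  · have hF' : F ∈ finiteRankIdeal E := by simpa [finiteRankIdeal] using hF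
    have : W'.mkQL F = 0 := (Submodule.Quotient.mk_eq_zero W').2 (W.le_topologicalClosure hF')
    change g (W'.mkQL F) = 0
    rw [this, map_zero]

/-- Otherwise `φ (X β)`, with `φ` vanishing on finite-rank operators, does not depend on the choice
of `X β`. It is entire and agrees near infinity with minus `φ` of the resolvent, so it vanishes by
Liouville. Then `φ (T * resolvent T β)` equals `-φ 1` near infinity but also tends to zero. -/
theorem exists_not_browder (hE : ¬ FiniteDimensional ℂ E) (T : E →L[ℂ] E) :
    ∃ β : ℂ, ¬ Browder (T - β • 1) := by
  by_contra hcon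
  push Not at hcon
  choose P X hX using hcon
  obtain ⟨φ, hφ1, hφ⟩ := exists_functional_finiteRank hE
  have huniq : ∀ β P' X', BrowderData (T - β • 1) P' X' → φ (X β) = φ X' := by
    intro β P' X' h
    have := hφ _ ((hX β).finiteDimensional_sub h)
    rwa [map_sub, sub_eq_zero] at this
  have hdiff : Differentiable ℂ fun β => φ (X β) := by
    intro β
    have hev : ∀ᶠ β' in 𝓝 β, φ (X β') =
        φ (X β * Ring.inverse (1 - (β' - β) • X β)) := by
      have h1 : ∀ᶠ β' in 𝓝 β, ‖(β' - β) • X β‖ < 1 := by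
        have hc : Continuous fun β' : ℂ => ‖(β' - β) • X β‖ := by fun_prop
        have := hc.tendsto β
        simp only [sub_self, zero_smul, norm_zero] at this
        exact this.eventually (gt_mem_nhds one_pos)
      filter_upwards [h1] with β' h1
      have h2 := (hX β).perturb h1
      have h3 : T - β • (1 : E →L[ℂ] E) - (β' - β) • 1 = T - β' • 1 := by
        rw [sub_smul]; abel
      rw [h3] at h2
      exact huniq β' _ _ h2
    refine DifferentiableAt.congr_of_eventuallyEq ?_ hev
    have h1 : DifferentiableAt ℂ (Ring.inverse : (E →L[ℂ] E) → E →L[ℂ] E)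
        (1 - (β - β) • X β) := differentiableAt_inverse (by simp)
    have h2 : DifferentiableAt ℂ (fun β' : ℂ => 1 - (β' - β) • X β) β := by fun_prop
    have h3 := DifferentiableAt.comp β h1 h2
    exact φ.differentiableAt.comp β ((differentiableAt_const (X β)).mul h3)
  have hne : Nontrivial (E →L[ℂ] E) := by
    refine ⟨⟨1, 0, fun h => hφ1 (by rw [h, map_zero])⟩⟩
  have hE0 : Nontrivial E := by
    by_contra h
    rw [not_nontrivial_iff_subsingleton] at h
    exact hE inferInstance
  have hres : ∀ᶠ β in Bornology.cobounded ℂ, φ (X β) = - φ (resolvent T β) ∧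
      (T - β • 1) * resolvent T β = -1 := by
    have h1 : ∀ᶠ β in Bornology.cobounded ℂ, ‖T‖ < ‖β‖ :=
      tendsto_norm_cobounded_atTop.eventually (eventually_gt_atTop _)
    filter_upwards [h1] with β h1
    have h2 : IsUnit (algebraMap ℂ (E →L[ℂ] E) β - T) := spectrum.mem_resolventSet_of_norm_lt h1
    obtain ⟨u, hu⟩ := h2
    have h3 : resolvent T β = ↑u⁻¹ := by rw [resolvent, ← hu, Ring.inverse_unit]
    have h4 : T - β • 1 = - (u : E →L[ℂ] E) := by
      rw [hu, Algebra.algebraMap_eq_smul_one]; abel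
    have h5 : BrowderData (T - β • 1) 0 (-↑u⁻¹ : E →L[ℂ] E) := by
      apply BrowderData.of_right_inverse
      · rw [h4]; simp
      · rw [h4]; simp
    refine ⟨?_, ?_⟩
    · rw [huniq β _ _ h5, h3, map_neg]
    · rw [h3, h4]; simp
  have hlim := spectrum.resolvent_tendsto_cobounded (𝕜 := ℂ) T
  have hφlim : Tendsto (fun β => φ (X β)) (cocompact ℂ) (𝓝 0) := by
    rw [← Metric.cobounded_eq_cocompact]
    have h1 : Tendsto (fun β => - φ (resolvent T β)) (Bornology.cobounded ℂ) (𝓝 0) := by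
      have := ((φ.continuous.tendsto 0).comp hlim).neg
      simpa using this
    refine h1.congr' ?_
    filter_upwards [hres] with β h using h.1.symm
  have hzero : ∀ β, φ (X β) = 0 := fun β => hdiff.apply_eq_of_tendsto_cocompact β hφlim
  have hev : ∀ᶠ β in Bornology.cobounded ℂ, φ (T * resolvent T β) = - φ 1 := by
    filter_upwards [hres] with β h
    have h1 : φ (resolvent T β) = 0 := by
      have := h.1; rw [hzero] at this; simpa using this.symm
    have h2 := congrArg φ h.2
    rw [sub_mul, map_sub, smul_mul_assoc, map_smul, one_mul, h1, smul_zero, sub_zero, map_neg] at h2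
    exact h2
  have hlim2 : Tendsto (fun β => φ (T * resolvent T β)) (Bornology.cobounded ℂ) (𝓝 0) := by
    have hc : Continuous fun S : E →L[ℂ] E => φ (T * S) := by fun_prop
    have := (hc.tendsto 0).comp hlim
    simp only [mul_zero, map_zero] at this
    exact this
  have h3 := tendsto_nhds_unique (hlim2.congr' hev) tendsto_const_nhds
  exact hφ1 (by simpa using h3.symm)

/-- A small shift keeps invertibility off the range of `P`. On that finite-dimensional range it
suffices to avoid finitely many eigenvalues. -/
theorem Browder.exists_isUnit {a : E →L[ℂ] E} (h : Browder a) {ε : ℝ} (hε : 0 < ε) :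
    ∃ δ : ℂ, ‖δ‖ < ε ∧ IsUnit (a - δ • 1) := by
  obtain ⟨P, X, h⟩ := h
  have hc : a * P = P * a := by
    have h3 : P = 1 - a * X := by rw [h.right]; abel
    have h4 : P = 1 - X * a := by rw [h.left]; abel
    nth_rewrite 1 [h4]
    rw [h3]
    noncomm_ring
  have hPP : P * P = P := by
    have h3 : P = 1 - a * X := by rw [h.right]; abel
    nth_rewrite 1 [h3]
    rw [sub_mul, mul_assoc, h.zero_right]; simp
  let W := (P : E →ₗ[ℂ] E).range
  have hW : FiniteDimensional ℂ W := h.fin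
  have haW : ∀ x ∈ W, (a : E →ₗ[ℂ] E) x ∈ W := by
    rintro _ ⟨x, rfl⟩
    exact ⟨a x, (congrArg (fun f : E →L[ℂ] E => f x) hc).symm⟩
  let b : Module.End ℂ W := (a : E →ₗ[ℂ] E).restrict haW
  have hfin := Module.End.finite_hasEigenvalue b
  have hnear : ∀ᶠ δ : ℂ in 𝓝[≠] 0, ‖δ‖ < ε ∧ ‖δ • X‖ < 1 ∧ ¬ b.HasEigenvalue δ := by
    refine (Filter.Eventually.and ?_ (Filter.Eventually.and ?_ ?_))
    · refine eventually_nhdsWithin_of_eventually_nhds ?_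
      have hc : Continuous fun δ : ℂ => ‖δ‖ := by fun_prop
      have := hc.tendsto 0
      rw [norm_zero] at this
      exact this.eventually (gt_mem_nhds hε)
    · refine eventually_nhdsWithin_of_eventually_nhds ?_
      have hc : Continuous fun δ : ℂ => ‖δ • X‖ := by fun_prop
      have := hc.tendsto 0
      simp only [zero_smul, norm_zero] at this
      exact this.eventually (gt_mem_nhds one_pos)
    · have h1 : ({δ | b.HasEigenvalue δ} \ {0}).Finite := hfin.subset Set.sdiff_subset
      have h2 : ({δ | b.HasEigenvalue δ} \ {0})ᶜ ∈ 𝓝 (0 : ℂ) :=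
        h1.isClosed.isOpen_compl.mem_nhds (by simp)
      filter_upwards [mem_nhdsWithin_of_mem_nhds h2, self_mem_nhdsWithin] with δ h3 h4 h5
      exact h3 ⟨h5, h4⟩
  obtain ⟨δ, h1, h2, h3⟩ := hnear.exists
  refine ⟨δ, h1, ?_⟩
  have hd := h.perturb h2
  set Y := X * Ring.inverse (1 - δ • X)
  have hker : ∀ x, (a - δ • 1) x = 0 → x = 0 := by
    intro x hx
    have h4 : x ∈ W := by
      refine ⟨x, ?_⟩
      have h5 := congrArg (fun f : E →L[ℂ] E => f x) hd.left
      simp only [mul_apply_eq_comp, hx, map_zero] at h5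
      exact (sub_eq_zero.1 (h5.symm : x - P x = 0)).symm
    by_contra h0
    refine h3 (Module.End.hasEigenvalue_of_hasEigenvector (x := ⟨x, h4⟩) ?_)
    refine ⟨Module.End.mem_eigenspace_iff.2 (Subtype.ext ?_), by simpa using h0⟩
    exact sub_eq_zero.1 (hx : a x - δ • x = 0)
  rw [ContinuousLinearMap.isUnit_iff_bijective]
  refine ⟨(injective_iff_map_eq_zero _).2 hker, fun y => ?_⟩
  have hinj : Function.Injective ⇑(b - δ • (1 : Module.End ℂ W)) := by
    rw [injective_iff_map_eq_zero]
    rintro ⟨x, hx⟩ hx0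
    exact Subtype.ext (hker x (congrArg Subtype.val hx0))
  obtain ⟨⟨w, hw⟩, hw'⟩ := (LinearMap.injective_iff_surjective.1 hinj) ⟨P y, y, rfl⟩
  refine ⟨Y y + w, ?_⟩
  have h5 := congrArg (fun f : E →L[ℂ] E => f y) hd.right
  have h6 : (a - δ • 1) w = P y := congrArg Subtype.val hw'
  rw [map_add, h6]
  have h7 : (a - δ • 1) (Y y) = y - P y := h5
  rw [h7, sub_add_cancel]

/-- Take `β` of largest modulus in the compact set of bad scalars. Points slightly further out are
Browder, so arbitrarily small additional shifts make the operator invertible. -/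
theorem exists_not_browder_resolventSeq (hE : ¬ FiniteDimensional ℂ E) (T : E →L[ℂ] E) :
    ∃ (β : ℂ) (κ : ℕ → ℂ) (r : ℕ → E →L[ℂ] E), ¬ Browder (T - β • 1) ∧
      ResolventSeq (T - β • 1) κ r := by
  let N : Set ℂ := {β | ¬ Browder (T - β • 1)}
  have hE0 : Nontrivial E := by
    by_contra h
    rw [not_nontrivial_iff_subsingleton] at h
    exact hE inferInstance
  have hopen : IsOpen Nᶜ := by
    rw [isOpen_iff_mem_nhds]
    intro β hβ
    obtain ⟨P, X, h⟩ := not_not.1 hβ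
    have h1 : ∀ᶠ β' in 𝓝 β, ‖(β' - β) • X‖ < 1 := by
      have hc : Continuous fun β' : ℂ => ‖(β' - β) • X‖ := by fun_prop
      have := hc.tendsto β
      simp only [sub_self, zero_smul, norm_zero] at this
      exact this.eventually (gt_mem_nhds one_pos)
    filter_upwards [h1] with β' h1
    have h2 := h.perturb h1
    have h3 : T - β • (1 : E →L[ℂ] E) - (β' - β) • 1 = T - β' • 1 := by
      rw [sub_smul]; abel
    rw [h3] at h2
    exact not_not.2 ⟨_, _, h2⟩
  have hbdd : N ⊆ Metric.closedBall 0 ‖T‖ := by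
    intro β hβ
    rw [mem_closedBall_zero_iff]
    by_contra h
    refine hβ ?_
    obtain ⟨u, hu⟩ : IsUnit (algebraMap ℂ (E →L[ℂ] E) β - T) :=
      spectrum.mem_resolventSet_of_norm_lt (not_le.1 h)
    have h4 : T - β • 1 = - (u : E →L[ℂ] E) := by
      rw [hu, Algebra.algebraMap_eq_smul_one]; abel
    refine ⟨0, (-↑u⁻¹ : E →L[ℂ] E), BrowderData.of_right_inverse ?_ ?_⟩
    · rw [h4]; simp
    · rw [h4]; simp
  have hcomp : IsCompact N :=
    (isCompact_closedBall (0 : ℂ) ‖T‖).of_isClosed_subset (isOpen_compl_iff.1 hopen) hbdd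
  obtain ⟨β, hβ, hmax⟩ := hcomp.exists_isMaxOn (exists_not_browder hE T) continuous_norm.continuousOn
  have hstep : ∀ n : ℕ, ∃ κ : ℂ, ‖κ‖ ≤ 1 / ((n : ℝ) + 1) ∧ IsUnit (T - β • 1 - κ • 1) := by
    intro n
    set η : ℝ := 1 / ((n : ℝ) + 1) with hη
    have hη0 : 0 < η := by positivity
    obtain ⟨t, ht, ht2⟩ : ∃ t : ℂ, ‖t‖ ≤ η / 2 ∧ ‖β‖ < ‖β + t‖ := by
      by_cases h0 : β = 0
      · refine ⟨((η / 2 : ℝ) : ℂ), ?_, ?_⟩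
        · rw [Complex.norm_real, Real.norm_of_nonneg (by positivity)]
        · rw [h0, zero_add, Complex.norm_real, Real.norm_of_nonneg (by positivity), norm_zero]
          positivity
      · have hb : 0 < ‖β‖ := norm_pos_iff.2 h0
        refine ⟨((η / 2 / ‖β‖ : ℝ) : ℂ) * β, ?_, ?_⟩
        · rw [norm_mul, Complex.norm_real, Real.norm_of_nonneg (by positivity)]
          rw [div_mul_cancel₀ _ hb.ne']
        · have h1 : β + ((η / 2 / ‖β‖ : ℝ) : ℂ) * β = ((1 + η / 2 / ‖β‖ : ℝ) : ℂ) * β := by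
            push_cast; ring
          rw [h1, norm_mul, Complex.norm_real, Real.norm_of_nonneg (by positivity)]
          have : 0 < η / 2 / ‖β‖ := by positivity
          nlinarith
    have hB : Browder (T - (β + t) • 1) := by
      by_contra h
      exact absurd (hmax h) (by simpa using ht2)
    obtain ⟨δ, hδ, hu⟩ := hB.exists_isUnit (ε := η / 2) (by positivity)
    refine ⟨t + δ, ?_, ?_⟩
    · exact (norm_add_le _ _).trans (by linarith)
    · have h3 : T - β • (1 : E →L[ℂ] E) - (t + δ) • 1 = T - (β + t) • 1 - δ • 1 := by
        simp only [add_smul]; abel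
      rw [h3]; exact hu
  choose κ hκ hu using hstep
  choose u hu using hu
  refine ⟨β, κ, fun n => ↑(u n)⁻¹, hβ, ⟨?_, ?_, ?_⟩⟩
  · exact squeeze_zero_norm hκ tendsto_one_div_add_atTop_nhds_zero_nat
  · intro n x
    have h1 : ((u n : E →L[ℂ] E) * ↑(u n)⁻¹) x = x := by rw [Units.mul_inv]; rfl
    rw [hu] at h1
    exact sub_eq_iff_eq_add.1 h1
  · intro n x
    have h1 : ((↑(u n)⁻¹ : E →L[ℂ] E) * (u n : E →L[ℂ] E)) x = x := by rw [Units.inv_mul]; rfl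
    rw [hu] at h1
    have h2 : (↑(u n)⁻¹ : E →L[ℂ] E) ((T - β • 1) x - κ n • x) = x := h1
    rw [map_sub, map_smul] at h2
    exact sub_eq_iff_eq_add.1 h2

end Browder

/-! ### Construction of approximate eigenvectors -/

section Engine

open Polynomial

variable {E : Type*} [NormedAddCommGroup E] [InnerProductSpace ℂ E]

/-- The monic polynomial vanishing at the points of `κ` indexed by `s`. -/
noncomputable def pointPoly (κ : ℕ → ℂ) (s : Finset ℕ) : ℂ[X] := ∏ n ∈ s, (X - C (κ n))

theorem pointPoly_insert (κ : ℕ → ℂ) {s : Finset ℕ} {n : ℕ} (hn : n ∉ s) :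
    pointPoly κ (insert n s) = pointPoly κ s * (X - C (κ n)) := by
  rw [pointPoly, Finset.prod_insert hn, mul_comm]; rfl

theorem pointPoly_eval_zero_ne {κ : ℕ → ℂ} (hκ : ∀ n, κ n ≠ 0) (s : Finset ℕ) :
    (pointPoly κ s).eval 0 ≠ 0 := by
  rw [pointPoly, eval_prod, Finset.prod_ne_zero_iff]
  intro n _
  simpa using hκ n

theorem natDegree_pointPoly (κ : ℕ → ℂ) (s : Finset ℕ) : (pointPoly κ s).natDegree = s.card := by
  rw [pointPoly, natDegree_prod_of_monic _ _ fun n _ => monic_X_sub_C _]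
  simp

theorem aeval_mul_X_sub_C_apply (D : E →L[ℂ] E) (p : ℂ[X]) (z : ℂ) (u : E) :
    aeval D (p * (X - C z)) u = aeval D p (D u - z • u) := by
  rw [map_mul, mul_apply_eq_comp, map_sub, aeval_X, aeval_C, Algebra.algebraMap_eq_smul_one]
  rfl

theorem apply_aeval_apply (D : E →L[ℂ] E) (p : ℂ[X]) (u : E) :
    D (aeval D p u) = aeval D p (D u) := by
  have h : D * aeval D p = aeval D p * D := by
    nth_rewrite 1 [← aeval_X (R := ℂ) D]
    nth_rewrite 4 [← aeval_X (R := ℂ) D]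
    rw [← map_mul, ← map_mul, mul_comm]
  exact congrArg (fun f : E →L[ℂ] E => f u) h

/-- Meant for `z` nearly killed by `D`: there a polynomial in `D` is nearly multiplication by its
value at zero. -/
theorem aeval_eq_eval_zero_add (D : E →L[ℂ] E) (p : ℂ[X]) (z : E) :
    aeval D p z = p.eval 0 • z + aeval D p.divX (D z) := by
  conv_lhs => rw [← divX_mul_X_add p]
  rw [map_add, map_mul, aeval_X, aeval_C, Algebra.algebraMap_eq_smul_one,
    coeff_zero_eq_eval_zero, add_comm]
  rfl

/-- Start from `v` with `D v` near `u` and add `a • z`, where `z` is a unit vector nearly killed by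
`D`. As `Q z` is nearly `q • z`, the choice `c = 1 / (a * q)` makes `c • Q (v + a • z)` close to `z`
once `a` is large. The order of choices matters: `a` first, then `z` depending on `a`, then `n` with
`κ n` small against the vector obtained, and last a tiny move off `K`. -/
theorem engine_step {D : E →L[ℂ] E} {Y : Submodule ℂ E} {u : E}
    (hu : ∀ ε : ℝ, 0 < ε → ∃ v ∈ Y, ‖D v - u‖ < ε) (hs : SingularOn D Y) {κ : ℕ → ℂ}
    (hκ : Tendsto κ atTop (𝓝 0)) (hκ0 : ∀ n, κ n ≠ 0) (s : Finset ℕ) (F : Submodule ℂ E)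
    [FiniteDimensional ℂ F] {η : ℝ} (hη : 0 < η) (K : Set E)
    (hK : ∀ s : Finset ℕ, ∀ u ∈ Y, ∀ ε : ℝ, 0 < ε → ∃ u' ∈ Y, ‖u' - u‖ < ε ∧
      aeval D (pointPoly κ s) u' ∉ K) :
    ∃ u' ∈ Y, ∃ (n : ℕ) (c : ℂ) (e : E), (∀ m ∈ s, m < n) ∧ c ≠ 0 ∧ ‖c‖ < η ∧ e ∈ Fᗮ ∧ ‖e‖ = 1 ∧
      ‖c • aeval D (pointPoly κ s) u' - e‖ < η ∧ ‖D u' - κ n • u' - u‖ < η ∧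
      aeval D (pointPoly κ (insert n s)) u' ∉ K := by
  set Q := aeval D (pointPoly κ s) with hQ
  set q := (pointPoly κ s).eval 0 with hq
  have hq0 : q ≠ 0 := pointPoly_eval_zero_ne hκ0 s
  set R := aeval D (pointPoly κ s).divX with hR
  obtain ⟨v, hv, hvu⟩ := hu (η / 4) (by positivity)
  have hqn : 0 < ‖q‖ := norm_pos_iff.2 hq0
  obtain ⟨a, ha0, ha1, ha2⟩ : ∃ a : ℝ, 0 < a ∧ 1 / (a * ‖q‖) < η ∧
      1 / (a * ‖q‖) * ‖Q v‖ < η / 4 := by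
    have h1 : Tendsto (fun a : ℝ => 1 / (a * ‖q‖)) atTop (𝓝 0) := by
      simp only [one_div]
      exact tendsto_inv_atTop_zero.comp (tendsto_id.atTop_mul_const hqn)
    have h2 : Tendsto (fun a : ℝ => 1 / (a * ‖q‖) * ‖Q v‖) atTop (𝓝 0) := by
      simpa using h1.mul_const ‖Q v‖
    obtain ⟨a, h3, h4, h5⟩ := ((h1.eventually (gt_mem_nhds hη)).and
      ((h2.eventually (gt_mem_nhds (show 0 < η / 4 by positivity))).and
        (eventually_gt_atTop 0))).exists
    exact ⟨a, h5, h3, h4⟩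
  set c : ℂ := 1 / ((a : ℂ) * q) with hc
  have hcn : ‖c‖ = 1 / (a * ‖q‖) := by
    rw [hc, norm_div, norm_mul, Complex.norm_real, Real.norm_of_nonneg ha0.le, norm_one]
  have ha0' : (a : ℂ) ≠ 0 := Complex.ofReal_ne_zero.2 ha0.ne'
  have hc0 : c ≠ 0 := one_div_ne_zero (mul_ne_zero ha0' hq0)
  obtain ⟨z, hz, hzF, hz1, hzD⟩ := hs F inferInstance
    (min (η / 4 / (a + 1)) (η / 4 / (‖c‖ * a * ‖R‖ + 1))) (by positivity)
  obtain ⟨hzD1, hzD2⟩ := lt_min_iff.1 hzD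
  rw [lt_div_iff₀ (by positivity)] at hzD1 hzD2
  set u1 := v + (a : ℂ) • z with hu1
  have hu1Y : u1 ∈ Y := add_mem hv (Y.smul_mem _ hz)
  have hDu1 : ‖D u1 - u‖ < η / 2 := by
    have h1 : D u1 - u = (D v - u) + (a : ℂ) • D z := by
      rw [hu1, map_add, map_smul]; abel
    rw [h1]
    refine (norm_add_le _ _).trans_lt ?_
    rw [norm_smul, Complex.norm_real, Real.norm_of_nonneg ha0.le]
    nlinarith [norm_nonneg (D z)]
  have hQu1 : ‖c • Q u1 - z‖ < η / 2 := by
    have h1 : c • Q u1 - z = c • Q v + (c * a) • R (D z) := by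
      have h2 : Q z = q • z + R (D z) := aeval_eq_eval_zero_add D _ z
      rw [hu1, map_add, map_smul, h2]
      simp only [smul_add, smul_smul]
      have h3 : c * (a * q) = 1 := by rw [hc]; field_simp
      rw [h3, one_smul]
      abel
    rw [h1]
    refine (norm_add_le _ _).trans_lt ?_
    have h4 : ‖(c * a) • R (D z)‖ ≤ ‖c‖ * a * (‖R‖ * ‖D z‖) := by
      rw [norm_smul, norm_mul, Complex.norm_real, Real.norm_of_nonneg ha0.le]
      exact mul_le_mul_of_nonneg_left (R.le_opNorm _) (by positivity)
    rw [norm_smul, hcn]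
    nlinarith [norm_nonneg (D z)]
  obtain ⟨n, hn1, hn2⟩ : ∃ n : ℕ, (∀ m ∈ s, m < n) ∧ ‖κ n‖ * ‖u1‖ < η / 4 := by
    have h1 : Tendsto (fun n => ‖κ n‖ * ‖u1‖) atTop (𝓝 0) := by
      simpa using hκ.norm.mul_const ‖u1‖
    obtain ⟨n, h2, h3⟩ := ((h1.eventually (gt_mem_nhds (show 0 < η / 4 by positivity))).and
      (eventually_gt_atTop (s.sup id))).exists
    exact ⟨n, fun m hm => lt_of_le_of_lt (Finset.le_sup (f := id) hm) h3, h2⟩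
  obtain ⟨u', hu', hu'1, hu'2⟩ := hK (insert n s) u1 hu1Y
    (η / 4 / (‖c‖ * ‖Q‖ + ‖D‖ + ‖κ n‖ + 1)) (by positivity)
  rw [lt_div_iff₀ (by positivity)] at hu'1
  have hd := norm_nonneg (u' - u1)
  refine ⟨u', hu', n, c, z, hn1, hc0, by rwa [hcn], hzF, hz1, ?_, ?_, hu'2⟩
  · have h1 : c • Q u' - z = (c • Q u1 - z) + c • Q (u' - u1) := by
      rw [map_sub, smul_sub]; abel
    rw [h1]
    refine (norm_add_le _ _).trans_lt ?_
    have h2 : ‖c • Q (u' - u1)‖ ≤ ‖c‖ * (‖Q‖ * ‖u' - u1‖) := by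
      rw [norm_smul]
      exact mul_le_mul_of_nonneg_left (Q.le_opNorm _) (norm_nonneg _)
    nlinarith [mul_nonneg (norm_nonneg D) hd, mul_nonneg (norm_nonneg (κ n)) hd]
  · have h1 : D u' - κ n • u' - u = (D u1 - u) + (- (κ n • u1)) + (D (u' - u1) + -(κ n • (u' - u1))) := by
      rw [map_sub, smul_sub]; abel
    rw [h1]
    refine (norm_add₃_le).trans_lt ?_
    have h2 : ‖D (u' - u1) + -(κ n • (u' - u1))‖ ≤ ‖D‖ * ‖u' - u1‖ + ‖κ n‖ * ‖u' - u1‖ := by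
      refine (norm_add_le _ _).trans (add_le_add (D.le_opNorm _) ?_)
      rw [norm_neg, norm_smul]
    rw [norm_neg, norm_smul]
    nlinarith [mul_nonneg (mul_nonneg (norm_nonneg c) (norm_nonneg Q)) hd]

theorem exists_dependent_seq {α : Type*} (G : ℕ → α → Prop) (R : ℕ → α → α → Prop)
    (h0 : ∃ a, G 0 a) (hs : ∀ k a, G k a → ∃ a', G (k + 1) a' ∧ R k a a') :
    ∃ σ : ℕ → α, (∀ k, G k (σ k)) ∧ ∀ k, R k (σ k) (σ (k + 1)) := by
  choose f hf using hs
  obtain ⟨a, ha⟩ := h0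
  let σ : (k : ℕ) → {a // G k a} := fun k =>
    Nat.rec ⟨a, ha⟩ (fun k x => ⟨f k x.1 x.2, (hf k x.1 x.2).1⟩) k
  exact ⟨fun k => (σ k).1, fun k => (σ k).2, fun k => (hf k (σ k).1 (σ k).2).2⟩

theorem exists_limit_of_halving [CompleteSpace E] {x : ℕ → E} {r : ℕ → ℝ}
    (hx : ∀ k, ‖x (k + 1) - x k‖ ≤ r k) (hr : ∀ k, r (k + 1) ≤ r k / 2) :
    ∃ l, Tendsto x atTop (𝓝 l) ∧ ∀ k, ‖l - x k‖ ≤ 2 * r k := by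
  have hgeo : ∀ k m, r (k + m) ≤ 2 * r k / 2 / 2 ^ m := by
    intro k m
    induction m with
    | zero => simp
    | succ m ih =>
      have h1 := hr (k + m)
      rw [pow_succ, ← div_div]
      rw [← add_assoc]
      linarith
  have hd : ∀ k m, dist (x (k + m)) (x (k + m + 1)) ≤ 2 * r k / 2 / 2 ^ m := by
    intro k m
    rw [dist_comm, dist_eq_norm]
    exact (hx _).trans (hgeo k m)
  obtain ⟨l, hl⟩ := cauchySeq_tendsto_of_complete
    (cauchySeq_of_le_geometric_two (f := x) (C := 2 * r 0) (by simpa using hd 0))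
  refine ⟨l, hl, fun k => ?_⟩
  have hl' : Tendsto (fun m => x (k + m)) atTop (𝓝 l) := by
    have := (tendsto_add_atTop_iff_nat k).2 hl
    simpa [add_comm] using this
  have := dist_le_of_le_geometric_two_of_tendsto₀ (f := fun m => x (k + m)) (hd k) hl'
  rwa [add_zero, dist_comm, dist_eq_norm] at this

/-- `r` bounds the next change of the vectors under control and at least halves at each stage, so
all later movement is at most `2 * r`. `F` collects the directions to which the next `e` must be
orthogonal. -/
structure EngineState (E : Type*) [NormedAddCommGroup E] [InnerProductSpace ℂ E] where
  points : Finset ℕ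
  n : ℕ
  c : ℂ
  e : E
  u : E
  r : ℝ
  F : Submodule ℂ E

/-- The construction of approximate eigenvectors: vectors `g j` close to an orthonormal sequence,
with `(D - κ (n j)) (g j) = c j • h` for a fixed `h` avoiding given closed sets. -/
theorem exists_eigen_family [CompleteSpace E] {D : E →L[ℂ] E} {Y : ℕ → Submodule ℂ E}
    (hY : ∀ k, ∀ u ∈ Y k, ∀ ε : ℝ, 0 < ε → ∃ v ∈ Y (k + 1), ‖D v - u‖ < ε)
    (hs : ∀ k, SingularOn D (Y k)) {κ : ℕ → ℂ} (hκ : Tendsto κ atTop (𝓝 0)) (hκ0 : ∀ n, κ n ≠ 0)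
    {K : ℕ → Set E} (hKc : ∀ j, IsClosed (K j))
    (hK : ∀ k j, ∀ s : Finset ℕ, ∀ u ∈ Y k, ∀ ε : ℝ, 0 < ε → ∃ u' ∈ Y k, ‖u' - u‖ < ε ∧
      aeval D (pointPoly κ s) u' ∉ K j)
    {W : Set E} (hWc : IsClosed W) (hWs : ∀ c : ℂ, ∀ x ∈ W, c • x ∈ W)
    (hW : ∀ k, ∀ q : ℂ[X], q.natDegree < k → ∀ u ∈ Y k, aeval D q u ∈ W)
    (G : Submodule ℂ E) [FiniteDimensional ℂ G] {δ : ℕ → ℝ} (hδ : ∀ j, 0 < δ j) :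
    ∃ (n : ℕ → ℕ) (e g : ℕ → E) (h : E) (c : ℕ → ℂ), StrictMono n ∧ Orthonormal ℂ e ∧
      (∀ j, e j ∈ Gᗮ) ∧ (∀ j, c j ≠ 0) ∧ (∀ j, ‖c j‖ ≤ δ j) ∧ (∀ j, ‖g j - e j‖ ≤ δ j) ∧
      (∀ j, D (g j) = κ (n j) • g j + c j • h) ∧ (∀ j, g j ∈ W) ∧ ∀ j, h ∉ K j := by
  -- With `S` the set of points used so far, `Q S u` converges to `h`, and `Q (S.erase m) u`
  -- converges to a vector `l` with `(D - κ m) l = h`. The approximate eigenvectors are the rescaled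
  -- `c • l`.
  let Q : Finset ℕ → E →L[ℂ] E := fun s => aeval D (pointPoly κ s)
  have hQins : ∀ s n u, n ∉ s → Q (insert n s) u = Q s (D u - κ n • u) := by
    intro s n u hn
    change aeval D (pointPoly κ (insert n s)) u = _
    rw [pointPoly_insert κ hn, aeval_mul_X_sub_C_apply]
  let Good : ℕ → EngineState E → Prop := fun k σ =>
    σ.u ∈ Y k ∧ 0 < σ.r ∧ FiniteDimensional ℂ σ.F ∧ σ.points.card = k ∧ G ≤ σ.F
  let Rel : ℕ → EngineState E → EngineState E → Prop := fun k σ σ' =>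
    (∀ m ∈ σ.points, m < σ'.n) ∧ σ'.points = insert σ'.n σ.points ∧
    σ'.F = σ.F ⊔ Submodule.span ℂ {σ'.e} ∧ σ'.e ∈ σ.Fᗮ ∧ ‖σ'.e‖ = 1 ∧ σ'.c ≠ 0 ∧ ‖σ'.c‖ ≤ δ k ∧
    ‖σ'.c • Q σ.points σ'.u - σ'.e‖ ≤ δ k / 2 ∧
    ‖Q σ'.points σ'.u - Q σ.points σ.u‖ ≤ σ.r ∧
    (∀ m ∈ σ.points, ‖Q (σ'.points.erase m) σ'.u - Q (σ.points.erase m) σ.u‖ ≤ σ.r) ∧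
    σ'.r ≤ σ.r / 2 ∧ ‖σ'.c‖ * (2 * σ'.r) ≤ δ k / 2 ∧
    ∀ x, ‖x - Q σ'.points σ'.u‖ ≤ 2 * σ'.r → x ∉ K k
  have hstep : ∀ k σ, Good k σ → ∃ σ', Good (k + 1) σ' ∧ Rel k σ σ' := by
    rintro k σ ⟨h1, h2, h3, h4, hGF⟩
    set M : ℝ := ‖Q σ.points‖ + ∑ m ∈ σ.points, ‖Q (σ.points.erase m)‖ + 1 with hM
    have hsum : 0 ≤ ∑ m ∈ σ.points, ‖Q (σ.points.erase m)‖ :=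
      Finset.sum_nonneg fun _ _ => norm_nonneg _
    have hM0 : 0 < M := by positivity
    obtain ⟨u', hu', n, c, e, hn, hc0, hc, he, he1, hce, hD, hK'⟩ :=
      engine_step (hY k σ.u h1) (hs (k + 1)) hκ hκ0 σ.points σ.F
        (η := min (δ k / 2) (σ.r / M)) (lt_min (half_pos (hδ k)) (by positivity))
        (K k) (hK (k + 1) k)
    have hn' : n ∉ σ.points := fun h => lt_irrefl _ (hn n h)
    obtain ⟨r0, hr0, hball⟩ : ∃ r0 > 0, ∀ x, ‖x - Q (insert n σ.points) u'‖ ≤ r0 → x ∉ K k := by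
      have : (K k)ᶜ ∈ 𝓝 (Q (insert n σ.points) u') := (hKc k).isOpen_compl.mem_nhds hK'
      obtain ⟨r0, hr0, hb⟩ := Metric.nhds_basis_closedBall.mem_iff.1 this
      exact ⟨r0, hr0, fun x hx => hb (by rwa [Metric.mem_closedBall, dist_eq_norm])⟩
    have hcp : 0 < ‖c‖ := norm_pos_iff.2 hc0
    have hδk := hδ k
    -- The three bounds serve the convergence, the avoidance of `K k` by the limit, and the
    -- closeness of the rescaled limit to `e`.
    set r' := min (σ.r / 2) (min (r0 / 2) (δ k / 4 / ‖c‖)) with hr'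
    have hr'1 : r' ≤ σ.r / 2 := min_le_left _ _
    have hr'2 : r' ≤ r0 / 2 := (min_le_right _ _).trans (min_le_left _ _)
    have hr'3 : r' ≤ δ k / 4 / ‖c‖ := (min_le_right _ _).trans (min_le_right _ _)
    have hDM : ‖D u' - κ n • u' - σ.u‖ * M ≤ σ.r := by
      have := hD.le.trans (min_le_right _ _)
      rwa [le_div_iff₀ hM0] at this
    have hdn := norm_nonneg (D u' - κ n • u' - σ.u)
    refine ⟨⟨insert n σ.points, n, c, e, u', r', σ.F ⊔ Submodule.span ℂ {e}⟩,
      ⟨hu', lt_min (by positivity) (by positivity), inferInstance, ?_,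
      hGF.trans le_sup_left⟩, hn, rfl, rfl, he, he1, hc0, ?_, ?_, ?_, ?_, hr'1, ?_, ?_⟩
    · rw [Finset.card_insert_of_notMem hn', h4]
    · exact (hc.le.trans (min_le_left _ _)).trans (by linarith)
    · exact hce.le.trans (min_le_left _ _)
    · change ‖Q (insert n σ.points) u' - Q σ.points σ.u‖ ≤ σ.r
      rw [hQins _ _ _ hn', ← map_sub]
      refine (ContinuousLinearMap.le_opNorm _ _).trans (le_trans ?_ hDM)
      rw [mul_comm]
      refine mul_le_mul_of_nonneg_left ?_ hdn
      linarith
    · intro m hm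
      change ‖Q ((insert n σ.points).erase m) u' - Q (σ.points.erase m) σ.u‖ ≤ σ.r
      have hnm : n ≠ m := fun h => hn' (h ▸ hm)
      rw [Finset.erase_insert_of_ne hnm, hQins _ _ _ fun h => hn' (Finset.mem_of_mem_erase h),
        ← map_sub]
      refine (ContinuousLinearMap.le_opNorm _ _).trans (le_trans ?_ hDM)
      rw [mul_comm]
      refine mul_le_mul_of_nonneg_left ?_ hdn
      have := Finset.single_le_sum (f := fun m => ‖Q (σ.points.erase m)‖)
        (fun _ _ => norm_nonneg _) hm
      have h5 := norm_nonneg (Q σ.points)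
      linarith
    · rw [le_div_iff₀ hcp] at hr'3
      change ‖c‖ * (2 * r') ≤ δ k / 2
      linarith
    · intro x hx
      exact hball x (hx.trans (by linarith))
  obtain ⟨σ, hG, hR⟩ := exists_dependent_seq Good Rel
    ⟨⟨∅, 0, 0, 0, 0, 1, G⟩, (Y 0).zero_mem, one_pos, inferInstance, rfl, le_rfl⟩ hstep
  have hr : ∀ k, (σ (k + 1)).r ≤ (σ k).r / 2 := fun k => (hR k).2.2.2.2.2.2.2.2.2.2.1
  have hpts : ∀ k, (σ (k + 1)).points = insert (σ (k + 1)).n (σ k).points := fun k => (hR k).2.1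
  have hnew : ∀ k, ∀ m ∈ (σ k).points, m < (σ (k + 1)).n := fun k => (hR k).1
  have hmem : ∀ j m, (σ (j + 1)).n ∈ (σ (j + 1 + m)).points := by
    intro j m
    induction m with
    | zero => rw [add_zero, hpts]; exact Finset.mem_insert_self _ _
    | succ m ih => rw [← add_assoc, hpts]; exact Finset.mem_insert_of_mem ih
  have hn : StrictMono fun j => (σ (j + 1)).n := by
    refine strictMono_nat_of_lt_succ fun j => ?_
    exact hnew (j + 1) _ (by simpa using hmem j 0)
  have hFmono : ∀ j m, (σ j).F ≤ (σ (j + m)).F := by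
    intro j m
    induction m with
    | zero => exact le_rfl
    | succ m ih => rw [← add_assoc, (hR _).2.2.1]; exact ih.trans le_sup_left
  have heF : ∀ j, (σ (j + 1)).e ∈ (σ j).Fᗮ := fun j => (hR j).2.2.2.1
  have heF' : ∀ j, (σ (j + 1)).e ∈ (σ (j + 1)).F := by
    intro j
    rw [(hR j).2.2.1]
    exact (le_sup_right : _ ≤ (σ j).F ⊔ _) (Submodule.mem_span_singleton_self _)
  obtain ⟨h, hlim, hlim2⟩ := exists_limit_of_halving (x := fun k => Q (σ k).points (σ k).u)
    (fun k => (hR k).2.2.2.2.2.2.2.2.1) hr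
  have hex : ∀ j, ∃ l, Tendsto (fun m => Q ((σ (j + 1 + m)).points.erase (σ (j + 1)).n)
      (σ (j + 1 + m)).u) atTop (𝓝 l) ∧ ∀ m, ‖l - Q ((σ (j + 1 + m)).points.erase (σ (j + 1)).n)
      (σ (j + 1 + m)).u‖ ≤ 2 * (σ (j + 1 + m)).r := fun j =>
    exists_limit_of_halving (fun m => (hR (j + 1 + m)).2.2.2.2.2.2.2.2.2.1 _ (hmem j m))
      (fun m => hr _)
  choose l hl hl2 using hex
  have herase : ∀ j, (σ (j + 1)).points.erase (σ (j + 1)).n = (σ j).points := by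
    intro j
    rw [hpts, Finset.erase_insert fun h => lt_irrefl _ (hnew j _ h)]
  refine ⟨fun j => (σ (j + 1)).n, fun j => (σ (j + 1)).e, fun j => (σ (j + 1)).c • l j, h,
    fun j => (σ (j + 1)).c, hn, ?_, ?_, ?_, ?_, ?_, ?_, ?_, ?_⟩
  · refine ⟨fun j => (hR j).2.2.2.2.1, ?_⟩
    have hlt : ∀ i j, i < j → inner ℂ (σ (i + 1)).e (σ (j + 1)).e = 0 := by
      intro i j hij
      obtain ⟨m, rfl⟩ := Nat.exists_eq_add_of_lt hij
      refine heF (i + m + 1) _ ?_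
      rw [show i + m + 1 = i + 1 + m by omega]
      exact hFmono (i + 1) m (heF' i)
    intro i j hij
    rcases lt_or_gt_of_ne hij with h' | h'
    · exact hlt i j h'
    · exact inner_eq_zero_symm.1 (hlt j i h')
  · exact fun j => Submodule.orthogonal_le (hG j).2.2.2.2 (heF j)
  · exact fun j => (hR j).2.2.2.2.2.1
  · exact fun j => (hR j).2.2.2.2.2.2.1
  · intro j
    have h1 := hl2 j 0
    rw [add_zero, herase] at h1
    have h2 : (σ (j + 1)).c • l j - (σ (j + 1)).e =
        (σ (j + 1)).c • (l j - Q (σ j).points (σ (j + 1)).u) +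
        ((σ (j + 1)).c • Q (σ j).points (σ (j + 1)).u - (σ (j + 1)).e) := by
      rw [smul_sub]; abel
    have h3 := (hR j).2.2.2.2.2.2.2.1
    have h4 := (hR j).2.2.2.2.2.2.2.2.2.2.2.1
    have h5 := (mul_le_mul_of_nonneg_left h1 (norm_nonneg (σ (j + 1)).c)).trans h4
    change ‖(σ (j + 1)).c • l j - (σ (j + 1)).e‖ ≤ δ j
    rw [h2]
    refine (norm_add_le _ _).trans ?_
    rw [norm_smul]
    linarith
  · intro j
    have h1 : D (l j) = κ (σ (j + 1)).n • l j + h := by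
      have h2 : Tendsto (fun m => Q (σ (j + 1 + m)).points (σ (j + 1 + m)).u) atTop (𝓝 h) := by
        have := (tendsto_add_atTop_iff_nat (j + 1)).2 hlim
        simpa [add_comm] using this
      have h3 : Tendsto (fun m => D (Q ((σ (j + 1 + m)).points.erase (σ (j + 1)).n)
          (σ (j + 1 + m)).u) - κ (σ (j + 1)).n • Q ((σ (j + 1 + m)).points.erase (σ (j + 1)).n)
          (σ (j + 1 + m)).u) atTop (𝓝 (D (l j) - κ (σ (j + 1)).n • l j)) :=
        ((D.continuous.tendsto _).comp (hl j)).sub ((hl j).const_smul _)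
      have h4 : (fun m => Q (σ (j + 1 + m)).points (σ (j + 1 + m)).u) =
          fun m => D (Q ((σ (j + 1 + m)).points.erase (σ (j + 1)).n)
          (σ (j + 1 + m)).u) - κ (σ (j + 1)).n • Q ((σ (j + 1 + m)).points.erase (σ (j + 1)).n)
          (σ (j + 1 + m)).u := by
        funext m
        rw [show D (Q ((σ (j + 1 + m)).points.erase (σ (j + 1)).n) (σ (j + 1 + m)).u) =
          Q ((σ (j + 1 + m)).points.erase (σ (j + 1)).n) (D (σ (j + 1 + m)).u) from
          apply_aeval_apply _ _ _, ← map_smul, ← map_sub, ← hQins _ _ _ (Finset.notMem_erase _ _),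
          Finset.insert_erase (hmem j m)]
      rw [h4] at h2
      rw [tendsto_nhds_unique h2 h3]
      abel
    change D ((σ (j + 1)).c • l j) = κ (σ (j + 1)).n • (σ (j + 1)).c • l j + (σ (j + 1)).c • h
    rw [map_smul, h1, smul_add, smul_comm]
  · intro j
    refine hWs _ _ (hWc.mem_of_tendsto (hl j) (.of_forall fun m => ?_))
    refine hW (j + 1 + m) _ ?_ _ (hG _).1
    rw [natDegree_pointPoly, Finset.card_erase_of_mem (hmem j m), (hG _).2.2.2.1]
    omega
  · intro j
    have h1 : ‖h - Q (σ (j + 1)).points (σ (j + 1)).u‖ ≤ 2 * (σ (j + 1)).r := hlim2 (j + 1)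
    exact (hR j).2.2.2.2.2.2.2.2.2.2.2.2 _ h1

end Engine

/-! ### Two mutually orthogonal families -/

section Families

open Polynomial

variable {E : Type*} [NormedAddCommGroup E] [InnerProductSpace ℂ E]

/-- The projection of `V` into `G` has a bounded linear section on its finite-dimensional range.
Subtracting the section of the component in `G` costs only a multiple of the distance to `y`. -/
theorem exists_mem_orthogonal_near {V : Submodule ℂ E} {y : E}
    (hy : ∀ ε : ℝ, 0 < ε → ∃ v ∈ V, ‖v - y‖ < ε) (G : Submodule ℂ E) [FiniteDimensional ℂ G]
    (hyG : y ∈ Gᗮ) {ε : ℝ} (hε : 0 < ε) : ∃ w ∈ V, w ∈ Gᗮ ∧ ‖w - y‖ < ε := by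
  let p : V →ₗ[ℂ] G := (G.orthogonalProjectionOnto : E →ₗ[ℂ] G) ∘ₗ V.subtype
  obtain ⟨s, hs⟩ := p.rangeRestrict.exists_rightInverse_of_surjective p.range_rangeRestrict
  let s' : p.range →L[ℂ] E := LinearMap.toContinuousLinearMap (V.subtype ∘ₗ s)
  have hps : ∀ w : p.range, G.orthogonalProjectionOnto (s' w) = w := fun w =>
    congrArg Subtype.val (LinearMap.congr_fun hs w)
  obtain ⟨v, hv, hvy⟩ := hy (ε / (‖s'‖ + 1)) (by positivity)
  rw [lt_div_iff₀ (by positivity)] at hvy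
  let w : p.range := ⟨p ⟨v, hv⟩, ⟨v, hv⟩, rfl⟩
  have hwn : ‖w‖ ≤ ‖v - y‖ := by
    have h1 : (w : G) = G.orthogonalProjectionOnto (v - y) := by
      rw [map_sub, Submodule.orthogonalProjectionOnto_eq_zero_iff.2 hyG, sub_zero]; rfl
    change ‖(w : G)‖ ≤ _
    rw [h1]
    exact Submodule.norm_orthogonalProjectionOnto_apply_le _ _
  refine ⟨v - s' w, sub_mem hv (s w).2, ?_, ?_⟩
  · rw [← Submodule.orthogonalProjectionOnto_eq_zero_iff, map_sub, hps]
    exact sub_self _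
  · have h1 : v - s' w - y = (v - y) - s' w := by abel
    rw [h1]
    refine (norm_sub_le _ _).trans_lt ?_
    have h2 := s'.le_opNorm w
    nlinarith [norm_nonneg s', norm_nonneg (v - y)]

/-- The functional defined by `g` on `Z` is not dominated by `y ↦ ‖A y‖`. -/
def NotDominated (A : E →L[ℂ] E) (Z : Submodule ℂ E) (g : E) : Prop :=
  ∀ C : ℝ, ∃ y ∈ Z, C * ‖A y‖ < ‖inner ℂ y g‖

theorem NotDominated.exists_inner_eq_one {A : E →L[ℂ] E} {Z : Submodule ℂ E} {g : E}
    (h : NotDominated A Z g) {ε : ℝ} (hε : 0 < ε) : ∃ y ∈ Z, inner ℂ g y = 1 ∧ ‖A y‖ < ε := by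
  obtain ⟨y, hy, h1⟩ := h (1 / ε)
  have h0 : inner ℂ g y ≠ (0 : ℂ) := by
    intro h0
    rw [inner_eq_zero_symm.1 h0, norm_zero] at h1
    have : 0 ≤ 1 / ε * ‖A y‖ := by positivity
    linarith
  refine ⟨(inner ℂ g y)⁻¹ • y, Z.smul_mem _ hy, ?_, ?_⟩
  · rw [inner_smul_right, inv_mul_cancel₀ h0]
  · rw [map_smul, norm_smul, norm_inv, inv_mul_eq_div, div_lt_iff₀ (norm_pos_iff.2 h0),
      norm_inner_symm]
    rw [one_div, inv_mul_eq_div, div_lt_iff₀ hε] at h1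
    rwa [mul_comm]

theorem not_notDominated_iff {A : E →L[ℂ] E} {Z : Submodule ℂ E} {g : E} :
    ¬ NotDominated A Z g ↔ ∃ C : ℝ, ∀ y ∈ Z, ‖inner ℂ y g‖ ≤ C * ‖A y‖ := by
  unfold NotDominated
  push Not
  rfl

theorem not_notDominated_add {A : E →L[ℂ] E} {Z : Submodule ℂ E} {g g' : E}
    (h : ¬ NotDominated A Z g) (h' : ¬ NotDominated A Z g') : ¬ NotDominated A Z (g + g') := by
  rw [not_notDominated_iff] at *
  obtain ⟨C, hC⟩ := h
  obtain ⟨C', hC'⟩ := h'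
  refine ⟨C + C', fun y hy => ?_⟩
  rw [inner_add_right, add_mul]
  exact (norm_add_le _ _).trans (add_le_add (hC y hy) (hC' y hy))

theorem not_notDominated_smul {A : E →L[ℂ] E} {Z : Submodule ℂ E} {g : E} (c : ℂ)
    (h : ¬ NotDominated A Z g) : ¬ NotDominated A Z (c • g) := by
  rw [not_notDominated_iff] at *
  obtain ⟨C, hC⟩ := h
  refine ⟨‖c‖ * C, fun y hy => ?_⟩
  rw [inner_smul_right, norm_mul, mul_assoc]
  exact mul_le_mul_of_nonneg_left (hC y hy) (norm_nonneg _)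

theorem NotDominated.smul {A : E →L[ℂ] E} {Z : Submodule ℂ E} {g : E} {c : ℂ} (hc : c ≠ 0)
    (h : NotDominated A Z g) : NotDominated A Z (c • g) := by
  by_contra h'
  have := not_notDominated_smul c⁻¹ h'
  rw [smul_smul, inv_mul_cancel₀ hc, one_smul] at this
  exact this h

theorem NotDominated.add {A : E →L[ℂ] E} {Z : Submodule ℂ E} {g g' : E}
    (h : NotDominated A Z g) (h' : ¬ NotDominated A Z g') : NotDominated A Z (g + g') := by
  by_contra h2
  have := not_notDominated_add h2 (not_notDominated_smul (-1) h')
  simp at this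
  exact this h

/-- One of the two families of approximate eigenvectors. -/
structure EigenFamily (A : E →L[ℂ] E) (δ τ : ℕ → ℝ) (e h : ℕ → E) (lam c : ℕ → ℂ) (v : E) :
    Prop where
  orth : Orthonormal ℂ e
  near : ∀ n, ‖h n - e n‖ ≤ δ n
  eq : ∀ n, A (h n) = lam n • h n + c n • v
  bound : ∀ n, ‖lam n‖ ≤ τ n
  small : ∀ n, ‖c n‖ ≤ δ n

theorem EigenFamily.comp {A : E →L[ℂ] E} {δ τ : ℕ → ℝ} {e h : ℕ → E} {lam c : ℕ → ℂ} {v : E}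
    (H : EigenFamily A δ τ e h lam c v) (hδ : Antitone δ) (hτ : Antitone τ) {φ : ℕ → ℕ}
    (hφ : StrictMono φ) :
    EigenFamily A δ τ (e ∘ φ) (h ∘ φ) (lam ∘ φ) (c ∘ φ) v where
  orth := H.orth.comp _ hφ.injective
  near n := (H.near _).trans (hδ hφ.le_apply)
  eq n := H.eq _
  bound n := (H.bound _).trans (hτ hφ.le_apply)
  small n := (H.small _).trans (hδ hφ.le_apply)

theorem EigenFamily.vec_mem {A : E →L[ℂ] E} {δ τ : ℕ → ℝ} {e h : ℕ → E} {lam c : ℕ → ℂ} {v : E}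
    (H : EigenFamily A δ τ e h lam c v) {Z : Submodule ℂ E} (hZ : ∀ x ∈ Z, A x ∈ Z) {n : ℕ}
    (hn : h n ∈ Z) (hc : c n ≠ 0) : v ∈ Z := by
  have h1 : v = (c n)⁻¹ • (A (h n) - lam n • h n) := by
    rw [H.eq, add_sub_cancel_left, smul_smul, inv_mul_cancel₀ hc, one_smul]
  rw [h1]
  exact Z.smul_mem _ (sub_mem (hZ _ hn) (Z.smul_mem _ hn))

theorem exists_small_points {τ : ℕ → ℝ} (hτ : ∀ n, 0 < τ n) (hτa : Antitone τ) :
    ∃ κ : ℕ → ℂ, Tendsto κ atTop (𝓝 0) ∧ (∀ n, κ n ≠ 0) ∧ Function.Injective κ ∧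
      ∀ n, ‖κ n‖ ≤ τ n := by
  have hp : ∀ n : ℕ, 0 < τ n / ((n : ℝ) + 1) := fun n => div_pos (hτ n) (by positivity)
  have hanti : StrictAnti fun n : ℕ => τ n / ((n : ℝ) + 1) := by
    refine strictAnti_nat_of_succ_lt fun n => ?_
    refine (div_le_div_of_nonneg_right (hτa (Nat.le_succ n)) (by positivity)).trans_lt ?_
    exact div_lt_div_of_pos_left (hτ n) (by positivity) (by push_cast; linarith)
  have hnorm : ∀ n : ℕ, ‖((τ n / ((n : ℝ) + 1) : ℝ) : ℂ)‖ = τ n / ((n : ℝ) + 1) := fun n => by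
    rw [Complex.norm_real, Real.norm_of_nonneg (hp n).le]
  refine ⟨fun n => ((τ n / ((n : ℝ) + 1) : ℝ) : ℂ), ?_, ?_, ?_, ?_⟩
  · refine squeeze_zero_norm (a := fun n : ℕ => τ 0 * (1 / ((n : ℝ) + 1))) (fun n => ?_) ?_
    · rw [hnorm, mul_one_div]
      exact div_le_div_of_nonneg_right (hτa (Nat.zero_le n)) (by positivity)
    · simpa using tendsto_one_div_add_atTop_nhds_zero_nat.const_mul (τ 0)
  · intro n
    exact Complex.ofReal_ne_zero.2 (hp n).ne'
  · intro m n h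
    exact hanti.injective (Complex.ofReal_injective h)
  · intro n
    rw [hnorm]
    exact div_le_self (hτ n).le (by linarith [Nat.cast_nonneg (α := ℝ) n])

theorem aeval_mem_of_invariant {D : E →L[ℂ] E} {Z : Submodule ℂ E} (hZ : ∀ x ∈ Z, D x ∈ Z)
    (q : ℂ[X]) {u : E} (hu : u ∈ Z) : aeval D q u ∈ Z := by
  induction q using Polynomial.induction_on' with
  | add p q hp hq => rw [map_add]; exact add_mem hp hq
  | monomial n a =>
    rw [aeval_monomial, Algebra.algebraMap_eq_smul_one]
    have : ∀ n : ℕ, (D ^ n) u ∈ Z := by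
      intro n
      induction n with
      | zero => exact hu
      | succ n ih => rw [pow_succ_clm_apply']; exact hZ _ ih
    have h2 := Z.smul_mem a (this n)
    simpa using h2

variable [CompleteSpace E]

/-- A single family inside an invariant subspace. -/
theorem exists_eigenFamily {D : E →L[ℂ] E} {Z : Submodule ℂ E} (hZc : IsClosed (Z : Set E))
    (hZ : ∀ x ∈ Z, D x ∈ Z) (hd : ∀ u ∈ Z, ∀ ε : ℝ, 0 < ε → ∃ v ∈ Z, ‖D v - u‖ < ε)
    (hs : SingularOn D Z) (G : Submodule ℂ E) [FiniteDimensional ℂ G] {δ τ : ℕ → ℝ}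
    (hδ : ∀ n, 0 < δ n) (hτ : ∀ n, 0 < τ n) (hτa : Antitone τ) :
    ∃ e h lam c v, EigenFamily D δ τ e h lam c v ∧ (∀ n, e n ∈ Gᗮ) ∧ (∀ n, h n ∈ Z) ∧ v ∈ Z := by
  obtain ⟨κ, hκ, hκ0, -, hκτ⟩ := exists_small_points hτ hτa
  obtain ⟨n, e, h, v, c, hn, ho, heG, hc0, hc, hne, heq, hW, -⟩ :=
    exists_eigen_family (D := D) (Y := fun _ => Z) (fun _ => hd) (fun _ => hs) hκ hκ0
      (K := fun _ => ∅) (fun _ => isClosed_empty)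
      (fun _ _ _ u hu ε hε => ⟨u, hu, by simpa using hε, fun h => h⟩) (W := Z) hZc
      (fun c x hx => Z.smul_mem c hx) (fun _ q _ u hu => aeval_mem_of_invariant hZ q hu) G hδ
  have H : EigenFamily D δ τ e h (κ ∘ n) c v :=
    ⟨ho, hne, heq, fun j => (hκτ _).trans (hτa hn.le_apply), hc⟩
  exact ⟨e, h, κ ∘ n, c, v, H, heG, hW, H.vec_mem hZ (hW 0) (hc0 0)⟩

theorem not_notDominated_adjoint (B : E →L[ℂ] E) (Z : Submodule ℂ E) (w : E) :
    ¬ NotDominated B Z (adjoint B w) := by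
  rw [not_notDominated_iff]
  refine ⟨‖w‖, fun y _ => ?_⟩
  rw [ContinuousLinearMap.adjoint_inner_right, mul_comm]
  exact norm_inner_le_norm _ _

/-- Two families, one for `B` and one for its adjoint, which are mutually orthogonal. -/
theorem exists_coupled_families {B : E →L[ℂ] E} {Z Z' : Submodule ℂ E}
    (hZc : IsClosed (Z : Set E)) (hZc' : IsClosed (Z' : Set E))
    (hZ : ∀ x ∈ Z, B x ∈ Z) (hZ' : ∀ x ∈ Z', adjoint B x ∈ Z')
    (hd : ∀ u ∈ Z, ∀ ε : ℝ, 0 < ε → ∃ v ∈ Z, ‖B v - u‖ < ε)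
    (hd' : ∀ u ∈ Z', ∀ ε : ℝ, 0 < ε → ∃ v ∈ Z', ‖adjoint B v - u‖ < ε)
    (hs : SingularOn B Z) (hs' : SingularOn (adjoint B) Z') {g₀ : E} (hg₀ : g₀ ∈ Z')
    (hg₀' : NotDominated B Z g₀) (G G' : Submodule ℂ E) [FiniteDimensional ℂ G]
    [FiniteDimensional ℂ G'] {δ τ : ℕ → ℝ} (hδ : ∀ n, 0 < δ n) (hδa : Antitone δ)
    (hτ : ∀ n, 0 < τ n) (hτa : Antitone τ) :
    ∃ e h lam c v f g mu d w, EigenFamily B δ τ e h lam c v ∧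
      EigenFamily (adjoint B) δ τ f g mu d w ∧
      (∀ n, e n ∈ Gᗮ) ∧ (∀ n, f n ∈ G'ᗮ) ∧ (∀ n, h n ∈ Z) ∧ v ∈ Z ∧ (∀ n, g n ∈ Z') ∧ w ∈ Z' ∧
      (∀ i j, inner ℂ (h i) (g j) = 0) ∧ (∀ j, inner ℂ v (g j) = 0) ∧
      ∀ j, inner ℂ (h j) w = 0 := by
  obtain ⟨κ, hκ, hκ0, hκi, hκτ⟩ := exists_small_points hτ hτa
  -- `K j` consists of the vectors dominated with constant `j`. Avoiding all of them makes the error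
  -- vector `w` of the first family not dominated, which the second family will need.
  let K : ℕ → Set E := fun j => {x | ∀ y ∈ Z, ‖inner ℂ y x‖ ≤ j * ‖B y‖}
  have hKc : ∀ j, IsClosed (K j) := by
    intro j
    have : K j = ⋂ y ∈ Z, {x | ‖inner ℂ y x‖ ≤ j * ‖B y‖} := by
      ext x; simp [K]
    rw [this]
    refine isClosed_biInter fun y _ => isClosed_le ?_ continuous_const
    fun_prop
  have hKdom : ∀ x, ¬ NotDominated B Z x ↔ ∃ j, x ∈ K j := by
    intro x
    rw [not_notDominated_iff]
    constructor
    · rintro ⟨C, hC⟩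
      obtain ⟨j, hj⟩ := exists_nat_ge C
      exact ⟨j, fun y hy => (hC y hy).trans (mul_le_mul_of_nonneg_right hj (norm_nonneg _))⟩
    · rintro ⟨j, hj⟩
      exact ⟨j, hj⟩
  obtain ⟨n, f, g, w, d, hn, hfo, hfG, hd0, hds, hgf, hgeq, hgZ, hwK⟩ :=
    exists_eigen_family (D := adjoint B) (Y := fun _ => Z') (fun _ => hd') (fun _ => hs') hκ hκ0
      (K := K) hKc (W := Z') (by
        intro k j s u hu ε hε
        by_contra hcon
        push Not at hcon
        set Q := aeval (adjoint B) (pointPoly κ s) with hQ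
        have h1 : Q u ∈ K j := hcon u hu (by simpa using hε)
        obtain ⟨t, ht0, ht⟩ : ∃ t : ℝ, 0 < t ∧ t * ‖g₀‖ < ε := by
          refine ⟨ε / (‖g₀‖ + 1), by positivity, ?_⟩
          rw [div_mul_eq_mul_div, div_lt_iff₀ (by positivity)]
          nlinarith [norm_nonneg g₀]
        have h2 : Q (u + (t : ℂ) • g₀) ∈ K j := hcon _ (add_mem hu (Z'.smul_mem _ hg₀)) (by
          rw [add_sub_cancel_left, norm_smul, Complex.norm_real, Real.norm_of_nonneg ht0.le]
          exact ht)
        have h1' := (hKdom _).2 ⟨j, h1⟩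
        have h2' := (hKdom _).2 ⟨j, h2⟩
        -- Modulo the range of `adjoint B`, all of whose vectors are dominated, `Q g₀` is a nonzero
        -- multiple of `g₀`. Hence `Q u` and `Q (u + t • g₀)` cannot both be dominated.
        have h3 : Q g₀ = (pointPoly κ s).eval 0 • g₀ +
            aeval (adjoint B) (pointPoly κ s).divX (adjoint B g₀) := aeval_eq_eval_zero_add _ _ _
        rw [← apply_aeval_apply] at h3
        have h4 := not_notDominated_adjoint B Z (aeval (adjoint B) (pointPoly κ s).divX g₀)
        have ht' : (t : ℂ) ≠ 0 := Complex.ofReal_ne_zero.2 ht0.ne'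
        have h5 : ¬ NotDominated B Z ((t : ℂ) • Q g₀) := by
          have := not_notDominated_add h2' (not_notDominated_smul (-1) h1')
          rwa [map_add, map_smul, neg_one_smul, add_neg_cancel_comm] at this
        refine h5 (NotDominated.smul ht' ?_)
        rw [h3]
        exact (hg₀'.smul (pointPoly_eval_zero_ne hκ0 s)).add h4) hZc'
      (fun c x hx => Z'.smul_mem c hx) (fun _ q _ u hu => aeval_mem_of_invariant hZ' q hu) G' hδ
  have HG : EigenFamily (adjoint B) δ τ f g (κ ∘ n) d w :=
    ⟨hfo, hgf, hgeq, fun j => (hκτ _).trans (hτa hn.le_apply), hds⟩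
  have hwZ : w ∈ Z' := HG.vec_mem hZ' (hgZ 0) (hd0 0)
  have hwd : NotDominated B Z w := by
    by_contra h
    obtain ⟨j, hj⟩ := (hKdom w).1 h
    exact hwK j hj
  -- On `Y k` every polynomial in `B` of degree less than `k` yields vectors orthogonal to `w`.
  -- Moreover a vector of `Z` orthogonal to `w` and mapped by `B` into `Y k` lies in `Y (k + 1)`.
  let Y : ℕ → Submodule ℂ E := fun k =>
    Z ⊓ (Submodule.span ℂ ((fun i => (adjoint B ^ i) w) '' Set.Iio k))ᗮ
  have hYfin : ∀ k, FiniteDimensional ℂ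
      (Submodule.span ℂ ((fun i => (adjoint B ^ i) w) '' Set.Iio k)) := fun k =>
    FiniteDimensional.span_of_finite ℂ ((Set.finite_Iio k).image _)
  have hYmem : ∀ k x, x ∈ Y k ↔ x ∈ Z ∧ ∀ i < k, inner ℂ ((adjoint B ^ i) w) x = 0 := by
    intro k x
    refine and_congr Iff.rfl ⟨fun h i hi => h _ (Submodule.subset_span ⟨i, hi, rfl⟩), fun h => ?_⟩
    refine (Submodule.mem_orthogonal _ _).2 fun y hy => ?_
    induction hy using Submodule.span_induction with
    | mem y hy => obtain ⟨i, hi, rfl⟩ := hy; exact h i hi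
    | zero => simp
    | add y z _ _ h1 h2 => rw [inner_add_left, h1, h2, add_zero]
    | smul a y _ h1 => rw [inner_smul_left, h1, mul_zero]
  have hadj : ∀ i x, inner ℂ ((adjoint B ^ i) w) (B x) = inner ℂ ((adjoint B ^ (i + 1)) w) x := by
    intro i x
    rw [pow_succ_clm_apply', ContinuousLinearMap.adjoint_inner_left]
  -- Since `w` is not dominated, some `y` has pairing one with `w` and tiny `B y`. It makes `v`
  -- orthogonal to `w` while hardly changing `B v`.
  have hdense : ∀ u ∈ Z, ∀ ε : ℝ, 0 < ε →
      ∃ v ∈ (Z ⊓ (ℂ ∙ w)ᗮ).map (B : E →ₗ[ℂ] E), ‖v - u‖ < ε := by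
    intro u hu ε hε
    obtain ⟨v, hv, hvu⟩ := hd u hu (ε / 2) (by positivity)
    obtain ⟨y, hy, hy1, hyB⟩ := hwd.exists_inner_eq_one
      (show 0 < ε / 2 / (‖inner ℂ w v‖ + 1) by positivity)
    rw [lt_div_iff₀ (by positivity)] at hyB
    refine ⟨B (v - inner ℂ w v • y), ⟨_, ⟨sub_mem hv (Z.smul_mem _ hy), ?_⟩, rfl⟩, ?_⟩
    · refine Submodule.mem_orthogonal_singleton_iff_inner_right.2 ?_
      rw [inner_sub_right, inner_smul_right, hy1, mul_one, sub_self]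
    · have h1 : B (v - inner ℂ w v • y) - u = (B v - u) - inner ℂ w v • B y := by
        rw [map_sub, map_smul]; abel
      rw [h1]
      refine (norm_sub_le _ _).trans_lt ?_
      rw [norm_smul]
      nlinarith [norm_nonneg (B y)]
  obtain ⟨m, e, h, v, c, hm, heo, heG, hc0, hcs, hhe, hheq, hhW, -⟩ :=
    exists_eigen_family (D := B) (Y := Y) (κ := fun j => (starRingEnd ℂ) (κ (n j)))
      (by
        intro k u hu ε hε
        obtain ⟨huZ, hu'⟩ := (hYmem k u).1 hu
        obtain ⟨x, hx, hxG, hxu⟩ := exists_mem_orthogonal_near (hdense u huZ)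
          (Submodule.span ℂ ((fun i => (adjoint B ^ i) w) '' Set.Iio k)) hu.2 hε
        obtain ⟨v, ⟨hvZ, hvw⟩, rfl⟩ := hx
        refine ⟨v, (hYmem _ _).2 ⟨hvZ, fun i hi => ?_⟩, hxu⟩
        cases i with
        | zero => exact Submodule.mem_orthogonal_singleton_iff_inner_right.1 hvw
        | succ i =>
          rw [← hadj]
          exact hxG _ (Submodule.subset_span ⟨i, by simpa using hi, rfl⟩))
      (fun k => hs.mono_orthogonal _ le_rfl)
      (by
        have h1 := (Complex.continuous_conj.tendsto 0).comp (hκ.comp hn.tendsto_atTop)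
        rw [map_zero] at h1
        exact h1)
      (fun j => (_root_.map_ne_zero _).2 (hκ0 _))
      (K := fun _ => ∅) (fun _ => isClosed_empty)
      (fun _ _ _ u hu ε hε => ⟨u, hu, by simpa using hε, fun h => h⟩)
      (W := (Z ⊓ (ℂ ∙ w)ᗮ : Submodule ℂ E))
      (hZc.inter (Submodule.isClosed_orthogonal _))
      (fun c x hx => Submodule.smul_mem _ c hx)
      (by
        intro k q hq u hu
        obtain ⟨huZ, hu'⟩ := (hYmem k u).1 hu
        refine ⟨aeval_mem_of_invariant hZ q huZ, ?_⟩
        refine Submodule.mem_orthogonal_singleton_iff_inner_right.2 ?_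
        have hpow : ∀ i x, inner ℂ w ((B ^ i) x) = inner ℂ ((adjoint B ^ i) w) x := by
          intro i
          induction i with
          | zero => intro x; rfl
          | succ i ih => intro x; rw [pow_succ_clm_apply, ih, hadj]
        rw [aeval_eq_sum_range, sum_apply, inner_sum]
        refine Finset.sum_eq_zero fun i hi => ?_
        rw [smul_apply, inner_smul_right, hpow, hu' i, mul_zero]
        rw [Finset.mem_range] at hi
        omega) G hδ
  have HH : EigenFamily B δ τ e h (fun j => (starRingEnd ℂ) (κ (n (m j)))) c v :=
    ⟨heo, hhe, hheq, fun j => by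
      rw [RCLike.norm_conj]
      exact (hκτ _).trans (hτa (hm.le_apply.trans hn.le_apply)), hcs⟩
  have hhw : ∀ j, inner ℂ w (h j) = 0 := fun j =>
    Submodule.mem_orthogonal_singleton_iff_inner_right.1 (hhW j).2
  have hBg : ∀ i x, inner ℂ w x = 0 → inner ℂ (g i) (B x) =
      (starRingEnd ℂ) (κ (n i)) * inner ℂ (g i) x := by
    intro i x hx
    rw [← ContinuousLinearMap.adjoint_inner_left, hgeq, inner_add_left, inner_smul_left,
      inner_smul_left, hx, mul_zero, add_zero]
  -- The eigenvalues for `B` were taken conjugate to those for the adjoint. For matching indices the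
  -- eigenvalue terms cancel and only `c j` times the pairing with `v` remains; for different
  -- indices distinct eigenvalues then force orthogonality.
  have hgv : ∀ j, inner ℂ (g (m j)) v = 0 := by
    intro j
    have h1 := hBg (m j) (h j) (hhw j)
    rw [hheq, inner_add_right, inner_smul_right, inner_smul_right, add_eq_left] at h1
    exact (mul_eq_zero.1 h1).resolve_left (hc0 j)
  have hgh : ∀ i j, i ≠ j → inner ℂ (g (m j)) (h i) = 0 := by
    intro i j hij
    have h1 := hBg (m j) (h i) (hhw i)
    rw [hheq, inner_add_right, inner_smul_right, inner_smul_right, hgv, mul_zero, add_zero,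
      ← sub_eq_zero, ← sub_mul] at h1
    refine (mul_eq_zero.1 h1).resolve_left ?_
    intro h2
    rw [sub_eq_zero] at h2
    exact hij (hm.injective (hn.injective (hκi ((starRingEnd ℂ).injective h2))))
  -- The pairing of `g (m j)` with `h j` is not controlled, so the two families retain disjoint sets
  -- of indices.
  have hev : StrictMono fun i : ℕ => 2 * i := fun a b (h : a < b) => show 2 * a < 2 * b by omega
  have hodd : StrictMono fun i : ℕ => m (2 * i + 1) := hm.comp
    fun a b (h : a < b) => show 2 * a + 1 < 2 * b + 1 by omega
  refine ⟨_, _, _, _, v, _, _, _, _, w, HH.comp hδa hτa hev, HG.comp hδa hτa hodd,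
    fun i => heG _, fun i => hfG _, fun i => (hhW _).1, HH.vec_mem hZ (hhW 0).1 (hc0 0),
    fun i => hgZ _, hwZ, fun i j => ?_, fun j => ?_, fun j => ?_⟩
  · exact inner_eq_zero_symm.1 (hgh (2 * i) (2 * j + 1) (by omega))
  · exact inner_eq_zero_symm.1 (hgv _)
  · exact inner_eq_zero_symm.1 (hhw _)

end Families

/-! ### Auxiliary vectors and invariant subspaces -/

section Subspaces

variable {E : Type*} [NormedAddCommGroup E] [InnerProductSpace ℂ E]

theorem exists_unit_mem_orthogonal {U : Submodule ℂ E} (hU : ¬ FiniteDimensional ℂ U)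
    (F : Submodule ℂ E) [FiniteDimensional ℂ F] : ∃ u ∈ U, u ∈ Fᗮ ∧ ‖u‖ = 1 := by
  obtain ⟨u, hu, huF, hu0⟩ : ∃ u ∈ U, u ∈ Fᗮ ∧ u ≠ 0 := by
    by_contra hcon
    push Not at hcon
    refine hU ?_
    let f : U →ₗ[ℂ] F := (F.orthogonalProjectionOnto : E →ₗ[ℂ] F) ∘ₗ U.subtype
    refine FiniteDimensional.of_injective f ?_
    rw [← LinearMap.ker_eq_bot, eq_bot_iff]
    rintro ⟨x, hx⟩ h
    exact Subtype.ext (hcon x hx (Submodule.orthogonalProjectionOnto_eq_zero_iff.1 h))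
  refine ⟨((‖u‖⁻¹ : ℝ) : ℂ) • u, U.smul_mem _ hu, Fᗮ.smul_mem _ huF, ?_⟩
  rw [norm_smul, Complex.norm_real, norm_inv, norm_norm, inv_mul_cancel₀ (norm_ne_zero_iff.2 hu0)]

theorem exists_orthonormal_mem {U : ℕ → Submodule ℂ E} (hU : ∀ n, ¬ FiniteDimensional ℂ (U n))
    (G : Submodule ℂ E) [FiniteDimensional ℂ G] :
    ∃ e : ℕ → E, Orthonormal ℂ e ∧ (∀ n, e n ∈ U n) ∧ ∀ n, e n ∈ Gᗮ := by
  obtain ⟨σ, hσ, hR⟩ := exists_dependent_seq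
    (fun _ (F : Submodule ℂ E × E) => FiniteDimensional ℂ F.1 ∧ G ≤ F.1)
    (fun n F F' => F'.1 = F.1 ⊔ Submodule.span ℂ {F'.2} ∧ F'.2 ∈ U n ∧ F'.2 ∈ F.1ᗮ ∧ ‖F'.2‖ = 1)
    ⟨(G, 0), inferInstance, le_rfl⟩ (by
      rintro n ⟨F, x⟩ ⟨hF, hG⟩
      have hF' : FiniteDimensional ℂ F := hF
      obtain ⟨u, h1, h2, h3⟩ := exists_unit_mem_orthogonal (hU n) F
      exact ⟨(F ⊔ Submodule.span ℂ {u}, u), ⟨inferInstance, hG.trans le_sup_left⟩, rfl, h1, h2, h3⟩)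
  have hmono : ∀ j m, (σ j).1 ≤ (σ (j + m)).1 := by
    intro j m
    induction m with
    | zero => exact le_rfl
    | succ m ih => rw [← add_assoc, (hR _).1]; exact ih.trans le_sup_left
  refine ⟨fun n => (σ (n + 1)).2, ⟨fun n => (hR n).2.2.2, ?_⟩, fun n => (hR n).2.1,
    fun n => Submodule.orthogonal_le (hσ n).2 (hR n).2.2.1⟩
  have hlt : ∀ i j, i < j → inner ℂ (σ (i + 1)).2 (σ (j + 1)).2 = 0 := by
    intro i j hij
    obtain ⟨m, rfl⟩ := Nat.exists_eq_add_of_lt hij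
    refine (hR (i + m + 1)).2.2.1 _ ?_
    rw [show i + m + 1 = i + 1 + m by omega]
    refine hmono (i + 1) m ?_
    rw [(hR i).1]
    exact (le_sup_right : _ ≤ (σ i).1 ⊔ _) (Submodule.mem_span_singleton_self _)
  intro i j hij
  rcases lt_or_gt_of_ne hij with h' | h'
  · exact hlt i j h'
  · exact inner_eq_zero_symm.1 (hlt j i h')

variable [CompleteSpace E]

/-- Choose `y n` in `V` with `‖D (y n)‖ < 1 / (n + 1)`. If every vector of `L` were dominated, the
functionals given on `L` by `(n + 1) • y n` would be pointwise bounded, hence uniformly bounded by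
Banach–Steinhaus; but their norms are at least `(n + 1) * c`. -/
theorem exists_notDominated {D : E →L[ℂ] E} {L V : Submodule ℂ E} [CompleteSpace L] {c : ℝ}
    (hc : 0 < c)
    (h : ∀ ε : ℝ, 0 < ε → ∃ y ∈ V, ‖D y‖ < ε ∧ c ≤ ‖L.starProjection y‖) :
    ∃ p ∈ L, NotDominated D V p := by
  by_contra hcon
  push Not at hcon
  have hy : ∀ n : ℕ, ∃ y ∈ V, ‖D y‖ < 1 / ((n : ℝ) + 1) ∧ c ≤ ‖L.starProjection y‖ :=
    fun n => h _ (by positivity)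
  choose y hyV hyD hyc using hy
  let T : ℕ → L →L[ℂ] ℂ := fun n => innerSL ℂ (((n : ℂ) + 1) • y n) ∘L L.subtypeL
  have hn1 : ∀ n : ℕ, ‖((n : ℂ) + 1)‖ = (n : ℝ) + 1 := fun n => by
    have : ((n : ℂ) + 1) = (((n : ℝ) + 1 : ℝ) : ℂ) := by push_cast; rfl
    rw [this, Complex.norm_real, Real.norm_of_nonneg (by positivity)]
  obtain ⟨C, hC⟩ := banach_steinhaus (g := T) (by
    intro p
    obtain ⟨C, hC⟩ := not_notDominated_iff.1 (hcon p p.2)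
    refine ⟨|C|, fun n => ?_⟩
    change ‖inner ℂ (((n : ℂ) + 1) • y n) (p : E)‖ ≤ |C|
    rw [inner_smul_left, norm_mul, RCLike.norm_conj, hn1]
    have h1 := hC _ (hyV n)
    have h2 : C * ‖D (y n)‖ ≤ |C| * (1 / ((n : ℝ) + 1)) :=
      mul_le_mul (le_abs_self C) (hyD n).le (norm_nonneg _) (abs_nonneg _)
    have h3 : (0 : ℝ) < (n : ℝ) + 1 := by positivity
    calc ((n : ℝ) + 1) * ‖inner ℂ (y n) (p : E)‖ ≤ ((n : ℝ) + 1) * (|C| * (1 / ((n : ℝ) + 1))) :=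
          mul_le_mul_of_nonneg_left (h1.trans h2) h3.le
      _ = |C| := by field_simp)
  obtain ⟨n, hn⟩ := exists_nat_gt (C / c)
  rw [div_lt_iff₀ hc] at hn
  let z : L := L.orthogonalProjectionOnto (y n)
  have hz : ‖z‖ = ‖L.starProjection (y n)‖ := rfl
  have hz0 : 0 < ‖z‖ := hc.trans_le (hyc n)
  have h1 : ‖T n z‖ = ((n : ℝ) + 1) * ‖z‖ ^ 2 := by
    change ‖inner ℂ (((n : ℂ) + 1) • y n) (L.starProjection (y n))‖ = _
    rw [inner_smul_left, norm_mul, RCLike.norm_conj, hn1]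
    have h3 : inner ℂ (y n) (L.starProjection (y n)) =
        inner ℂ (L.starProjection (y n)) (L.starProjection (y n)) := by
      rw [Submodule.inner_starProjection_left_eq_right,
        Submodule.starProjection_eq_self_iff.2 (Submodule.starProjection_apply_mem _ _)]
    rw [h3, inner_self_eq_norm_sq_to_K, hz, norm_pow]
    simp
  have h2 := ((T n).le_opNorm z).trans (mul_le_mul_of_nonneg_right (hC n) (norm_nonneg z))
  rw [h1] at h2
  have h3 : ((n : ℝ) + 1) * ‖z‖ ≤ C := by
    by_contra h4
    push Not at h4
    nlinarith
  have h4 : (n : ℝ) * c ≤ ((n : ℝ) + 1) * ‖z‖ := by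
    have := hyc n
    rw [← hz] at this
    nlinarith [Nat.cast_nonneg (α := ℝ) n]
  linarith

/-- Baire: each zero set is a proper closed subspace of `Y`. -/
theorem exists_forall_apply_ne_zero {Y : Submodule ℂ E} [CompleteSpace Y] (l : ℕ → E →L[ℂ] ℂ)
    (hl : ∀ n, ∃ y ∈ Y, l n y ≠ 0) : ∃ y ∈ Y, ∀ n, l n y ≠ 0 := by
  let l' : ℕ → Y →L[ℂ] ℂ := fun n => l n ∘L Y.subtypeL
  have h1 : ∀ n, IsOpen {y | l' n y ≠ 0} := fun n => isOpen_ne_fun (l' n).continuous continuous_const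
  have h2 : ∀ n, Dense {y | l' n y ≠ 0} := by
    intro n
    have : {y | l' n y ≠ 0} = ((l' n : Y →ₗ[ℂ] ℂ).ker : Set Y)ᶜ := by
      ext y; simp
    rw [this, ← interior_eq_empty_iff_dense_compl]
    by_contra hne
    rw [← ne_eq, ← Set.nonempty_iff_ne_empty] at hne
    have htop := Submodule.eq_top_of_nonempty_interior' _ hne
    obtain ⟨y, hy, hy0⟩ := hl n
    have h3 : (⟨y, hy⟩ : Y) ∈ (l' n : Y →ₗ[ℂ] ℂ).ker := by rw [htop]; trivial
    exact hy0 h3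
  obtain ⟨y, hy⟩ := (dense_iInter_of_isOpen_nat h1 h2).nonempty
  rw [Set.mem_iInter] at hy
  exact ⟨y, y.2, hy⟩

/-- The smallest closed subspace containing `x` and invariant under `D` and all `r n`. -/
def cyclicSubspace (D : E →L[ℂ] E) (r : ℕ → E →L[ℂ] E) (x : E) : Submodule ℂ E :=
  sInf {Y | IsClosed (Y : Set E) ∧ (∀ y ∈ Y, D y ∈ Y) ∧ (∀ n, ∀ y ∈ Y, r n y ∈ Y) ∧ x ∈ Y}

/-! ### Cyclic subspaces, divisible parts and closures of ranges -/

section Cyclic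

variable {D : E →L[ℂ] E} {κ : ℕ → ℂ} {r : ℕ → E →L[ℂ] E} {x : E}

theorem mem_cyclicSubspace : x ∈ cyclicSubspace D r x :=
  Submodule.mem_sInf.2 fun _ hY => hY.2.2.2

theorem cyclicSubspace_le {Y : Submodule ℂ E} (hYc : IsClosed (Y : Set E))
    (hY : ∀ y ∈ Y, D y ∈ Y) (hYr : ∀ n, ∀ y ∈ Y, r n y ∈ Y) (hx : x ∈ Y) :
    cyclicSubspace D r x ≤ Y := sInf_le ⟨hYc, hY, hYr, hx⟩

theorem isClosed_cyclicSubspace : IsClosed (cyclicSubspace D r x : Set E) := by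
  rw [cyclicSubspace, Submodule.coe_sInf]
  exact isClosed_biInter fun Y hY => hY.1

theorem apply_mem_cyclicSubspace : ∀ y ∈ cyclicSubspace D r x, D y ∈ cyclicSubspace D r x := by
  intro y hy
  rw [cyclicSubspace, Submodule.mem_sInf] at *
  exact fun Y hY => hY.2.1 _ (hy Y hY)

theorem resolvent_mem_cyclicSubspace (n : ℕ) :
    ∀ y ∈ cyclicSubspace D r x, r n y ∈ cyclicSubspace D r x := by
  intro y hy
  rw [cyclicSubspace, Submodule.mem_sInf] at *
  exact fun Y hY => hY.2.2.1 n _ (hy Y hY)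

theorem topologicalClosure_apply_mem {V : Submodule ℂ E} {T : E →L[ℂ] E}
    (h : ∀ y ∈ V, T y ∈ V.topologicalClosure) : ∀ y ∈ V.topologicalClosure,
      T y ∈ V.topologicalClosure := by
  have h1 : V.topologicalClosure ≤ V.topologicalClosure.comap (T : E →ₗ[ℂ] E) := by
    refine Submodule.topologicalClosure_minimal _ h ?_
    exact V.isClosed_topologicalClosure.preimage T.continuous
  exact h1

/-- Since `κ n` is not zero, `r n y = (κ n)⁻¹ • (D (r n y) - y)`. So the closure on the right is
invariant under the `r n` as well as under `D`, and minimality applies. -/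
theorem cyclicSubspace_le_closure (hR : ResolventSeq D κ r) (hκ : ∀ n, κ n ≠ 0) :
    cyclicSubspace D r x ≤
      ((ℂ ∙ x) ⊔ (cyclicSubspace D r x).map (D : E →ₗ[ℂ] E)).topologicalClosure := by
  set Z := cyclicSubspace D r x
  set V := (ℂ ∙ x) ⊔ Z.map (D : E →ₗ[ℂ] E)
  have hxV : x ∈ V := (le_sup_left : _ ≤ V) (Submodule.mem_span_singleton_self x)
  have hDV : ∀ z ∈ Z, D z ∈ V := fun z hz => (le_sup_right : _ ≤ V) ⟨z, hz, rfl⟩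
  have hVZ : V ≤ Z := sup_le ((Submodule.span_singleton_le_iff_mem _ _).2 mem_cyclicSubspace) (by
    rintro _ ⟨z, hz, rfl⟩
    exact apply_mem_cyclicSubspace z hz)
  refine cyclicSubspace_le V.isClosed_topologicalClosure (topologicalClosure_apply_mem ?_)
    (fun n => topologicalClosure_apply_mem ?_) (V.le_topologicalClosure hxV)
  · exact fun y hy => V.le_topologicalClosure (hDV y (hVZ hy))
  · intro y hy
    refine V.le_topologicalClosure ?_
    have h1 : r n y = (κ n)⁻¹ • (D (r n y) - y) := by
      rw [hR.right, add_sub_cancel_left, smul_smul, inv_mul_cancel₀ (hκ n), one_smul]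
    rw [h1]
    exact V.smul_mem _ (sub_mem (hDV _ (resolvent_mem_cyclicSubspace n y (hVZ hy))) hy)

theorem ResolventSeq.restrict_seq (hR : ResolventSeq D κ r) {Y : Submodule ℂ E}
    (hY : ∀ y ∈ Y, D y ∈ Y) (hYr : ∀ n, ∀ y ∈ Y, r n y ∈ Y) :
    ResolventSeq (D.restrict hY) κ fun n => (r n).restrict (hYr n) :=
  ⟨hR.tendsto, fun n x => Subtype.ext (hR.right n x), fun n x => Subtype.ext (hR.left n x)⟩

theorem restrict_pow_apply {Y : Submodule ℂ E} (hY : ∀ y ∈ Y, D y ∈ Y) (k : ℕ) (y : Y) :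
    (((D.restrict hY) ^ k) y : E) = (D ^ k) y := by
  induction k generalizing y with
  | zero => rfl
  | succ k ih => rw [pow_succ_clm_apply, pow_succ_clm_apply, ih]; rfl

/-- By Baire one `p` is detected by all `v k` at once. Were `D` not singular on the cyclic subspace,
it would be invertible there up to a nilpotent part, and for some `K` the vector `(D ^ K) p` would
lie in the image of `D ^ (K + 1)`, which `v K` annihilates. -/
theorem exists_cyclic_singularOn (hR : ResolventSeq D κ r) {Y : Submodule ℂ E}
    (hYc : IsClosed (Y : Set E)) (hY : ∀ y ∈ Y, D y ∈ Y) (hYr : ∀ n, ∀ y ∈ Y, r n y ∈ Y)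
    {v : ℕ → E} (hv0 : ∀ k, ∀ y ∈ Y, inner ℂ (v k) ((D ^ (k + 1)) y) = 0)
    (hv1 : ∀ k, ∃ y ∈ Y, inner ℂ (v k) ((D ^ k) y) ≠ 0) :
    ∃ p ∈ Y, ‖p‖ = 1 ∧ (∀ k, inner ℂ (v k) ((D ^ k) p) ≠ 0) ∧
      SingularOn D (cyclicSubspace D r p) := by
  have : CompleteSpace Y := hYc.completeSpace_coe
  obtain ⟨p, hp, hp1, hpv⟩ : ∃ p ∈ Y, ‖p‖ = 1 ∧ ∀ k, inner ℂ (v k) ((D ^ k) p) ≠ 0 := by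
    obtain ⟨q, hq, hqv⟩ := exists_forall_apply_ne_zero (Y := Y)
      (fun k => innerSL ℂ (v k) ∘L (D ^ k)) hv1
    have hq0 : q ≠ 0 := by
      rintro rfl
      exact hqv 0 (map_zero _)
    have hn : ‖q‖ ≠ 0 := norm_ne_zero_iff.2 hq0
    refine ⟨((‖q‖⁻¹ : ℝ) : ℂ) • q, Y.smul_mem _ hq, ?_, fun k => ?_⟩
    · rw [norm_smul, Complex.norm_real, norm_inv, norm_norm, inv_mul_cancel₀ hn]
    · rw [map_smul, inner_smul_right]
      exact mul_ne_zero (Complex.ofReal_ne_zero.2 (inv_ne_zero hn)) (hqv k)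
  refine ⟨p, hp, hp1, hpv, ?_⟩
  by_contra hs
  set Z := cyclicSubspace D r p
  have : CompleteSpace Z := isClosed_cyclicSubspace.completeSpace_coe
  obtain ⟨K, P, X, -, h1, h2, -, -, h5⟩ := exists_browder_of_not_singularOn
    (hR.restrict_seq apply_mem_cyclicSubspace resolvent_mem_cyclicSubspace)
    (SingularOn.of_restrict apply_mem_cyclicSubspace hs)
  set d := D.restrict (apply_mem_cyclicSubspace (D := D) (r := r) (x := p)) with hd
  have h6 : d ^ K = d ^ (K + 1) * X := by
    rw [pow_succ, mul_assoc, h1, mul_sub, h5, mul_one, sub_zero]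
  have h7 := congrArg (fun f : Z →L[ℂ] Z => ((f ⟨p, mem_cyclicSubspace⟩ : Z) : E)) h6
  simp only [mul_apply_eq_comp] at h7
  rw [hd, restrict_pow_apply, restrict_pow_apply] at h7
  refine hpv K ?_
  rw [h7]
  exact hv0 K _ (cyclicSubspace_le hYc hY hYr hp (X ⟨p, mem_cyclicSubspace⟩).2)

/-- The closed "divisible part" of the generalized kernel when the ascent is infinite. -/
theorem exists_divisible_part {A : E →L[ℂ] E} (hR : ResolventSeq A κ r)
    [FiniteDimensional ℂ (A : E →ₗ[ℂ] E).ker]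
    (hasc : ∀ k, ∃ x, (A ^ (k + 1)) x = 0 ∧ (A ^ k) x ≠ 0) :
    ∃ Z : Submodule ℂ E, IsClosed (Z : Set E) ∧ (∀ z ∈ Z, A z ∈ Z) ∧
      (∀ n, ∀ z ∈ Z, r n z ∈ Z) ∧ (∀ u ∈ Z, ∀ ε : ℝ, 0 < ε → ∃ v ∈ Z, ‖A v - u‖ < ε) ∧
      SingularOn A Z ∧
      ∃ w : ℕ → E, (∀ k, w k ∈ Z) ∧ w 0 ≠ 0 ∧ A (w 0) = 0 ∧ ∀ k, A (w (k + 1)) = w k := by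
  let V : Submodule ℂ E :=
    { carrier := {x | ∃ k : ℕ, (A ^ k) x = 0}
      add_mem' := by
        rintro x y ⟨k, hk⟩ ⟨l, hl⟩
        refine ⟨k + l, ?_⟩
        have h1 : (A ^ (k + l)) x = (A ^ l) ((A ^ k) x) := by rw [add_comm, pow_add]; rfl
        have h2 : (A ^ (k + l)) y = (A ^ k) ((A ^ l) y) := by rw [pow_add]; rfl
        rw [map_add, h1, h2, hk, hl, map_zero, map_zero, add_zero]
      zero_mem' := ⟨0, by simp⟩
      smul_mem' := by
        rintro c x ⟨k, hk⟩
        exact ⟨k, by rw [map_smul, hk, smul_zero]⟩ }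
  have hVA : ∀ x ∈ V, A x ∈ V := by
    rintro x ⟨k, hk⟩
    exact ⟨k, by rw [← pow_succ_clm_apply, pow_succ_clm_apply', hk, map_zero]⟩
  have hVr : ∀ n, ∀ x ∈ V, r n x ∈ V := by
    rintro n x ⟨k, hk⟩
    exact ⟨k, by rw [hR.comm_pow, hk, map_zero]⟩
  have hVpow : ∀ j, ∀ x ∈ V, (A ^ j) x ∈ V := by
    intro j
    induction j with
    | zero => exact fun x hx => hx
    | succ j ih => intro x hx; rw [pow_succ_clm_apply']; exact hVA _ (ih x hx)
  let R : ℕ → Submodule ℂ E := fun j => V.map ((A ^ j : E →L[ℂ] E) : E →ₗ[ℂ] E)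
  have hRmap : ∀ j, (R j).map (A : E →ₗ[ℂ] E) = R (j + 1) := by
    intro j
    ext y
    constructor
    · rintro ⟨_, ⟨x, hx, rfl⟩, rfl⟩
      exact ⟨x, hx, pow_succ_clm_apply' A j x⟩
    · rintro ⟨x, hx, rfl⟩
      exact ⟨_, ⟨x, hx, rfl⟩, (pow_succ_clm_apply' A j x).symm⟩
  have hRanti : Antitone R := by
    refine antitone_nat_of_succ_le fun j => ?_
    rintro _ ⟨x, hx, rfl⟩
    exact ⟨A x, hVA x hx, (pow_succ_clm_apply A j x).symm⟩
  -- A finite-dimensional kernel makes `A` map the intersection of the `R j` onto itself, and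
  -- infinite ascent provides kernel vectors in each `R j`, hence one in the intersection.
  obtain ⟨h1, h2⟩ := map_iInf_eq_of_finiteDimensional_ker (A : E →ₗ[ℂ] E) R hRanti hRmap
  obtain ⟨w₀, hw₀, hw₀A, hw₀0⟩ := h2 (by
    intro j
    obtain ⟨x, hx, hx0⟩ := hasc j
    exact ⟨(A ^ j) x, ⟨x, ⟨j + 1, hx⟩, rfl⟩, by rw [← hx, pow_succ_clm_apply']; rfl, hx0⟩)
  set U : Submodule ℂ E := ⨅ j, R j with hU
  have hUA : ∀ x ∈ U, A x ∈ U := fun x hx => h1.le ⟨x, hx, rfl⟩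
  have hUs : ∀ y ∈ U, ∃ x ∈ U, A x = y := fun y hy => h1.ge hy
  have hUr : ∀ n, ∀ x ∈ U, r n x ∈ U := by
    intro n x hx
    rw [hU, Submodule.mem_iInf] at hx ⊢
    intro j
    obtain ⟨y, hy, hxy⟩ := hx j
    refine ⟨r n y, hVr n y hy, ?_⟩
    rw [← hxy]
    exact hR.comm_pow n j y
  obtain ⟨w, hw, hwA, hw0⟩ : ∃ w : ℕ → E, (∀ k, w k ∈ U) ∧ (∀ k, A (w (k + 1)) = w k) ∧
      w 0 = w₀ := by
    choose! f hf using hUs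
    have hmem : ∀ k, f^[k] w₀ ∈ U := by
      intro k
      induction k with
      | zero => exact hw₀
      | succ k ih => rw [Function.iterate_succ_apply']; exact (hf _ ih).1
    refine ⟨fun k => f^[k] w₀, hmem, fun k => ?_, rfl⟩
    change A (f^[k + 1] w₀) = f^[k] w₀
    rw [Function.iterate_succ_apply']
    exact (hf _ (hmem k)).2
  set Z := U.topologicalClosure with hZ
  have hZc : IsClosed (Z : Set E) := U.isClosed_topologicalClosure
  have hUZ : U ≤ Z := U.le_topologicalClosure
  have hZA : ∀ z ∈ Z, A z ∈ Z := topologicalClosure_apply_mem fun y hy => hUZ (hUA y hy)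
  have hZr : ∀ n, ∀ z ∈ Z, r n z ∈ Z := fun n =>
    topologicalClosure_apply_mem fun y hy => hUZ (hUr n y hy)
  have hZd : ∀ u ∈ Z, ∀ ε : ℝ, 0 < ε → ∃ v ∈ Z, ‖A v - u‖ < ε := by
    intro u hu ε hε
    obtain ⟨y, hy, hyu⟩ := Metric.mem_closure_iff.1 hu ε hε
    obtain ⟨v, hv, rfl⟩ := hUs y hy
    exact ⟨v, hUZ hv, by rwa [dist_comm, dist_eq_norm] at hyu⟩
  refine ⟨Z, hZc, hZA, hZr, hZd, ?_, w, fun k => hUZ (hw k), by rw [hw0]; exact hw₀0,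
    by rw [hw0]; exact hw₀A, hwA⟩
  -- On `Z` the operator has dense range, so if it were not singular it would be invertible, which
  -- the kernel vector `w₀` forbids.
  by_contra hs
  have : CompleteSpace Z := hZc.completeSpace_coe
  obtain ⟨X, -, hX⟩ := exists_inverse_of_not_singularOn (hR.restrict_seq hZA hZr)
    (SingularOn.of_restrict hZA hs) (by
      intro u
      rw [Metric.mem_closure_iff]
      intro ε hε
      obtain ⟨v, hv, hvu⟩ := hZd u u.2 ε hε
      refine ⟨_, ⟨⟨v, hv⟩, rfl⟩, ?_⟩
      rw [dist_comm, Subtype.dist_eq, dist_eq_norm]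
      exact hvu)
  have h3 := congrArg (fun f : Z →L[ℂ] Z => f ⟨w₀, hUZ hw₀⟩) hX
  have h4 : A.restrict hZA ⟨w₀, hUZ hw₀⟩ = 0 := Subtype.ext hw₀A
  simp only [mul_apply_eq_comp, h4, map_zero] at h3
  exact hw₀0 (congrArg Subtype.val h3.symm)

/-- `W` is the closure of `D ^ k Y`, on which `D` has dense range by `hk`. If `D` were not singular
on `W` it would be invertible there. For `z` in `Y`, pull `(D ^ k) z` back inside `W` to `u`; then
`z - u` lies in the finite-dimensional kernel of `D ^ k` on `Y`. A unit `z` orthogonal to this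
kernel with `D z` small makes `u` small, yet the inner product of `u` with `z` is one. -/
theorem singularOn_closure_map_pow (hR : ResolventSeq D κ r) {Y : Submodule ℂ E}
    (hY : ∀ y ∈ Y, D y ∈ Y) (hYr : ∀ n, ∀ y ∈ Y, r n y ∈ Y) (hYc : IsClosed (Y : Set E))
    (hs : SingularOn D Y)
    (hker : FiniteDimensional ℂ ((D : E →ₗ[ℂ] E).ker ⊓ Y : Submodule ℂ E)) (k : ℕ)
    (hk : ∀ y ∈ Y, (D ^ k) y ∈
      (Y.map ((D ^ (k + 1) : E →L[ℂ] E) : E →ₗ[ℂ] E)).topologicalClosure) :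
    ∃ W ≤ Y, IsClosed (W : Set E) ∧ (∀ z ∈ W, D z ∈ W) ∧
      (∀ u ∈ W, ∀ ε : ℝ, 0 < ε → ∃ v ∈ W, ‖D v - u‖ < ε) ∧ SingularOn D W := by
  set V := Y.map ((D ^ k : E →L[ℂ] E) : E →ₗ[ℂ] E) with hV
  set W := V.topologicalClosure with hW
  have hYpow : ∀ j, ∀ y ∈ Y, (D ^ j) y ∈ Y := by
    intro j
    induction j with
    | zero => exact fun x hx => hx
    | succ j ih => intro x hx; rw [pow_succ_clm_apply']; exact hY _ (ih x hx)
  have hWY : W ≤ Y := Submodule.topologicalClosure_minimal _ (by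
    rintro _ ⟨y, hy, rfl⟩; exact hYpow k y hy) hYc
  have hWc : IsClosed (W : Set E) := V.isClosed_topologicalClosure
  have hWD : ∀ z ∈ W, D z ∈ W := topologicalClosure_apply_mem (by
    rintro _ ⟨y, hy, rfl⟩
    refine V.le_topologicalClosure ⟨D y, hY y hy, ?_⟩
    exact (pow_succ_clm_apply D k y).symm.trans (pow_succ_clm_apply' D k y))
  have hWr : ∀ n, ∀ z ∈ W, r n z ∈ W := fun n => topologicalClosure_apply_mem (by
    rintro _ ⟨y, hy, rfl⟩
    exact V.le_topologicalClosure ⟨r n y, hYr n y hy, hR.comm_pow n k y⟩)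
  have hWd : ∀ u ∈ W, ∀ ε : ℝ, 0 < ε → ∃ v ∈ W, ‖D v - u‖ < ε := by
    intro u hu ε hε
    have h1 : W ≤ (Y.map ((D ^ (k + 1) : E →L[ℂ] E) : E →ₗ[ℂ] E)).topologicalClosure :=
      Submodule.topologicalClosure_minimal _ (by rintro _ ⟨y, hy, rfl⟩; exact hk y hy)
        (Submodule.isClosed_topologicalClosure _)
    obtain ⟨_, ⟨y, hy, rfl⟩, hyu⟩ := Metric.mem_closure_iff.1 (h1 hu) ε hε
    refine ⟨(D ^ k) y, V.le_topologicalClosure ⟨y, hy, rfl⟩, ?_⟩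
    rw [← pow_succ_clm_apply']
    rwa [dist_comm, dist_eq_norm] at hyu
  refine ⟨W, hWY, hWc, hWD, hWd, ?_⟩
  by_contra hns
  have : CompleteSpace W := hWc.completeSpace_coe
  obtain ⟨X, hX1, hX2⟩ := exists_inverse_of_not_singularOn (hR.restrict_seq hWD hWr)
    (SingularOn.of_restrict hWD hns) (by
      intro u
      rw [Metric.mem_closure_iff]
      intro ε hε
      obtain ⟨v, hv, hvu⟩ := hWd u u.2 ε hε
      refine ⟨_, ⟨⟨v, hv⟩, rfl⟩, ?_⟩
      rw [dist_comm, Subtype.dist_eq, dist_eq_norm]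
      exact hvu)
  set d := D.restrict hWD with hd
  have hcomm : Commute d X := hX1.trans hX2.symm
  have hdX : ∀ j : ℕ, d ^ j * X ^ j = 1 := fun j => by
    rw [← hcomm.mul_pow, hX1, one_pow]
  have hXd : X ^ (k + 1) * d = X ^ k := by rw [pow_succ, mul_assoc, hX2, mul_one]
  have hFk : FiniteDimensional ℂ (((D ^ k : E →L[ℂ] E) : E →ₗ[ℂ] E).ker ⊓ Y : Submodule ℂ E) := by
    set T : Y →ₗ[ℂ] Y := (D : E →ₗ[ℂ] E).restrict hY with hT
    have hTk : FiniteDimensional ℂ T.ker := by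
      let f : T.ker →ₗ[ℂ] ((D : E →ₗ[ℂ] E).ker ⊓ Y : Submodule ℂ E) :=
        { toFun := fun x => ⟨x.1.1, congrArg Subtype.val x.2, x.1.2⟩
          map_add' := fun _ _ => rfl
          map_smul' := fun _ _ => rfl }
      refine FiniteDimensional.of_injective f fun x y h => ?_
      have h' : x.1.1 = y.1.1 := congrArg (fun z : ((D : E →ₗ[ℂ] E).ker ⊓ Y : Submodule ℂ E) =>
        (z : E)) h
      exact Subtype.ext (Subtype.ext h')
    have hpow : ∀ (j : ℕ) (y : Y), ((T ^ j) y : E) = (D ^ j) y := by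
      intro j
      induction j with
      | zero => intro y; rfl
      | succ j ih => intro y; rw [pow_succ, pow_succ_clm_apply]; exact ih _
    have h1 := finiteDimensional_ker_pow T k
    refine Submodule.finiteDimensional_of_le (S₂ := (T ^ k).ker.map Y.subtype) ?_
    rintro x ⟨hx, hxY⟩
    exact ⟨⟨x, hxY⟩, Subtype.ext ((hpow k ⟨x, hxY⟩).trans hx), rfl⟩
  set C : ℝ := ‖X ^ (k + 1)‖ * ‖D ^ k‖ + 1 with hC
  have hC0 : 0 < C := by positivity
  obtain ⟨z, hzY, hzF, hz1, hzD⟩ := hs _ hFk (1 / C) (by positivity)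
  let q : W := ⟨(D ^ k) z, V.le_topologicalClosure ⟨z, hzY, rfl⟩⟩
  let q' : W := ⟨(D ^ k) (D z), V.le_topologicalClosure ⟨D z, hY z hzY, rfl⟩⟩
  have hq' : d q = q' := Subtype.ext
    ((pow_succ_clm_apply' D k z).symm.trans (pow_succ_clm_apply D k z))
  set u : W := (X ^ k) q with hu
  have hu' : u = (X ^ (k + 1)) q' := by rw [← hq', hu, ← hXd]; rfl
  have hun : ‖(u : E)‖ < 1 := by
    have h1 : ‖u‖ ≤ ‖X ^ (k + 1)‖ * (‖D ^ k‖ * ‖D z‖) := by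
      rw [hu']
      refine ((X ^ (k + 1)).le_opNorm q').trans (mul_le_mul_of_nonneg_left ?_ (norm_nonneg _))
      exact (D ^ k).le_opNorm _
    have h2 : ‖D z‖ * C < 1 := by rwa [lt_div_iff₀ hC0] at hzD
    have h3 : ‖u‖ = ‖(u : E)‖ := rfl
    rw [← h3]
    nlinarith [norm_nonneg (D z)]
  have hzu : z - u ∈ (((D ^ k : E →L[ℂ] E) : E →ₗ[ℂ] E).ker ⊓ Y : Submodule ℂ E) := by
    refine ⟨?_, sub_mem hzY (hWY u.2)⟩
    change (D ^ k) (z - u) = 0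
    have h1 : (D ^ k) (u : E) = (D ^ k) z := by
      rw [← restrict_pow_apply hWD k u, hu, ← hd]
      have := congrArg (fun f : W →L[ℂ] W => f q) (hdX k)
      exact congrArg Subtype.val this
    rw [map_sub, h1, sub_self]
  have h1 : inner ℂ (z - u) z = (0 : ℂ) := hzF _ hzu
  rw [inner_sub_left, sub_eq_zero, inner_self_eq_norm_sq_to_K, hz1] at h1
  have h2 := norm_inner_le_norm (𝕜 := ℂ) (u : E) z
  rw [← h1, hz1, mul_one] at h2
  simp at h2
  linarith

/-- `D` maps everything into `Y`, where it has an inverse `X` modulo a finite-rank `P`. Thus `x - X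
(D x)` lies in the preimage under `D` of the range of `P`, a finite-dimensional space. On the kernel
of `A` this map is injective, since `x = X (D x)` puts `x` in `Y`, the orthogonal complement of that
kernel. -/
theorem finiteDimensional_ker_of_adjoint_not_singularOn {A : E →L[ℂ] E}
    (hR : ResolventSeq (ContinuousLinearMap.adjoint A) κ r)
    (hr : ∀ n, ∀ y ∈ ((A : E →ₗ[ℂ] E).ker)ᗮ, r n y ∈ ((A : E →ₗ[ℂ] E).ker)ᗮ)
    [FiniteDimensional ℂ ((ContinuousLinearMap.adjoint A : E →L[ℂ] E) : E →ₗ[ℂ] E).ker]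
    (hs : ¬ SingularOn (ContinuousLinearMap.adjoint A) ((A : E →ₗ[ℂ] E).ker)ᗮ) :
    FiniteDimensional ℂ (A : E →ₗ[ℂ] E).ker := by
  set Y := ((A : E →ₗ[ℂ] E).ker)ᗮ with hYdef
  set D := ContinuousLinearMap.adjoint A with hD
  have hDY : ∀ x, D x ∈ Y := by
    intro x u hu
    have : A u = 0 := hu
    rw [hD, ContinuousLinearMap.adjoint_inner_right, this, inner_zero_left]
  have : CompleteSpace Y := (Submodule.isClosed_orthogonal _).completeSpace_coe
  obtain ⟨K, P, X, hP, h1, -, -, -, -⟩ := exists_browder_of_not_singularOn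
    (hR.restrict_seq (fun y _ => hDY y) hr) (SingularOn.of_restrict (fun y _ => hDY y) hs)
  set d := D.restrict (fun y (_ : y ∈ Y) => hDY y) with hd
  let F : Submodule ℂ E := ((P : Y →ₗ[ℂ] Y).range.map Y.subtype).comap (D : E →ₗ[ℂ] E)
  have hF : FiniteDimensional ℂ F := finiteDimensional_comap _ _
  let Q : E →ₗ[ℂ] E := LinearMap.id - Y.subtype ∘ₗ (X : Y →ₗ[ℂ] Y) ∘ₗ
    ((D.codRestrict Y hDY : E →L[ℂ] Y) : E →ₗ[ℂ] Y)
  have hQ : ∀ x, Q x ∈ F := by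
    intro x
    refine ⟨P ⟨D x, hDY x⟩, ⟨_, rfl⟩, ?_⟩
    have h2 := congrArg (fun f : Y →L[ℂ] Y => ((f ⟨D x, hDY x⟩ : Y) : E)) h1
    have h3 : D (X ⟨D x, hDY x⟩ : E) = D x - P ⟨D x, hDY x⟩ := h2
    change (P ⟨D x, hDY x⟩ : E) = D (x - X ⟨D x, hDY x⟩)
    rw [map_sub, h3, sub_sub_cancel]
  let f : (A : E →ₗ[ℂ] E).ker →ₗ[ℂ] F := (Q ∘ₗ (A : E →ₗ[ℂ] E).ker.subtype).codRestrict F fun x => hQ x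
  refine FiniteDimensional.of_injective f ?_
  rw [← LinearMap.ker_eq_bot, eq_bot_iff]
  rintro ⟨x, hx⟩ h
  have h2 : x - (X ⟨D x, hDY x⟩ : E) = 0 := congrArg Subtype.val h
  have h3 : x ∈ Y := by
    rw [sub_eq_zero] at h2
    rw [h2]; exact (X ⟨D x, hDY x⟩).2
  exact Subtype.ext (inner_self_eq_zero.1 (h3 x hx))

end Cyclic

end Subspaces

/-! ### Rank-one perturbations creating a pair of eigenvectors -/

section RankOnePerturbation

variable {E : Type*} [NormedAddCommGroup E] [InnerProductSpace ℂ E]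

/-- Perturbed approximate eigenvectors with two error directions `v` and `x`. -/
structure PerturbedFamily (A : E →L[ℂ] E) (δ τ : ℕ → ℝ) (ε : ℝ) (e h : ℕ → E)
    (lam c xi : ℕ → ℂ) (v x : E) : Prop where
  orth : Orthonormal ℂ e
  near_zero : ‖h 0 - e 0‖ ≤ δ 0
  near : ∃ C : ℝ, ∀ n, ‖h (n + 1) - e (n + 1)‖ ≤ C * δ n
  eq : ∀ n, A (h n) = lam n • h n + c n • v + xi n • x
  bound_zero : ‖lam 0‖ < ε
  bound : ∀ n, ‖lam (n + 1)‖ ≤ τ n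

theorem EigenFamily.perturbedFamily {A : E →L[ℂ] E} {δ τ : ℕ → ℝ} {e h : ℕ → E} {lam c : ℕ → ℂ}
    {v : E} (H : EigenFamily A δ τ e h lam c v) (hδ : Antitone δ) (hτ : Antitone τ) {ε : ℝ}
    (hε : τ 0 < ε) : PerturbedFamily A δ τ ε e h lam c 0 v 0 where
  orth := H.orth
  near_zero := H.near 0
  near := ⟨1, fun n => by rw [one_mul]; exact (H.near _).trans (hδ (Nat.le_succ n))⟩
  eq n := by rw [H.eq]; simp
  bound_zero := (H.bound 0).trans_lt hε
  bound n := (H.bound _).trans (hτ (Nat.le_succ n))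

theorem Orthonormal.nat_cases {e : ℕ → E} (he : Orthonormal ℂ e) {p : E} (hp : ‖p‖ = 1)
    (hpe : ∀ n, inner ℂ p (e n) = 0) :
    Orthonormal ℂ (fun n => Nat.casesOn n p e : ℕ → E) := by
  refine ⟨fun n => ?_, fun i j hij => ?_⟩
  · cases n with
    | zero => exact hp
    | succ n => exact he.1 n
  · cases i with
    | zero =>
      cases j with
      | zero => exact absurd rfl hij
      | succ j => exact hpe j
    | succ i =>
      cases j with
      | zero => exact inner_eq_zero_symm.1 (hpe i)
      | succ j => exact he.2 (fun h => hij (congrArg Nat.succ h))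

/-- The eigenvector `p` enters as the term of index zero. Subtracting `ρ • p` from `v` makes the
error orthogonal to `x'`; adding `t n • p` to `h n` with `t n * (lam n - s) = c n * ρ` restores the
eigenvalue equation. The denominators are safe because `‖lam n‖` is at most half of `‖s‖`. -/
theorem EigenFamily.exists_perturbedFamily {A B : E →L[ℂ] E} {δ τ : ℕ → ℝ} {e h : ℕ → E}
    {lam c : ℕ → ℂ} {v p x x' : E} {s N : ℂ} {ε : ℝ} (H : EigenFamily B δ τ e h lam c v)
    (hδ : ∀ n, 0 < δ n) (hp : ‖p‖ = 1)
    (hpe : ∀ n, inner ℂ p (e n) = 0) (hN : N ≠ 0) (hx'p : inner ℂ x' p = N) (hs : s ≠ 0)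
    (hsε : ‖s‖ < ε) (hτs : ∀ n, τ n ≤ ‖s‖ / 2) (hBp : B p = s • p)
    (hA : ∀ z, A z = B z + (N⁻¹ * inner ℂ x' z) • x) :
    ∃ (e' h' : ℕ → E) (lam' c' xi' : ℕ → ℂ) (v' : E),
      PerturbedFamily A δ τ ε e' h' lam' c' xi' v' x ∧ h' 0 = p ∧
      (∀ n, ∃ t : ℂ, h' (n + 1) = h n + t • p) ∧ (∃ t : ℂ, v' = v + t • p) ∧
      inner ℂ x' v' = 0 := by
  set ρ : ℂ := inner ℂ x' v / N with hρ
  have hsn : 0 < ‖s‖ := norm_pos_iff.2 hs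
  have hls : ∀ n, ‖s‖ / 2 ≤ ‖lam n - s‖ := by
    intro n
    have h1 := norm_sub_norm_le s (lam n)
    have h2 := (H.bound n).trans (hτs n)
    rw [norm_sub_rev] at h1
    linarith
  have hls0 : ∀ n, lam n - s ≠ 0 := fun n h0 => by
    have := hls n
    rw [h0, norm_zero] at this
    linarith
  let t : ℕ → ℂ := fun n => c n * ρ / (lam n - s)
  refine ⟨fun n => Nat.casesOn n p e, fun n => Nat.casesOn n p fun k => h k + t k • p,
    fun n => Nat.casesOn n s lam, fun n => Nat.casesOn n 0 c,
    fun n => N⁻¹ * inner ℂ x' (Nat.casesOn n p fun k => h k + t k • p : E), v - ρ • p, ?_, rfl,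
    fun n => ⟨t n, rfl⟩, ⟨-ρ, by rw [neg_smul, sub_eq_add_neg]⟩, ?_⟩
  · refine ⟨H.orth.nat_cases hp hpe, ?_, ⟨1 + ‖ρ‖ / (‖s‖ / 2), fun n => ?_⟩, fun n => ?_, hsε,
      H.bound⟩
    · change ‖p - p‖ ≤ δ 0
      rw [sub_self, norm_zero]; exact (hδ 0).le
    · change ‖h n + t n • p - e n‖ ≤ _
      have h1 : h n + t n • p - e n = (h n - e n) + t n • p := by abel
      rw [h1]
      refine (norm_add_le _ _).trans ?_
      rw [norm_smul, hp, mul_one, add_mul, one_mul]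
      refine add_le_add (H.near n) ?_
      change ‖c n * ρ / (lam n - s)‖ ≤ _
      rw [norm_div, norm_mul, div_mul_eq_mul_div, mul_comm ‖ρ‖]
      exact div_le_div₀ (by have := hδ n; positivity)
        (mul_le_mul_of_nonneg_right (H.small n) (norm_nonneg _)) (by positivity) (hls n)
    · cases n with
      | zero =>
        change A p = s • p + (0 : ℂ) • _ + (N⁻¹ * inner ℂ x' p) • x
        rw [hA, hBp, zero_smul, add_zero]
      | succ n =>
        change A (h n + t n • p) = lam n • (h n + t n • p) + c n • (v - ρ • p) + _ • x
        rw [hA, map_add, map_smul, hBp, H.eq]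
        congr 1
        have h2 : t n * s = lam n * t n - c n * ρ := by
          change c n * ρ / (lam n - s) * s = lam n * (c n * ρ / (lam n - s)) - c n * ρ
          field_simp [hls0 n]
          ring
        rw [smul_smul, h2, smul_add, smul_sub, sub_smul, smul_smul, smul_smul]
        abel
  · rw [inner_sub_right, inner_smul_right, hx'p, hρ, div_mul_cancel₀ _ hN, sub_self]

/-- If `T v` is near a vector orthogonal to `p`, the eigenvector relation makes the pairing of `v`
with `p` small, and a small multiple of `z₀` removes it. -/
theorem exists_apply_near_of_inter {T : E →L[ℂ] E} {Z : Submodule ℂ E} {p : E} {θ : ℂ}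
    (hθ : θ ≠ 0) (hp : ∀ v, inner ℂ p (T v) = θ * inner ℂ p v)
    (hd : ∀ u ∈ Z, ∀ ε : ℝ, 0 < ε → ∃ v ∈ Z, ‖T v - u‖ < ε) {z₀ : E} (hz₀ : z₀ ∈ Z)
    (hz₀p : inner ℂ p z₀ ≠ 0) :
    ∀ u ∈ Z ⊓ (ℂ ∙ p)ᗮ, ∀ ε : ℝ, 0 < ε → ∃ v ∈ Z ⊓ (ℂ ∙ p)ᗮ, ‖T v - u‖ < ε := by
  rintro u ⟨hu, hup⟩ ε hε
  have hup' : inner ℂ p u = 0 := Submodule.mem_orthogonal_singleton_iff_inner_right.1 hup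
  set C : ℝ := ‖p‖ / (‖θ‖ * ‖inner ℂ p z₀‖) * ‖T z₀‖ with hC
  have hC0 : 0 ≤ C := by positivity
  obtain ⟨v, hv, hvu⟩ := hd u hu (ε / (1 + C)) (by positivity)
  rw [lt_div_iff₀ (by positivity)] at hvu
  set t : ℂ := inner ℂ p v / inner ℂ p z₀ with ht
  have htn : ‖t‖ ≤ ‖p‖ / (‖θ‖ * ‖inner ℂ p z₀‖) * ‖T v - u‖ := by
    have h1 : inner ℂ p (T v - u) = θ * inner ℂ p v := by rw [inner_sub_right, hup', sub_zero, hp]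
    have h2 := norm_inner_le_norm (𝕜 := ℂ) p (T v - u)
    rw [h1, norm_mul] at h2
    have h3 : 0 < ‖θ‖ := norm_pos_iff.2 hθ
    have h4 : 0 < ‖inner ℂ p z₀‖ := norm_pos_iff.2 hz₀p
    rw [ht, norm_div, div_mul_eq_mul_div, div_le_div_iff₀ h4 (by positivity)]
    nlinarith
  refine ⟨v - t • z₀, ⟨sub_mem hv (Z.smul_mem _ hz₀), ?_⟩, ?_⟩
  · refine Submodule.mem_orthogonal_singleton_iff_inner_right.2 ?_
    rw [inner_sub_right, inner_smul_right, ht, div_mul_cancel₀ _ hz₀p, sub_self]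
  · have h1 : T (v - t • z₀) - u = (T v - u) - t • T z₀ := by rw [map_sub, map_smul]; abel
    rw [h1]
    refine (norm_sub_le _ _).trans_lt ?_
    rw [norm_smul]
    have h2 := mul_le_mul_of_nonneg_right htn (norm_nonneg (T z₀))
    have h3 : ‖p‖ / (‖θ‖ * ‖inner ℂ p z₀‖) * ‖T v - u‖ * ‖T z₀‖ = ‖T v - u‖ * C := by
      rw [hC]; ring
    nlinarith

theorem SingularOn.congr_orthogonal {D D' : E →L[ℂ] E} {Y : Submodule ℂ E} (h : SingularOn D Y)
    (G : Submodule ℂ E) [FiniteDimensional ℂ G] (hD : ∀ z ∈ Gᗮ, D' z = D z) :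
    SingularOn D' (Y ⊓ Gᗮ) := by
  intro F hF ε hε
  obtain ⟨z, hz, hzF, h1, h2⟩ := h (F ⊔ G) inferInstance ε hε
  rw [← Submodule.inf_orthogonal] at hzF
  exact ⟨z, ⟨hz, hzF.2⟩, hzF.1, h1, by rwa [hD z hzF.2]⟩

variable [CompleteSpace E]

/-- Two mutually orthogonal perturbed families for an operator and its adjoint. -/
def HasCoupledFamilies (A : E →L[ℂ] E) (δ τ : ℕ → ℝ) (ε : ℝ) : Prop :=
  ∃ e h lam c xi v x f g mu d eta w x',
    PerturbedFamily A δ τ ε e h lam c xi v x ∧ PerturbedFamily (adjoint A) δ τ ε f g mu d eta w x' ∧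
    (∀ i j, inner ℂ (h i) (g j) = 0) ∧ (∀ j, inner ℂ v (g j) = 0) ∧ inner ℂ v x' = 0 ∧
    (∀ j, inner ℂ (h j) w = 0) ∧ inner ℂ x w = 0 ∧ inner ℂ x x' = 0 ∧
    ((x = 0 ∧ x' = 0) ∨ (inner ℂ (g 0) x ≠ 0 ∧ inner ℂ (h 0) x' ≠ 0))

theorem HasCoupledFamilies.of_adjoint {A : E →L[ℂ] E} {δ τ : ℕ → ℝ} {ε : ℝ}
    (h : HasCoupledFamilies (adjoint A) δ τ ε) : HasCoupledFamilies A δ τ ε := by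
  obtain ⟨e, h, lam, c, xi, v, x, f, g, mu, d, eta, w, x', H1, H2, h1, h2, h3, h4, h5, h6, h7⟩ := h
  rw [ContinuousLinearMap.adjoint_adjoint] at H2
  refine ⟨f, g, mu, d, eta, w, x', e, h, lam, c, xi, v, x, H2, H1,
    fun i j => inner_eq_zero_symm.1 (h1 j i), fun j => inner_eq_zero_symm.1 (h4 j),
    inner_eq_zero_symm.1 h5, fun j => inner_eq_zero_symm.1 (h2 j), inner_eq_zero_symm.1 h3,
    inner_eq_zero_symm.1 h6, ?_⟩
  rcases h7 with h7 | h7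
  · exact Or.inl ⟨h7.2, h7.1⟩
  · exact Or.inr ⟨h7.2, h7.1⟩

theorem hasCoupledFamilies_of_families {A : E →L[ℂ] E} {δ τ : ℕ → ℝ} {ε : ℝ} (hδ : Antitone δ)
    (hτ : Antitone τ) (hε : τ 0 < ε) {e h lam c v f g mu d w}
    (H : EigenFamily A δ τ e h lam c v) (H' : EigenFamily (adjoint A) δ τ f g mu d w)
    (h1 : ∀ i j, inner ℂ (h i) (g j) = 0) (h2 : ∀ j, inner ℂ v (g j) = 0)
    (h3 : ∀ j, inner ℂ (h j) w = 0) : HasCoupledFamilies A δ τ ε :=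
  ⟨e, h, lam, c, 0, v, 0, f, g, mu, d, 0, w, 0, H.perturbedFamily hδ hτ hε,
    H'.perturbedFamily hδ hτ hε, h1, h2, inner_zero_right _, h3, inner_zero_left _,
    inner_zero_left _, Or.inl ⟨rfl, rfl⟩⟩

/-- `A` is a rank-one perturbation of `B`, where `p` and `p'` are eigenvectors of `B` and its
adjoint with eigenvalues `s` and `-conj s`. -/
structure RankOneSplit (A B : E →L[ℂ] E) (p p' x x' : E) (s N : ℂ) : Prop where
  apply : ∀ z, A z = B z + (N⁻¹ * inner ℂ x' z) • x
  adjoint_apply : ∀ z, adjoint A z = adjoint B z + (((starRingEnd ℂ) N)⁻¹ * inner ℂ x z) • x'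
  eigen : B p = s • p
  adjoint_eigen : adjoint B p' = (-(starRingEnd ℂ) s) • p'
  ne_zero : N ≠ 0
  inner_p : inner ℂ x' p = N
  inner_p' : inner ℂ x p' = (starRingEnd ℂ) N
  inner_x : inner ℂ x x' = 0
  x_eq : x = A p - s • p
  x'_eq : x' = adjoint A p' + (starRingEnd ℂ) s • p'
  norm_p : ‖p‖ = 1
  norm_p' : ‖p'‖ = 1
  orth : inner ℂ p p' = 0
  inner_apply : inner ℂ p' (A p) = N

/-- Subtract from `A` the rank-one operator built from the defects `x` and `x'` of `p` and `p'` as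
eigenvectors. The opposite signs of `s` are needed for `x` and `x'` to be orthogonal: by `h0` and
`h2` their pairing is `-s * N + s * N`. -/
theorem exists_rankOneSplit (A : E →L[ℂ] E) {p p' : E} (hp : ‖p‖ = 1) (hp' : ‖p'‖ = 1)
    (h0 : inner ℂ p p' = 0) (h1 : inner ℂ p' (A p) ≠ 0) (h2 : inner ℂ p' (A (A p)) = 0) (s : ℂ) :
    ∃ B x x' N, RankOneSplit A B p p' x x' s N := by
  set x := A p - s • p with hx
  set x' := adjoint A p' + (starRingEnd ℂ) s • p' with hx'
  set N := inner ℂ p' (A p) with hN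
  have h0' : inner ℂ p' p = 0 := inner_eq_zero_symm.1 h0
  let R : E →L[ℂ] E := N⁻¹ • (innerSL ℂ x').smulRight x
  have hR : ∀ z, R z = (N⁻¹ * inner ℂ x' z) • x := fun z => by
    rw [mul_smul]; rfl
  have hRa : ∀ z, adjoint R z = (((starRingEnd ℂ) N)⁻¹ * inner ℂ x z) • x' := by
    intro z
    refine ext_inner_left ℂ fun y => ?_
    have hc : (starRingEnd ℂ) (inner ℂ x' y) = inner ℂ y x' := inner_conj_symm _ _
    rw [ContinuousLinearMap.adjoint_inner_right, hR, inner_smul_left, inner_smul_right, map_mul,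
      map_inv₀, hc]
    ring
  have hxp : inner ℂ x' p = N := by
    rw [hx', inner_add_left, ContinuousLinearMap.adjoint_inner_left, inner_smul_left, h0',
      mul_zero, add_zero]
  have hxp' : inner ℂ x p' = (starRingEnd ℂ) N := by
    rw [hx, inner_sub_left, inner_smul_left, h0, mul_zero, sub_zero, hN, inner_conj_symm]
  have hNc : (starRingEnd ℂ) N ≠ 0 := (_root_.map_ne_zero _).2 h1
  refine ⟨A - R, x, x', N, fun z => ?_, fun z => ?_, ?_, ?_, h1, hxp, hxp', ?_, rfl, rfl, hp, hp', h0,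
    rfl⟩
  · rw [← hR]; simp
  · rw [← hRa, map_sub]; simp
  · change A p - R p = s • p
    rw [hR, hxp, inv_mul_cancel₀ h1, one_smul, hx, sub_sub_cancel]
  · rw [map_sub]
    change adjoint A p' - adjoint R p' = _
    rw [hRa, hxp', inv_mul_cancel₀ hNc, one_smul, hx', neg_smul, sub_add_cancel_left]
  · rw [inner_eq_zero_symm, hx', hx, inner_add_left, inner_smul_left, inner_sub_right,
      inner_sub_right, inner_smul_right, inner_smul_right, ContinuousLinearMap.adjoint_inner_left,
      ContinuousLinearMap.adjoint_inner_left, h2, h0', ← hN]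
    simp

namespace RankOneSplit

variable {A B : E →L[ℂ] E} {p p' x x' : E} {s N : ℂ}

/-- Both families for `B` are enlarged by `p` and `p'` at index zero, and corrected by multiples of
these. The relations survive because `p` is orthogonal to `p'`, `g` and `w`, and `p'` to `h` and
`v`; nondegeneracy comes from `N`. -/
theorem hasCoupledFamilies (S : RankOneSplit A B p p' x x' s N) (hs : s ≠ 0) {δ τ : ℕ → ℝ} {ε : ℝ}
    (hδ : ∀ n, 0 < δ n) (hsε : ‖s‖ < ε) (hτs : ∀ n, τ n ≤ ‖s‖ / 2) {e h lam c v f g mu d w}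
    (H : EigenFamily B δ τ e h lam c v) (H' : EigenFamily (adjoint B) δ τ f g mu d w)
    (he : ∀ n, inner ℂ p (e n) = 0) (hf : ∀ n, inner ℂ p' (f n) = 0)
    (hh : ∀ n, inner ℂ p' (h n) = 0) (hg : ∀ n, inner ℂ p (g n) = 0)
    (hv : inner ℂ p' v = 0) (hw : inner ℂ p w = 0)
    (h1 : ∀ i j, inner ℂ (h i) (g j) = 0) (h2 : ∀ j, inner ℂ v (g j) = 0)
    (h3 : ∀ j, inner ℂ (h j) w = 0) : HasCoupledFamilies A δ τ ε := by
  obtain ⟨e', h', lam', c', xi', v', F, hh0, hhs, ⟨t, hv'⟩, hxv⟩ :=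
    H.exists_perturbedFamily (x := x) (ε := ε) hδ S.norm_p he S.ne_zero S.inner_p hs hsε hτs S.eigen S.apply
  obtain ⟨f', g', mu', d', eta', w', F', hg0, hgs, ⟨t', hw'⟩, hxw⟩ :=
    H'.exists_perturbedFamily (x := x') (ε := ε) hδ S.norm_p' hf
      ((_root_.map_ne_zero _).2 S.ne_zero) S.inner_p'
      (neg_ne_zero.2 ((_root_.map_ne_zero (starRingEnd ℂ)).2 hs))
      (by rwa [norm_neg, RCLike.norm_conj]) (by simpa using hτs) S.adjoint_eigen S.adjoint_apply
  have hh' : ∀ n, inner ℂ (h n) p' = 0 := fun n => inner_eq_zero_symm.1 (hh n)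
  have hv2 : inner ℂ v p' = 0 := inner_eq_zero_symm.1 hv
  have hpg : ∀ j, inner ℂ p (g' j) = 0 := by
    intro j
    cases j with
    | zero => rw [hg0]; exact S.orth
    | succ j =>
      obtain ⟨t, ht⟩ := hgs j
      rw [ht, inner_add_right, inner_smul_right, hg, S.orth, mul_zero, add_zero]
  have hhp : ∀ j, inner ℂ (h' j) p' = 0 := by
    intro j
    cases j with
    | zero => rw [hh0]; exact S.orth
    | succ j =>
      obtain ⟨t, ht⟩ := hhs j
      rw [ht, inner_add_left, inner_smul_left, hh', S.orth, mul_zero, add_zero]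
  refine ⟨e', h', lam', c', xi', v', x, f', g', mu', d', eta', w', x', F, F', ?_, ?_,
    inner_eq_zero_symm.1 hxv, ?_, hxw, S.inner_x, Or.inr ⟨?_, ?_⟩⟩
  · intro i j
    cases i with
    | zero => rw [hh0]; exact hpg j
    | succ i =>
      cases j with
      | zero => rw [hg0]; exact hhp _
      | succ j =>
        obtain ⟨t, ht⟩ := hhs i
        obtain ⟨t2, ht2⟩ := hgs j
        rw [ht, inner_add_left, inner_smul_left, hpg, mul_zero, add_zero, ht2, inner_add_right,
          inner_smul_right, h1, hh', mul_zero, add_zero]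
  · intro j
    rw [hv', inner_add_left, inner_smul_left, hpg, mul_zero, add_zero]
    cases j with
    | zero => rw [hg0]; exact hv2
    | succ j =>
      obtain ⟨t, ht⟩ := hgs j
      rw [ht, inner_add_right, inner_smul_right, h2, hv2, mul_zero, add_zero]
  · intro j
    rw [hw', inner_add_right, inner_smul_right, hhp, mul_zero, add_zero]
    cases j with
    | zero => rw [hh0]; exact hw
    | succ j =>
      obtain ⟨t, ht⟩ := hhs j
      rw [ht, inner_add_left, inner_smul_left, h3, hw, mul_zero, add_zero]
  · rw [hg0, ← inner_conj_symm, S.inner_p', RCLike.conj_conj]; exact S.ne_zero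
  · rw [hh0, ← inner_conj_symm, S.inner_p, ]; exact (_root_.map_ne_zero _).2 S.ne_zero

theorem inner_apply_left (S : RankOneSplit A B p p' x x' s N) (v : E) :
    inner ℂ p (adjoint B v) = (starRingEnd ℂ) s * inner ℂ p v := by
  rw [ContinuousLinearMap.adjoint_inner_right, S.eigen, inner_smul_left]

theorem inner_apply_right (S : RankOneSplit A B p p' x x' s N) (v : E) :
    inner ℂ p' (B v) = (-s) * inner ℂ p' v := by
  rw [← ContinuousLinearMap.adjoint_inner_left, S.adjoint_eigen, inner_smul_left]
  simp

/-- The adjoint of `B` on the part of `Z'` orthogonal to `p`. -/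
theorem adjoint_inter (S : RankOneSplit A B p p' x x' s N) (hs : s ≠ 0) {Z' : Submodule ℂ E}
    (hZ : ∀ z ∈ Z', adjoint A z ∈ Z') (hp' : p' ∈ Z')
    (hspan : Z' ≤ ((ℂ ∙ p') ⊔ Z'.map (adjoint A : E →ₗ[ℂ] E)).topologicalClosure)
    (hsing : SingularOn (adjoint A) Z') (hpd : NotDominated (adjoint A) Z' p) :
    (∀ z ∈ Z' ⊓ (ℂ ∙ p)ᗮ, adjoint B z ∈ Z' ⊓ (ℂ ∙ p)ᗮ) ∧
    (∀ u ∈ Z' ⊓ (ℂ ∙ p)ᗮ, ∀ ε : ℝ, 0 < ε → ∃ v ∈ Z' ⊓ (ℂ ∙ p)ᗮ, ‖adjoint B v - u‖ < ε) ∧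
    SingularOn (adjoint B) (Z' ⊓ (ℂ ∙ p)ᗮ) := by
  have hx' : x' ∈ Z' := by
    rw [S.x'_eq]; exact add_mem (hZ _ hp') (Z'.smul_mem _ hp')
  have hB : ∀ z, adjoint B z = adjoint A z - (((starRingEnd ℂ) N)⁻¹ * inner ℂ x z) • x' := fun z => by
    rw [S.adjoint_apply, add_sub_cancel_right]
  have hNc : (starRingEnd ℂ) N ≠ 0 := (_root_.map_ne_zero _).2 S.ne_zero
  refine ⟨?_, ?_, ?_⟩
  · rintro z ⟨hz, hzp⟩
    refine ⟨?_, Submodule.mem_orthogonal_singleton_iff_inner_right.2 ?_⟩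
    · rw [hB]; exact sub_mem (hZ z hz) (Z'.smul_mem _ hx')
    · rw [S.inner_apply_left, Submodule.mem_orthogonal_singleton_iff_inner_right.1 hzp, mul_zero]
  · obtain ⟨z₀, hz₀, hz₀1, -⟩ := hpd.exists_inner_eq_one one_pos
    refine exists_apply_near_of_inter ((_root_.map_ne_zero (starRingEnd ℂ)).2 hs) S.inner_apply_left
      ?_ hz₀ (by rw [hz₀1]; exact one_ne_zero)
    set V := Z'.map (adjoint B : E →ₗ[ℂ] E) with hV
    -- `x` is `-s • p` plus `A p`, and the latter is dominated, being in the range of the adjoint of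
    -- `adjoint A`.
    have hxd : NotDominated (adjoint A) Z' x := by
      have h1 : x = (-s) • p + adjoint (adjoint A) p := by
        rw [S.x_eq, ContinuousLinearMap.adjoint_adjoint, neg_smul]; abel
      rw [h1]
      exact (hpd.smul (neg_ne_zero.2 hs)).add (not_notDominated_adjoint _ _ _)
    -- A vector nearly killed by `adjoint A` with pairing one with `x` is mapped by `adjoint B`
    -- close to a multiple of `x'`. So the closure contains `x'`, then the image of `adjoint A`,
    -- then `p'`, and by `hspan` all of `Z'`.
    have hx'V : x' ∈ V.topologicalClosure := by
      refine Metric.mem_closure_iff.2 fun ε hε => ?_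
      obtain ⟨y, hy, hy1, hyA⟩ := hxd.exists_inner_eq_one
        (show 0 < ε / ‖(starRingEnd ℂ) N‖ by positivity)
      refine ⟨adjoint B ((-(starRingEnd ℂ) N) • y), ⟨_, Z'.smul_mem _ hy, rfl⟩, ?_⟩
      have h1 : adjoint B ((-(starRingEnd ℂ) N) • y) = x' - (starRingEnd ℂ) N • adjoint A y := by
        rw [map_smul, hB, hy1, mul_one, smul_sub, smul_smul, neg_mul, mul_inv_cancel₀ hNc,
          neg_smul, neg_smul, one_smul]
        abel
      rw [h1, dist_eq_norm, sub_sub_cancel, norm_smul, ← lt_div_iff₀' (norm_pos_iff.2 hNc)]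
      exact hyA
    have hAV : ∀ z ∈ Z', adjoint A z ∈ V.topologicalClosure := by
      intro z hz
      rw [S.adjoint_apply]
      exact add_mem (V.le_topologicalClosure ⟨z, hz, rfl⟩) (Submodule.smul_mem _ _ hx'V)
    have hp'V : p' ∈ V.topologicalClosure := by
      have hsc : (starRingEnd ℂ) s ≠ 0 := (_root_.map_ne_zero _).2 hs
      have h1 : p' = ((starRingEnd ℂ) s)⁻¹ • (x' - adjoint A p') := by
        rw [S.x'_eq, add_sub_cancel_left, smul_smul, inv_mul_cancel₀ hsc, one_smul]
      rw [h1]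
      exact Submodule.smul_mem _ _ (sub_mem hx'V (hAV _ hp'))
    have hle : Z' ≤ V.topologicalClosure := hspan.trans
      (Submodule.topologicalClosure_minimal _ (sup_le
        ((Submodule.span_singleton_le_iff_mem _ _).2 hp'V)
        (by rintro _ ⟨z, hz, rfl⟩; exact hAV z hz)) V.isClosed_topologicalClosure)
    intro u hu ε hε
    obtain ⟨_, ⟨v, hv, rfl⟩, hvu⟩ := Metric.mem_closure_iff.1 (hle hu) ε hε
    exact ⟨v, hv, by rwa [dist_comm, dist_eq_norm] at hvu⟩
  · have h1 := hsing.congr_orthogonal ((ℂ ∙ p) ⊔ (ℂ ∙ x)) (D' := adjoint B) (by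
      intro z hz
      rw [← Submodule.inf_orthogonal] at hz
      rw [hB, Submodule.mem_orthogonal_singleton_iff_inner_right.1 hz.2, mul_zero, zero_smul,
        sub_zero])
    refine h1.mono (inf_le_inf_left _ ?_)
    exact Submodule.orthogonal_le le_sup_left

end RankOneSplit

end RankOnePerturbation

/-! ### Coupled families from an invariant subspace or infinite ascent -/

section Cases

variable {E : Type*} [NormedAddCommGroup E] [InnerProductSpace ℂ E]

/-- Admissible tolerances. -/
structure Tolerance (δ τ : ℕ → ℝ) (ε : ℝ) : Prop where
  pos_near : ∀ n, 0 < δ n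
  anti_near : Antitone δ
  pos_bound : ∀ n, 0 < τ n
  anti_bound : Antitone τ
  pos : 0 < ε
  le : τ 0 ≤ ε / 4

theorem Tolerance.lt {δ τ : ℕ → ℝ} {ε : ℝ} (T : Tolerance δ τ ε) : τ 0 < ε := by
  have := T.le; have := T.pos; linarith

/-- Families of approximate eigenvectors exist inside `Z` with arbitrary tolerances. -/
def HasFamilies (A : E →L[ℂ] E) (Z : Submodule ℂ E) : Prop :=
  ∀ (G : Submodule ℂ E), FiniteDimensional ℂ G → ∀ (δ τ : ℕ → ℝ), (∀ n, 0 < δ n) →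
    (∀ n, 0 < τ n) → Antitone τ → ∃ e h lam c v, EigenFamily A δ τ e h lam c v ∧
      (∀ n, e n ∈ Gᗮ) ∧ (∀ n, h n ∈ Z) ∧ v ∈ Z

theorem HasFamilies.mono {A : E →L[ℂ] E} {Z Z' : Submodule ℂ E} (h : HasFamilies A Z)
    (hZ : Z ≤ Z') : HasFamilies A Z' := by
  intro G hG δ τ hδ hτ hτa
  obtain ⟨e, h, lam, c, v, H, h1, h2, h3⟩ := h G hG δ τ hδ hτ hτa
  exact ⟨e, h, lam, c, v, H, h1, fun n => hZ (h2 n), hZ h3⟩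

theorem eigenFamily_of_ker {A : E →L[ℂ] E} {e : ℕ → E} (he : Orthonormal ℂ e)
    (h : ∀ n, A (e n) = 0) {δ τ : ℕ → ℝ} (hδ : ∀ n, 0 < δ n) (hτ : ∀ n, 0 < τ n) :
    EigenFamily A δ τ e e 0 0 0 :=
  ⟨he, fun n => by rw [sub_self, norm_zero]; exact (hδ n).le, fun n => by rw [h]; simp,
    fun n => by simpa using (hτ n).le, fun n => by simpa using (hδ n).le⟩

theorem hasFamilies_of_le_ker {A : E →L[ℂ] E} {U : Submodule ℂ E} (hU : ¬ FiniteDimensional ℂ U)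
    (h : ∀ x ∈ U, A x = 0) : HasFamilies A U := by
  intro G hG δ τ hδ hτ hτa
  obtain ⟨e, he, heU, heG⟩ := exists_orthonormal_mem (U := fun _ => U) (fun _ => hU) G
  exact ⟨e, e, 0, 0, 0, eigenFamily_of_ker he (fun n => h _ (heU n)) hδ hτ, heG, heU, U.zero_mem⟩

variable [CompleteSpace E]

theorem ResolventSeq.adjoint {A : E →L[ℂ] E} {κ : ℕ → ℂ} {r : ℕ → E →L[ℂ] E}
    (h : ResolventSeq A κ r) :
    ResolventSeq (adjoint A) (fun n => (starRingEnd ℂ) (κ n)) fun n => adjoint (r n) := by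
  refine ⟨?_, fun n x => ?_, fun n x => ?_⟩
  · have := (Complex.continuous_conj.tendsto 0).comp h.tendsto
    rwa [map_zero] at this
  · refine ext_inner_left ℂ fun y => ?_
    rw [ContinuousLinearMap.adjoint_inner_right, ContinuousLinearMap.adjoint_inner_right, h.left,
      inner_add_left, inner_smul_left, inner_add_right, inner_smul_right,
      ContinuousLinearMap.adjoint_inner_right]
  · refine ext_inner_left ℂ fun y => ?_
    rw [ContinuousLinearMap.adjoint_inner_right, ContinuousLinearMap.adjoint_inner_right, h.right,
      inner_add_left, inner_smul_left, inner_add_right, inner_smul_right,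
      ContinuousLinearMap.adjoint_inner_right]

theorem adjoint_mem_orthogonal {T : E →L[ℂ] E} {Z : Submodule ℂ E} (h : ∀ z ∈ Z, T z ∈ Z) :
    ∀ y ∈ Zᗮ, adjoint T y ∈ Zᗮ := by
  intro y hy z hz
  rw [ContinuousLinearMap.adjoint_inner_right]
  exact hy _ (h z hz)

theorem inner_adjoint_pow (A : E →L[ℂ] E) (k : ℕ) (x y : E) :
    inner ℂ ((adjoint A ^ k) x) y = inner ℂ x ((A ^ k) y) := by
  induction k generalizing x y with
  | zero => rfl
  | succ k ih =>
    rw [pow_succ_clm_apply, ih, ContinuousLinearMap.adjoint_inner_left, ← pow_succ_clm_apply']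

/-- Dominated vectors form a subspace, so one of `p`, `q`, `p + q` meets both demands before
normalization. -/
theorem exists_unit_notDominated {D : E →L[ℂ] E} {L V : Submodule ℂ E} {p q u : E} (hp : p ∈ L)
    (hpd : NotDominated D V p) (hq : q ∈ L) (hqu : inner ℂ q u ≠ 0) :
    ∃ p ∈ L, ‖p‖ = 1 ∧ NotDominated D V p ∧ inner ℂ p u ≠ 0 := by
  obtain ⟨p', hp', hpd', hpu'⟩ : ∃ p ∈ L, NotDominated D V p ∧ inner ℂ p u ≠ 0 := by
    by_cases h1 : inner ℂ p u = 0
    · by_cases h2 : NotDominated D V q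
      · exact ⟨q, hq, h2, hqu⟩
      · exact ⟨p + q, add_mem hp hq, hpd.add h2, by rwa [inner_add_left, h1, zero_add]⟩
    · exact ⟨p, hp, hpd, h1⟩
  have h0 : p' ≠ 0 := by
    rintro rfl
    exact hpu' (inner_zero_left _)
  have hn : ‖p'‖ ≠ 0 := norm_ne_zero_iff.2 h0
  have hc : ((‖p'‖⁻¹ : ℝ) : ℂ) ≠ 0 := Complex.ofReal_ne_zero.2 (inv_ne_zero hn)
  refine ⟨((‖p'‖⁻¹ : ℝ) : ℂ) • p', L.smul_mem _ hp', ?_, hpd'.smul hc, ?_⟩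
  · rw [norm_smul, Complex.norm_real, norm_inv, norm_norm, inv_mul_cancel₀ hn]
  · rw [inner_smul_left]
    exact mul_ne_zero ((_root_.map_ne_zero _).2 hc) hpu'

/-- Choice of the vector `p` matching a cyclic vector `p'` of the adjoint. -/
theorem exists_rankOneSplit_of_notDominated {A : E →L[ℂ] E} {M Z' : Submodule ℂ E} {p' v₀ v₁ : E}
    (hp' : ‖p'‖ = 1) (hv₀ : v₀ ∈ M) (hv₁ : v₁ ∈ M) (h00 : inner ℂ v₀ p' ≠ 0)
    (h01 : inner ℂ v₀ (adjoint A p') = 0) (h02 : inner ℂ v₀ (adjoint A (adjoint A p')) = 0)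
    (h11 : inner ℂ v₁ (adjoint A p') ≠ 0) (h12 : inner ℂ v₁ (adjoint A (adjoint A p')) = 0)
    (hnd : ∃ p ∈ M ⊓ ((ℂ ∙ p') ⊔ (ℂ ∙ adjoint A (adjoint A p')))ᗮ, NotDominated (adjoint A) Z' p)
    (s : ℂ) :
    ∃ p ∈ M, ∃ B x x' N, RankOneSplit A B p p' x x' s N ∧ NotDominated (adjoint A) Z' p ∧
      inner ℂ p (adjoint A (adjoint A p')) = 0 := by
  obtain ⟨p₀, hp₀, hp₀d⟩ := hnd
  set L := M ⊓ ((ℂ ∙ p') ⊔ (ℂ ∙ adjoint A (adjoint A p')))ᗮ with hL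
  have hLmem : ∀ y, y ∈ L ↔ y ∈ M ∧ inner ℂ y p' = 0 ∧ inner ℂ y (adjoint A (adjoint A p')) = 0 := by
    intro y
    rw [hL, ← Submodule.inf_orthogonal]
    exact and_congr Iff.rfl (and_congr Submodule.mem_orthogonal_singleton_iff_inner_left
      Submodule.mem_orthogonal_singleton_iff_inner_left)
  -- Removing a multiple of `v₀` from `v₁` gives orthogonality to `p'` without losing the nonzero
  -- pairing with `adjoint A p'`.
  set t : ℂ := (starRingEnd ℂ) (inner ℂ v₁ p' / inner ℂ v₀ p') with ht
  have hq : v₁ - t • v₀ ∈ L := by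
    refine (hLmem _).2 ⟨sub_mem hv₁ (M.smul_mem _ hv₀), ?_, ?_⟩
    · rw [inner_sub_left, inner_smul_left, ht, RCLike.conj_conj, div_mul_cancel₀ _ h00, sub_self]
    · rw [inner_sub_left, inner_smul_left, h12, h02, mul_zero, sub_zero]
  obtain ⟨p, hp, hp1, hpd, hpu⟩ := exists_unit_notDominated hp₀ hp₀d hq (u := adjoint A p') (by
    rw [inner_sub_left, inner_smul_left, h01, mul_zero, sub_zero]; exact h11)
  obtain ⟨hpM, hp2, hp3⟩ := (hLmem p).1 hp
  obtain ⟨B, x, x', N, S⟩ := exists_rankOneSplit A hp1 hp' hp2 (by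
      rw [← ContinuousLinearMap.adjoint_inner_left]
      exact fun h => hpu (inner_eq_zero_symm.1 h)) (by
      rw [← ContinuousLinearMap.adjoint_inner_left, ← ContinuousLinearMap.adjoint_inner_left]
      exact inner_eq_zero_symm.1 hp3) s
  exact ⟨p, hpM, B, x, x', N, S, hpd, hp3⟩

/-- A family for the adjoint inside `Zᗮ` is automatically coupled to the one in `Z`. It exists if
the adjoint has infinite-dimensional kernel in `Zᗮ`, or if the closures of the images of its powers
become stationary. Failing both, a cyclic vector `p'` in `Zᗮ` and a rank-one perturbation are used.
-/
theorem hasCoupledFamilies_of_split {A : E →L[ℂ] E} {κ : ℕ → ℂ} {r : ℕ → E →L[ℂ] E}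
    (hR : ResolventSeq (adjoint A) κ r) (hκ : ∀ n, κ n ≠ 0) {Z : Submodule ℂ E}
    (hZ : ∀ z ∈ Z, A z ∈ Z) (hZr : ∀ n, ∀ y ∈ Zᗮ, r n y ∈ Zᗮ) (hf : HasFamilies A Z)
    (hs : SingularOn (adjoint A) Zᗮ) {δ τ : ℕ → ℝ} {ε : ℝ} (T : Tolerance δ τ ε) :
    HasCoupledFamilies A δ τ ε := by
  have hY := adjoint_mem_orthogonal hZ
  have hYc : IsClosed (Zᗮ : Set E) := Submodule.isClosed_orthogonal Z
  have halpha : HasFamilies (adjoint A) Zᗮ → HasCoupledFamilies A δ τ ε := by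
    intro hf'
    obtain ⟨e, h, lam, c, v, H, -, h1, h2⟩ := hf ⊥ inferInstance δ τ T.pos_near T.pos_bound T.anti_bound
    obtain ⟨f, g, mu, d, w, H', -, h1', h2'⟩ :=
      hf' ⊥ inferInstance δ τ T.pos_near T.pos_bound T.anti_bound
    exact hasCoupledFamilies_of_families T.anti_near T.anti_bound T.lt H H'
      (fun i j => h1' j _ (h1 i)) (fun j => h1' j _ h2) (fun j => h2' _ (h1 j))
  by_cases hker : FiniteDimensional ℂ
      (((adjoint A : E →L[ℂ] E) : E →ₗ[ℂ] E).ker ⊓ Zᗮ : Submodule ℂ E)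
  swap
  · exact halpha ((hasFamilies_of_le_ker hker fun x hx => hx.1).mono inf_le_right)
  set D := adjoint A with hD
  by_cases hcl : ∃ k, ∀ y ∈ Zᗮ, (D ^ k) y ∈
      (Zᗮ.map ((D ^ (k + 1) : E →L[ℂ] E) : E →ₗ[ℂ] E)).topologicalClosure
  · obtain ⟨k, hk⟩ := hcl
    obtain ⟨W, hWY, hWc, hWD, hWd, hWs⟩ := singularOn_closure_map_pow hR hY hZr hYc hs hker k hk
    refine halpha (HasFamilies.mono ?_ hWY)
    intro G hG δ τ hδ hτ hτa
    exact exists_eigenFamily hWc hWD hWd hWs G hδ hτ hτa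
  push Not at hcl
  -- The image of `D ^ k` is never contained in the closure of the image of `D ^ (k + 1)`; the
  -- component orthogonal to that closure separates them.
  have hv : ∀ k, ∃ v : E, (∀ y ∈ Zᗮ, inner ℂ v ((D ^ (k + 1)) y) = 0) ∧
      ∃ y ∈ Zᗮ, inner ℂ v ((D ^ k) y) ≠ 0 := by
    intro k
    obtain ⟨y, hy, hyW⟩ := hcl k
    set W := (Zᗮ.map ((D ^ (k + 1) : E →L[ℂ] E) : E →ₗ[ℂ] E)).topologicalClosure with hW
    have : CompleteSpace W := (Submodule.isClosed_topologicalClosure _).completeSpace_coe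
    have hvW : (D ^ k) y - W.starProjection ((D ^ k) y) ∈ Wᗮ :=
      Submodule.sub_starProjection_mem_orthogonal _
    refine ⟨(D ^ k) y - W.starProjection ((D ^ k) y), fun z hz => ?_, y, hy, fun h0 => ?_⟩
    · exact inner_eq_zero_symm.1 (hvW _ (Submodule.le_topologicalClosure _ ⟨z, hz, rfl⟩))
    · have h1 : inner ℂ ((D ^ k) y - W.starProjection ((D ^ k) y))
          ((D ^ k) y - W.starProjection ((D ^ k) y)) = (0 : ℂ) := by
        rw [inner_sub_right, h0,
          inner_eq_zero_symm.1 (hvW _ (Submodule.starProjection_apply_mem _ _)), sub_zero]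
      rw [inner_self_eq_zero, sub_eq_zero] at h1
      rw [h1] at hyW
      exact hyW (Submodule.starProjection_apply_mem _ _)
  choose v hv0 hv1 using hv
  obtain ⟨p', hp'Y, hp'1, hp'v, hp's⟩ := exists_cyclic_singularOn hR hYc hY hZr hv0 hv1
  set Z' := cyclicSubspace D r p' with hZ'
  have hZ'Y : Z' ≤ Zᗮ := cyclicSubspace_le hYc hY hZr hp'Y
  have hp'Z' : p' ∈ Z' := mem_cyclicSubspace
  have hDp' : D p' ∈ Zᗮ := hY _ hp'Y
  -- The additional eigenvalue is `ε / 2`: below the norm bound, and at least twice every `τ n`,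
  -- hence separated from the other eigenvalues.
  have hs0 : ((ε / 2 : ℝ) : ℂ) ≠ 0 := Complex.ofReal_ne_zero.2 (half_pos T.pos).ne'
  have hsn : ‖((ε / 2 : ℝ) : ℂ)‖ = ε / 2 := by
    rw [Complex.norm_real, Real.norm_of_nonneg (half_pos T.pos).le]
  obtain ⟨p, -, B, x, x', N, S, hpd, -⟩ := exists_rankOneSplit_of_notDominated (A := A) (M := ⊤)
    (Z' := Z') hp'1 (v₀ := v 0) (v₁ := v 1) trivial trivial (hp'v 0) (hv0 0 p' hp'Y)
    (hv0 0 _ hDp') (hp'v 1) (hv0 1 p' hp'Y) (by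
      set L := (⊤ : Submodule ℂ E) ⊓ ((ℂ ∙ p') ⊔ (ℂ ∙ D (D p')))ᗮ with hL
      have hLc : IsClosed (L : Set E) := isClosed_univ.inter (Submodule.isClosed_orthogonal _)
      have : CompleteSpace L := hLc.completeSpace_coe
      refine exists_notDominated one_pos fun ε hε => ?_
      obtain ⟨y, hy, hyG, hy1, hyD⟩ := hp's ((ℂ ∙ p') ⊔ (ℂ ∙ D (D p'))) inferInstance ε hε
      refine ⟨y, hy, hyD, ?_⟩
      rw [Submodule.starProjection_eq_self_iff.2 (show y ∈ L from ⟨trivial, hyG⟩), hy1])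
    ((ε / 2 : ℝ) : ℂ)
  obtain ⟨hB1, hB2, hB3⟩ := S.adjoint_inter hs0 apply_mem_cyclicSubspace hp'Z'
    (cyclicSubspace_le_closure hR hκ) hp's hpd
  have hx'Y : x' ∈ Zᗮ := by
    rw [S.x'_eq]; exact add_mem hDp' (Submodule.smul_mem _ _ hp'Y)
  obtain ⟨e, h, lam, c, v', H, heG, hh, hv'⟩ := hf (ℂ ∙ p) inferInstance δ τ T.pos_near T.pos_bound
    T.anti_bound
  -- `x'` lies in `Zᗮ`, so `A` and `B` agree on `Z`.
  have HB : EigenFamily B δ τ e h lam c v' := by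
    refine ⟨H.orth, H.near, fun n => ?_, H.bound, H.small⟩
    have h1 := S.apply (h n)
    rw [inner_eq_zero_symm.1 (hx'Y _ (hh n)), mul_zero, zero_smul, add_zero] at h1
    rw [← h1, H.eq]
  obtain ⟨f, g, mu, d, w, H', hfG, hg, hw⟩ := exists_eigenFamily
    (isClosed_cyclicSubspace.inter (Submodule.isClosed_orthogonal (ℂ ∙ p))) hB1 hB2 hB3 (ℂ ∙ p')
    T.pos_near T.pos_bound T.anti_bound
  refine S.hasCoupledFamilies hs0 T.pos_near (by rw [hsn]; linarith [T.pos])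
    (fun n => by rw [hsn]; linarith [T.anti_bound (Nat.zero_le n), T.le]) HB H'
    (fun n => Submodule.mem_orthogonal_singleton_iff_inner_right.1 (heG n))
    (fun n => Submodule.mem_orthogonal_singleton_iff_inner_right.1 (hfG n))
    (fun n => inner_eq_zero_symm.1 (hp'Y _ (hh n)))
    (fun n => Submodule.mem_orthogonal_singleton_iff_inner_right.1 (hg n).2)
    (inner_eq_zero_symm.1 (hp'Y _ hv')) (Submodule.mem_orthogonal_singleton_iff_inner_right.1 hw.2)
    (fun i j => hZ'Y (hg j).1 _ (hh i)) (fun j => hZ'Y (hg j).1 _ hv')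
    (fun j => hZ'Y hw.1 _ (hh j))

/-- Let `Z` be the divisible part of the generalized kernel. If the adjoint is singular on `Zᗮ`, the
split case applies. Otherwise near-kernel vectors of the adjoint keep a definite component in `Z`;
this gives a suitable `p` in `Z` for a rank-one split, and the coupled construction is run for `B`
on hyperplanes of `Z` and of a cyclic subspace. -/
theorem hasCoupledFamilies_of_infinite_ascent {A : E →L[ℂ] E} {κ : ℕ → ℂ} {r : ℕ → E →L[ℂ] E}
    (hR : ResolventSeq A κ r) (hκ : ∀ n, κ n ≠ 0) [FiniteDimensional ℂ (A : E →ₗ[ℂ] E).ker]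
    (hasc : ∀ k, ∃ x, (A ^ (k + 1)) x = 0 ∧ (A ^ k) x ≠ 0)
    {δ τ : ℕ → ℝ} {ε : ℝ} (T : Tolerance δ τ ε) : HasCoupledFamilies A δ τ ε := by
  obtain ⟨Z, hZc, hZ, hZr, hZd, hZs, w, hw, hw0, hwA, hwS⟩ := exists_divisible_part hR hasc
  have hκ' : ∀ n, (starRingEnd ℂ) (κ n) ≠ 0 := fun n => (_root_.map_ne_zero _).2 (hκ n)
  by_cases hs : SingularOn (adjoint A) Zᗮ
  · exact hasCoupledFamilies_of_split hR.adjoint hκ' hZ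
      (fun n => adjoint_mem_orthogonal (hZr n))
      (fun G hG δ τ hδ hτ hτa => exists_eigenFamily hZc hZ hZd hZs G hδ hτ hτa) hs T
  have : CompleteSpace Z := hZc.completeSpace_coe
  have hwpow : ∀ k, (A ^ k) (w k) = w 0 := by
    intro k
    induction k with
    | zero => rfl
    | succ k ih => rw [pow_succ_clm_apply, hwS, ih]
  set D := adjoint A with hD
  have hDinner : ∀ x y, inner ℂ x (D y) = inner ℂ (A x) y := fun x y =>
    ContinuousLinearMap.adjoint_inner_right _ _ _
  have hDpow : ∀ k x y, inner ℂ x ((D ^ k) y) = inner ℂ ((A ^ k) x) y := by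
    intro k
    induction k with
    | zero => intro x y; rfl
    | succ k ih => intro x y; rw [pow_succ_clm_apply', hDinner, ih, ← pow_succ_clm_apply]
  obtain ⟨p', -, hp'1, hp'v, hp's⟩ := exists_cyclic_singularOn hR.adjoint (Y := ⊤) isClosed_univ
    (fun _ _ => trivial) (fun _ _ _ => trivial) (v := w) (fun k y _ => by
      rw [← hD, hDpow, pow_succ_clm_apply', hwpow, hwA, inner_zero_left])
    (fun k => ⟨w 0, trivial, by rw [← hD, hDpow, hwpow]; exact inner_self_ne_zero.2 hw0⟩)
  rw [← hD] at hp's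
  have hw0p' : inner ℂ (w 0) p' ≠ 0 := hp'v 0
  have hp'w0 : inner ℂ p' (w 0) ≠ 0 := fun h => hw0p' (inner_eq_zero_symm.1 h)
  set Z' := cyclicSubspace D (fun n => adjoint (r n)) p' with hZ'
  have hp'Z' : p' ∈ Z' := mem_cyclicSubspace
  have hDZ' : ∀ z ∈ Z', D z ∈ Z' := apply_mem_cyclicSubspace
  have hs0 : ((ε / 2 : ℝ) : ℂ) ≠ 0 := Complex.ofReal_ne_zero.2 (half_pos T.pos).ne'
  have hsn : ‖((ε / 2 : ℝ) : ℂ)‖ = ε / 2 := by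
    rw [Complex.norm_real, Real.norm_of_nonneg (half_pos T.pos).le]
  set s : ℂ := ((ε / 2 : ℝ) : ℂ) with hsdef
  obtain ⟨F, hF, c₁, hc₁, hFc⟩ := exists_bound_of_not_singularOn hs
  obtain ⟨p, hpZ, B, x, x', N, S, hpd, hpDD⟩ := exists_rankOneSplit_of_notDominated (A := A) (M := Z)
    (Z' := Z') hp'1 (v₀ := w 0) (v₁ := w 1) (hw 0) (hw 1) hw0p'
    (by rw [← hD, hDinner, hwA, inner_zero_left]) (by rw [← hD, hDinner, hwA, inner_zero_left])
    (by rw [← hD, hDinner, hwS]; exact hw0p')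
    (by rw [← hD, hDinner, hwS, hDinner, hwA, inner_zero_left]) (by
      set L := Z ⊓ ((ℂ ∙ p') ⊔ (ℂ ∙ D (D p')))ᗮ with hL
      have hLc : IsClosed (L : Set E) := hZc.inter (Submodule.isClosed_orthogonal _)
      have : CompleteSpace L := hLc.completeSpace_coe
      have hq0 : 0 < c₁ / 2 / (c₁ + ‖D‖) := by positivity
      refine exists_notDominated hq0 fun ε' hε' => ?_
      let G : Submodule ℂ E := ((ℂ ∙ p') ⊔ (ℂ ∙ D (D p'))).map ((Z.starProjection : E →L[ℂ] E) : E →ₗ[ℂ] E)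
        ⊔ F.map ((Zᗮ.starProjection : E →L[ℂ] E) : E →ₗ[ℂ] E)
      obtain ⟨y, hy, hyG, hy1, hyD⟩ := hp's G inferInstance (min ε' (c₁ / 2)) (by positivity)
      refine ⟨y, hy, hyD.trans_le (min_le_left _ _), ?_⟩
      have hyD2 := hyD.le.trans (min_le_right _ _)
      rw [← Submodule.inf_orthogonal] at hyG
      obtain ⟨hyG1, hyG2⟩ := hyG
      set a := Z.starProjection y with ha
      set b := Zᗮ.starProjection y with hb
      have hab : a + b = y := Submodule.starProjection_add_starProjection_orthogonal _
      have haL : a ∈ L := by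
        refine ⟨Submodule.starProjection_apply_mem _ _, fun u hu => ?_⟩
        rw [ha, ← Submodule.inner_starProjection_left_eq_right]
        exact hyG1 _ ⟨u, hu, rfl⟩
      have hbF : b ∈ Fᗮ := by
        intro u hu
        rw [hb, ← Submodule.inner_starProjection_left_eq_right]
        exact hyG2 _ ⟨u, hu, rfl⟩
      have hLa : L.starProjection y = a := by
        rw [← hab, map_add, Submodule.starProjection_eq_self_iff.2 haL]
        have hbL : b ∈ Lᗮ := Submodule.orthogonal_le inf_le_left
          (Submodule.starProjection_apply_mem _ _)
        rw [(Submodule.starProjection_apply_eq_zero_iff _).2 hbL, add_zero]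
      rw [hLa]
      -- The component `b` is controlled by `D b`, thus by `D y` and `a`. With `‖D y‖` at most `c₁ /
      -- 2`, the component `a` of a unit vector cannot be small.
      have h1 := hFc b (Submodule.starProjection_apply_mem _ _) hbF
      have h2 : ‖D b‖ ≤ ‖D y‖ + ‖D‖ * ‖a‖ := by
        have h3 : D b = D y - D a := by rw [← hab, map_add, add_sub_cancel_left]
        rw [h3]
        exact (norm_sub_le _ _).trans (add_le_add le_rfl (D.le_opNorm a))
      have h3 : 1 ≤ ‖a‖ + ‖b‖ := by
        rw [← hy1, ← hab]; exact norm_add_le _ _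
      rw [div_le_iff₀ (by positivity)]
      nlinarith [norm_nonneg a]) s
  rw [← hD] at hpd hpDD
  obtain ⟨hB1', hB2', hB3'⟩ := S.adjoint_inter hs0 hDZ' hp'Z'
    (cyclicSubspace_le_closure hR.adjoint hκ') hp's hpd
  have hxZ : x ∈ Z := by rw [S.x_eq]; exact sub_mem (hZ _ hpZ) (Z.smul_mem _ hpZ)
  have hBA : ∀ z, B z = A z - (N⁻¹ * inner ℂ x' z) • x := fun z => by
    rw [S.apply, add_sub_cancel_right]
  have hBZ : ∀ z ∈ Z, B z ∈ Z := fun z hz => by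
    rw [hBA]; exact sub_mem (hZ z hz) (Z.smul_mem _ hxZ)
  have hx'in : ∀ z, inner ℂ x' z = inner ℂ p' (A z) + s * inner ℂ p' z := by
    intro z
    rw [S.x'_eq, inner_add_left, ContinuousLinearMap.adjoint_inner_left, inner_smul_left,
      RCLike.conj_conj]
  have hx'w : inner ℂ x' (w 0) ≠ 0 := by
    rw [hx'in, hwA, inner_zero_right, zero_add]
    exact mul_ne_zero hs0 hp'w0
  -- `w 0` is killed by `A` but not orthogonal to `x'`; subtracting a multiple of it cancels the
  -- rank-one term, so that `B` takes the value `A v`.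
  have hBd : ∀ u ∈ Z, ∀ ε : ℝ, 0 < ε → ∃ v ∈ Z, ‖B v - u‖ < ε := by
    intro u hu ε hε
    obtain ⟨v, hv, hvu⟩ := hZd u hu ε hε
    set t : ℂ := inner ℂ x' v / inner ℂ x' (w 0) with ht
    refine ⟨v - t • w 0, sub_mem hv (Z.smul_mem _ (hw 0)), ?_⟩
    have h1 : B (v - t • w 0) = A v := by
      rw [hBA, map_sub, map_smul, hwA, smul_zero, sub_zero, inner_sub_right, inner_smul_right, ht,
        div_mul_cancel₀ _ hx'w, sub_self, mul_zero, zero_smul, sub_zero]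
    rwa [h1]
  have hB1 : ∀ z ∈ Z ⊓ (ℂ ∙ p')ᗮ, B z ∈ Z ⊓ (ℂ ∙ p')ᗮ := by
    rintro z ⟨hz, hzp⟩
    refine ⟨hBZ z hz, Submodule.mem_orthogonal_singleton_iff_inner_right.2 ?_⟩
    rw [S.inner_apply_right, Submodule.mem_orthogonal_singleton_iff_inner_right.1 hzp, mul_zero]
  have hB2 := exists_apply_near_of_inter (neg_ne_zero.2 hs0) S.inner_apply_right hBd (hw 0) hp'w0
  have hB3 : SingularOn B (Z ⊓ (ℂ ∙ p')ᗮ) := by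
    have h1 := hZs.congr_orthogonal ((ℂ ∙ p') ⊔ (ℂ ∙ x')) (D' := B) (by
      intro z hz
      rw [← Submodule.inf_orthogonal] at hz
      rw [hBA, Submodule.mem_orthogonal_singleton_iff_inner_right.1 hz.2, mul_zero, zero_smul,
        sub_zero])
    exact h1.mono (inf_le_inf_left _ (Submodule.orthogonal_le le_sup_left))
  have hg₀ : D (D p') ∈ Z' ⊓ (ℂ ∙ p)ᗮ :=
    ⟨hDZ' _ (hDZ' _ hp'Z'), Submodule.mem_orthogonal_singleton_iff_inner_right.2 hpDD⟩
  have hsp : 0 < ‖s‖ := norm_pos_iff.2 hs0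
  have hNp : 0 < ‖N‖ := norm_pos_iff.2 S.ne_zero
  -- The test vectors are `p + s • y₂` with `A y₂` near `-p` and `y₂` orthogonal to `p'`. The terms
  -- `s • p` and `s • A y₂` nearly cancel, so `B` almost kills them, while their pairing with `D (D
  -- p')` stays near `-s * N`.
  have hg₀d : NotDominated B (Z ⊓ (ℂ ∙ p')ᗮ) (D (D p')) := by
    intro C
    set k : ℝ := 1 + ‖N⁻¹‖ * ‖x‖ with hk
    have hk0 : 0 < k := by positivity
    set η : ℝ := ‖N‖ / (|C| * k + ‖D p'‖ + 1) with hη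
    have hη0 : 0 < η := by positivity
    obtain ⟨y₁, hy₁, hy₁p⟩ := hZd (-p) (neg_mem hpZ) η hη0
    set t : ℂ := inner ℂ p' y₁ / inner ℂ p' (w 0) with ht
    set y₂ := y₁ - t • w 0 with hy₂
    have hy₂Z : y₂ ∈ Z := sub_mem hy₁ (Z.smul_mem _ (hw 0))
    have hy₂p : inner ℂ p' y₂ = 0 := by
      rw [hy₂, inner_sub_right, inner_smul_right, ht, div_mul_cancel₀ _ hp'w0, sub_self]
    set q := A y₂ + p with hq
    have hqn : ‖q‖ < η := by
      have : A y₂ = A y₁ := by rw [hy₂, map_sub, map_smul, hwA, smul_zero, sub_zero]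
      rw [hq, this]
      rwa [sub_neg_eq_add] at hy₁p
    have hAy : A y₂ = q - p := by rw [hq, add_sub_cancel_right]
    have hp'p : inner ℂ p' p = 0 := inner_eq_zero_symm.1 S.orth
    have hBy : B (p + s • y₂) = s • (q - (N⁻¹ * inner ℂ p' q) • x) := by
      rw [map_add, S.eigen, map_smul, hBA, hx'in, hy₂p, mul_zero, add_zero, hAy, inner_sub_right,
        hp'p, sub_zero, ← smul_add]
      congr 1
      abel
    have hByn : ‖B (p + s • y₂)‖ ≤ ‖s‖ * (k * η) := by
      rw [hBy, norm_smul]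
      refine mul_le_mul_of_nonneg_left ?_ (norm_nonneg _)
      refine (norm_sub_le _ _).trans ?_
      rw [norm_smul, norm_mul]
      have h1 := norm_inner_le_norm (𝕜 := ℂ) p' q
      rw [hp'1, one_mul] at h1
      have h2 : ‖N⁻¹‖ * ‖inner ℂ p' q‖ * ‖x‖ ≤ ‖N⁻¹‖ * ‖x‖ * η := by
        calc ‖N⁻¹‖ * ‖inner ℂ p' q‖ * ‖x‖ = ‖N⁻¹‖ * ‖x‖ * ‖inner ℂ p' q‖ := by ring
          _ ≤ _ := mul_le_mul_of_nonneg_left (h1.trans hqn.le) (by positivity)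
      rw [hk, add_mul, one_mul]
      exact add_le_add hqn.le h2
    have hin : inner ℂ (D (D p')) (p + s • y₂) = s * (inner ℂ (D p') q - N) := by
      have h1 : inner ℂ (D (D p')) p = (0 : ℂ) := inner_eq_zero_symm.1 hpDD
      have h2 : inner ℂ (D p') p = N := by
        rw [hD, ContinuousLinearMap.adjoint_inner_left]; exact S.inner_apply
      rw [inner_add_right, h1, zero_add, inner_smul_right, hD,
        ContinuousLinearMap.adjoint_inner_left, ← hD, hAy, inner_sub_right, h2]
    refine ⟨p + s • y₂, ⟨add_mem hpZ (Z.smul_mem _ hy₂Z),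
      Submodule.mem_orthogonal_singleton_iff_inner_right.2 ?_⟩, ?_⟩
    · rw [inner_add_right, inner_smul_right, hy₂p, hp'p, mul_zero, add_zero]
    · rw [norm_inner_symm, hin, norm_mul]
      have h1 : C * ‖B (p + s • y₂)‖ ≤ |C| * (‖s‖ * (k * η)) :=
        mul_le_mul (le_abs_self C) hByn (norm_nonneg _) (abs_nonneg _)
      have h2 : ‖N‖ - ‖D p'‖ * η ≤ ‖inner ℂ (D p') q - N‖ := by
        have h3 := norm_sub_norm_le N (inner ℂ (D p') q)
        have h4 := (norm_inner_le_norm (𝕜 := ℂ) (D p') q).trans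
          (mul_le_mul_of_nonneg_left hqn.le (norm_nonneg _))
        rw [norm_sub_rev] at h3
        linarith
      have h3 : η * (|C| * k + ‖D p'‖ + 1) = ‖N‖ := by
        rw [hη]; exact div_mul_cancel₀ _ (by positivity)
      refine h1.trans_lt (lt_of_lt_of_le ?_ (mul_le_mul_of_nonneg_left h2 hsp.le))
      have h4 : |C| * (‖s‖ * (k * η)) = ‖s‖ * (|C| * k * η) := by ring
      rw [h4]
      refine mul_lt_mul_of_pos_left ?_ hsp
      nlinarith
  obtain ⟨e, h, lam, c, v, f, g, mu, d, w', H, H', he, hf, hh, hv, hg, hw', h1, h2, h3⟩ :=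
    exists_coupled_families (B := B) (hZc.inter (Submodule.isClosed_orthogonal (ℂ ∙ p')))
      (isClosed_cyclicSubspace.inter (Submodule.isClosed_orthogonal (ℂ ∙ p))) hB1 hB1' hB2 hB2'
      hB3 hB3' hg₀ hg₀d (ℂ ∙ p) (ℂ ∙ p') T.pos_near T.anti_near T.pos_bound T.anti_bound
  exact S.hasCoupledFamilies hs0 T.pos_near (by rw [hsn]; linarith [T.pos])
    (fun n => by rw [hsn]; linarith [T.anti_bound (Nat.zero_le n), T.le]) H H'
    (fun n => Submodule.mem_orthogonal_singleton_iff_inner_right.1 (he n))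
    (fun n => Submodule.mem_orthogonal_singleton_iff_inner_right.1 (hf n))
    (fun n => Submodule.mem_orthogonal_singleton_iff_inner_right.1 (hh n).2)
    (fun n => Submodule.mem_orthogonal_singleton_iff_inner_right.1 (hg n).2)
    (Submodule.mem_orthogonal_singleton_iff_inner_right.1 hv.2)
    (Submodule.mem_orthogonal_singleton_iff_inner_right.1 hw'.2) h1 h2 h3

end Cases

/-! ### Infinite kernels, finite ascent, and the case distinction -/

section MainCases

variable {E : Type*} [NormedAddCommGroup E] [InnerProductSpace ℂ E] [CompleteSpace E]

/-- If both kernels are infinite-dimensional, one orthonormal sequence alternating between them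
gives both families. Otherwise the split case applies to the kernel of `A`, as non-singularity of
the adjoint on its complement would make that kernel finite-dimensional. -/
theorem hasCoupledFamilies_of_infinite_kernel {A : E →L[ℂ] E} {κ : ℕ → ℂ} {r : ℕ → E →L[ℂ] E}
    (hR : ResolventSeq A κ r) (hκ : ∀ n, κ n ≠ 0)
    (hk : ¬ FiniteDimensional ℂ (A : E →ₗ[ℂ] E).ker)
    {δ τ : ℕ → ℝ} {ε : ℝ} (T : Tolerance δ τ ε) : HasCoupledFamilies A δ τ ε := by
  by_cases hk' : FiniteDimensional ℂ ((adjoint A : E →L[ℂ] E) : E →ₗ[ℂ] E).ker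
  · have hr : ∀ n, ∀ z ∈ (A : E →ₗ[ℂ] E).ker, r n z ∈ (A : E →ₗ[ℂ] E).ker := by
      intro n z hz
      have hz' : A z = 0 := hz
      change A (r n z) = 0
      rw [hR.comm, hz', map_zero]
    have hr' : ∀ n, ∀ y ∈ ((A : E →ₗ[ℂ] E).ker)ᗮ, adjoint (r n) y ∈ ((A : E →ₗ[ℂ] E).ker)ᗮ :=
      fun n => adjoint_mem_orthogonal (hr n)
    refine hasCoupledFamilies_of_split hR.adjoint (fun n => (_root_.map_ne_zero _).2 (hκ n))
      (Z := (A : E →ₗ[ℂ] E).ker) (fun z hz => ?_) hr' (hasFamilies_of_le_ker hk fun x hx => hx) ?_ T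
    · have hz' : A z = 0 := hz
      rw [hz']; exact Submodule.zero_mem _
    · by_contra hs
      exact hk (finiteDimensional_ker_of_adjoint_not_singularOn hR.adjoint hr' hs)
  · obtain ⟨u, hu, huU, -⟩ := exists_orthonormal_mem
      (U := fun n => if n % 2 = 0 then (A : E →ₗ[ℂ] E).ker else
        ((adjoint A : E →L[ℂ] E) : E →ₗ[ℂ] E).ker) (fun n => by
        by_cases hn : n % 2 = 0
        · rw [if_pos hn]; exact hk
        · rw [if_neg hn]; exact hk') ⊥
    have he : ∀ n, A (u (2 * n)) = 0 := fun n => by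
      have := huU (2 * n)
      simp only [Nat.mul_mod_right, if_true] at this
      exact this
    have hf : ∀ n, adjoint A (u (2 * n + 1)) = 0 := fun n => by
      have := huU (2 * n + 1)
      rw [if_neg (by omega)] at this
      exact this
    have H := eigenFamily_of_ker (hu.comp (fun n : ℕ => 2 * n) fun a b h => by
      have h : 2 * a = 2 * b := h
      omega) he T.pos_near T.pos_bound
    have H' := eigenFamily_of_ker (hu.comp (fun n : ℕ => 2 * n + 1) fun a b h => by
      have h : 2 * a + 1 = 2 * b + 1 := h
      omega) hf T.pos_near T.pos_bound
    exact hasCoupledFamilies_of_families T.anti_near T.anti_bound T.lt H H'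
      (fun i j => hu.2 (show 2 * i ≠ 2 * j + 1 by omega)) (fun j => inner_zero_left _) (fun j => inner_zero_right _)

/-- Stable kernels of powers of the adjoint mean that the ranges of `A ^ k` and `A ^ (k + 1)` have
the same closure `Z`. Its complement lies in the kernel of the `k`-th power of the adjoint, so it is
finite-dimensional and singularity passes to `Z`. -/
theorem closure_range_pow_properties {A : E →L[ℂ] E}
    [FiniteDimensional ℂ ((adjoint A : E →L[ℂ] E) : E →ₗ[ℂ] E).ker] {k : ℕ}
    (hk : ∀ x, (adjoint A ^ (k + 1)) x = 0 → (adjoint A ^ k) x = 0) (hs : SingularOn A ⊤) :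
    ∃ Z : Submodule ℂ E, IsClosed (Z : Set E) ∧ (∀ z ∈ Z, A z ∈ Z) ∧
      (∀ u ∈ Z, ∀ ε : ℝ, 0 < ε → ∃ v ∈ Z, ‖A v - u‖ < ε) ∧ FiniteDimensional ℂ Zᗮ ∧
      SingularOn A Z := by
  have horth : ∀ j : ℕ, ∀ z, z ∈ (((A ^ j : E →L[ℂ] E) : E →ₗ[ℂ] E).range.topologicalClosure)ᗮ →
      (adjoint A ^ j) z = 0 := by
    intro j z hz
    refine ext_inner_right ℂ fun y => ?_
    rw [inner_adjoint_pow, inner_zero_left]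
    exact inner_eq_zero_symm.1 (hz _ (Submodule.le_topologicalClosure _ ⟨y, rfl⟩))
  set V := ((A ^ k : E →L[ℂ] E) : E →ₗ[ℂ] E).range with hV
  set Z := V.topologicalClosure with hZ
  have hZc : IsClosed (Z : Set E) := V.isClosed_topologicalClosure
  have : CompleteSpace Z := hZc.completeSpace_coe
  have hfd : FiniteDimensional ℂ Zᗮ := by
    have h1 := finiteDimensional_ker_pow ((adjoint A : E →L[ℂ] E) : E →ₗ[ℂ] E) k
    refine Submodule.finiteDimensional_of_le
      (S₂ := (((adjoint A : E →L[ℂ] E) : E →ₗ[ℂ] E) ^ k).ker) fun z hz => ?_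
    have h2 := horth k z hz
    rw [LinearMap.mem_ker, ← ContinuousLinearMap.toLinearMap_pow]
    exact h2
  refine ⟨Z, hZc, topologicalClosure_apply_mem ?_, ?_, hfd, ?_⟩
  · rintro _ ⟨y, rfl⟩
    exact V.le_topologicalClosure ⟨A y, (pow_succ_clm_apply A k y).symm.trans
      (pow_succ_clm_apply' A k y)⟩
  · set W := ((A ^ (k + 1) : E →L[ℂ] E) : E →ₗ[ℂ] E).range.topologicalClosure with hW
    have hWc : IsClosed (W : Set E) := Submodule.isClosed_topologicalClosure _
    have : CompleteSpace W := hWc.completeSpace_coe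
    have hZW : Z ≤ W := by
      refine Submodule.topologicalClosure_minimal _ ?_ hWc
      rintro _ ⟨y, rfl⟩
      rw [← Submodule.orthogonal_orthogonal W]
      intro z hz
      have h1 := hk z (horth (k + 1) z hz)
      change inner ℂ z ((A ^ k) y) = 0
      rw [← inner_adjoint_pow, h1, inner_zero_left]
    intro u hu ε hε
    obtain ⟨_, ⟨y, rfl⟩, hyu⟩ := Metric.mem_closure_iff.1 (hZW hu) ε hε
    refine ⟨(A ^ k) y, V.le_topologicalClosure ⟨y, rfl⟩, ?_⟩
    rw [← pow_succ_clm_apply']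
    rwa [dist_comm, dist_eq_norm] at hyu
  · refine hs.mono_orthogonal Zᗮ ?_
    rw [Submodule.orthogonal_orthogonal, top_inf_eq]

/-- The dense-range parts `Z` and `Z'` have finite codimension, so unit vectors nearly killed by `A`
exist in `Z ⊓ Z'`. They yield the vector that is not dominated and starts the coupled construction.
-/
theorem hasCoupledFamilies_of_finite_ascent {A : E →L[ℂ] E}
    [FiniteDimensional ℂ (A : E →ₗ[ℂ] E).ker]
    [FiniteDimensional ℂ ((adjoint A : E →L[ℂ] E) : E →ₗ[ℂ] E).ker]
    {k k' : ℕ} (hk : ∀ x, (A ^ (k + 1)) x = 0 → (A ^ k) x = 0)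
    (hk' : ∀ x, (adjoint A ^ (k' + 1)) x = 0 → (adjoint A ^ k') x = 0)
    (hs : SingularOn A ⊤) (hs' : SingularOn (adjoint A) ⊤)
    {δ τ : ℕ → ℝ} {ε : ℝ} (T : Tolerance δ τ ε) : HasCoupledFamilies A δ τ ε := by
  obtain ⟨Z, hZc, hZ, hZd, hZf, hZs⟩ := closure_range_pow_properties hk' hs
  have hAA : adjoint (adjoint A) = A := ContinuousLinearMap.adjoint_adjoint A
  obtain ⟨Z', hZc', hZ', hZd', hZf', hZs'⟩ :
      ∃ Z : Submodule ℂ E, IsClosed (Z : Set E) ∧ (∀ z ∈ Z, adjoint A z ∈ Z) ∧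
      (∀ u ∈ Z, ∀ ε : ℝ, 0 < ε → ∃ v ∈ Z, ‖adjoint A v - u‖ < ε) ∧ FiniteDimensional ℂ Zᗮ ∧
      SingularOn (adjoint A) Z := by
    have : FiniteDimensional ℂ ((adjoint (adjoint A) : E →L[ℂ] E) : E →ₗ[ℂ] E).ker := by
      rw [hAA]; infer_instance
    exact closure_range_pow_properties (k := k) (by rw [hAA]; exact hk) hs'
  have : CompleteSpace Z := hZc.completeSpace_coe
  have : CompleteSpace Z' := hZc'.completeSpace_coe
  obtain ⟨g₀, hg₀, hg₀d⟩ : ∃ p ∈ Z', NotDominated A Z p := by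
    refine exists_notDominated one_pos fun ε' hε' => ?_
    obtain ⟨y, -, hyG, hy1, hyA⟩ := hs (Zᗮ ⊔ Z'ᗮ) inferInstance ε' hε'
    rw [← Submodule.inf_orthogonal, Submodule.orthogonal_orthogonal,
      Submodule.orthogonal_orthogonal] at hyG
    refine ⟨y, hyG.1, hyA, ?_⟩
    rw [Submodule.starProjection_eq_self_iff.2 hyG.2, hy1]
  obtain ⟨e, h, lam, c, v, f, g, mu, d, w, H, H', -, -, -, -, -, -, h1, h2, h3⟩ :=
    exists_coupled_families hZc hZc' hZ hZ' hZd hZd' hZs hZs' hg₀ hg₀d ⊥ ⊥ T.pos_near T.anti_near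
      T.pos_bound T.anti_bound
  exact hasCoupledFamilies_of_families T.anti_near T.anti_bound T.lt H H' h1 h2 h3

/-- The roles of left and right inverse are exchanged, and the adjoint of `P` has finite rank since
it factors through the range of `P`. -/
theorem Browder.of_adjoint {A : E →L[ℂ] E} (h : Browder (adjoint A)) : Browder A := by
  obtain ⟨P, X, h⟩ := h
  have hmul : ∀ S T : E →L[ℂ] E, adjoint (S * T) = adjoint T * adjoint S :=
    fun S T => ContinuousLinearMap.adjoint_comp S T
  have hone : adjoint (1 : E →L[ℂ] E) = 1 := ContinuousLinearMap.adjoint_id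
  have hAA : adjoint (adjoint A) = A := ContinuousLinearMap.adjoint_adjoint A
  refine ⟨adjoint P, adjoint X, ?_, ?_, ?_, ?_, ?_⟩
  · have hfd := h.fin
    set W := (P : E →ₗ[ℂ] E).range with hW
    refine Submodule.finiteDimensional_of_le (S₂ := W.map ((adjoint P : E →L[ℂ] E) : E →ₗ[ℂ] E)) ?_
    rintro _ ⟨x, rfl⟩
    refine ⟨W.starProjection x, Submodule.starProjection_apply_mem _ _, ?_⟩
    have h1 : x - W.starProjection x ∈ Wᗮ := Submodule.sub_starProjection_mem_orthogonal _
    have h2 : adjoint P (x - W.starProjection x) = 0 := by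
      refine ext_inner_left ℂ fun y => ?_
      rw [ContinuousLinearMap.adjoint_inner_right, inner_zero_right]
      exact h1 _ ⟨y, rfl⟩
    rw [map_sub, sub_eq_zero] at h2
    exact h2.symm
  · have := congrArg adjoint h.left
    rwa [hmul, map_sub, hone, hAA] at this
  · have := congrArg adjoint h.right
    rwa [hmul, map_sub, hone, hAA] at this
  · have := congrArg adjoint h.zero_right
    rwa [hmul, map_zero] at this
  · have := congrArg adjoint h.zero_left
    rwa [hmul, map_zero] at this

theorem hasCoupledFamilies_of_not_browder {A : E →L[ℂ] E} {κ : ℕ → ℂ} {r : ℕ → E →L[ℂ] E}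
    (hR : ResolventSeq A κ r) (hB : ¬ Browder A) {δ τ : ℕ → ℝ} {ε : ℝ} (T : Tolerance δ τ ε) :
    HasCoupledFamilies A δ τ ε := by
  have hκ : ∀ n, κ n ≠ 0 := by
    intro n h0
    refine hB ⟨0, r n, BrowderData.of_right_inverse ?_ ?_⟩
    · ext x
      have := hR.right n x
      rwa [h0, zero_smul, add_zero] at this
    · ext x
      have := hR.left n x
      rwa [h0, zero_smul, add_zero] at this
  have hκ' : ∀ n, (starRingEnd ℂ) (κ n) ≠ 0 := fun n => (_root_.map_ne_zero _).2 (hκ n)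
  have hs : SingularOn A ⊤ := by
    by_contra h
    exact hB (Browder.of_not_singularOn hR h)
  have hs' : SingularOn (adjoint A) ⊤ := by
    by_contra h
    exact hB (Browder.of_adjoint (Browder.of_not_singularOn hR.adjoint h))
  by_cases hk : FiniteDimensional ℂ (A : E →ₗ[ℂ] E).ker
  swap
  · exact hasCoupledFamilies_of_infinite_kernel hR hκ hk T
  by_cases hk' : FiniteDimensional ℂ ((adjoint A : E →L[ℂ] E) : E →ₗ[ℂ] E).ker
  swap
  · exact (hasCoupledFamilies_of_infinite_kernel hR.adjoint hκ' hk' T).of_adjoint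
  by_cases ha : ∀ k, ∃ x, (A ^ (k + 1)) x = 0 ∧ (A ^ k) x ≠ 0
  · exact hasCoupledFamilies_of_infinite_ascent hR hκ ha T
  by_cases ha' : ∀ k, ∃ x, (adjoint A ^ (k + 1)) x = 0 ∧ (adjoint A ^ k) x ≠ 0
  · exact (hasCoupledFamilies_of_infinite_ascent hR.adjoint hκ' ha' T).of_adjoint
  push Not at ha ha'
  obtain ⟨k, hk1⟩ := ha
  obtain ⟨k', hk1'⟩ := ha'
  exact hasCoupledFamilies_of_finite_ascent hk1 hk1' hs hs' T

end MainCases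

/-! ### Diagonal operators in an ideal -/

section DiagonalOperators

variable {E : Type*} [NormedAddCommGroup E] [InnerProductSpace ℂ E]
variable {F : Type*} [NormedAddCommGroup F] [InnerProductSpace ℂ F]

theorem Orthonormal.countable_of_separable [TopologicalSpace.SeparableSpace E] {ι : Type*}
    {b : ι → E} (hb : Orthonormal ℂ b) : Countable ι := by
  have h : ∀ i, ∃ n, ‖TopologicalSpace.denseSeq E n - b i‖ < 1 / 2 := by
    intro i
    obtain ⟨_, ⟨n, rfl⟩, hn⟩ := Metric.mem_closure_iff.1
      (TopologicalSpace.denseRange_denseSeq E (b i)) (1 / 2) (by norm_num)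
    exact ⟨n, by rwa [dist_comm, dist_eq_norm] at hn⟩
  choose f hf using h
  refine Function.Injective.countable (f := f) fun i j hij => ?_
  by_contra hne
  have h1 := hf i
  have h2 := hf j
  rw [hij] at h1
  have h3 : ‖b i - b j‖ < 1 := by
    have : b i - b j = (TopologicalSpace.denseSeq E (f j) - b j) -
        (TopologicalSpace.denseSeq E (f j) - b i) := by abel
    rw [this]
    refine (norm_sub_le _ _).trans_lt ?_
    linarith
  have h4 : inner ℂ (b i) (b i - b j) = 1 := by
    rw [inner_sub_right, hb.2 hne, inner_self_eq_norm_sq_to_K, hb.1]; simp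
  have h5 := norm_inner_le_norm (𝕜 := ℂ) (b i) (b i - b j)
  rw [h4, hb.1, norm_one, one_mul] at h5
  linarith

theorem exists_hilbertBasis_nat [CompleteSpace E] [TopologicalSpace.SeparableSpace E]
    (hE : ¬ FiniteDimensional ℂ E) : Nonempty (HilbertBasis ℕ ℂ E) := by
  obtain ⟨w, b, -⟩ := exists_hilbertBasis ℂ E
  have hc : Countable w := b.orthonormal.countable_of_separable
  have hi : Infinite w := by
    by_contra hfin
    rw [not_infinite_iff_finite] at hfin
    have := Fintype.ofFinite w
    exact hE (b.toOrthonormalBasis.toBasis.finiteDimensional_of_finite)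
  obtain ⟨e⟩ := nonempty_equiv_of_countable (α := ℕ) (β := w)
  refine ⟨HilbertBasis.mk (b.orthonormal.comp e e.injective) ?_⟩
  rw [e.surjective.range_comp, b.dense_span]

/-- The sum of a summable family of rank one operators along an orthonormal sequence. -/
theorem Orthonormal.exists_clm [CompleteSpace F] {u : ℕ → E} (hu : Orthonormal ℂ u) {z : ℕ → F}
    (hz : Summable fun n => ‖z n‖) :
    ∃ D : E →L[ℂ] F, (∀ n, D (u n) = z n) ∧ ‖D‖ ≤ ∑' n, ‖z n‖ := by
  have hn : ∀ n, ‖rankOne ℂ (z n) (u n)‖ = ‖z n‖ := fun n => by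
    rw [InnerProductSpace.norm_rankOne, hu.1, mul_one]
  have hs : Summable fun n => ‖rankOne ℂ (z n) (u n)‖ := by simpa only [hn] using hz
  refine ⟨∑' n, rankOne ℂ (z n) (u n), fun m => ?_, ?_⟩
  · have h := (ContinuousLinearMap.apply ℂ F (u m)).hasSum hs.of_norm.hasSum
    have h' : HasSum (fun n => rankOne ℂ (z n) (u n) (u m)) (z m) := by
      have := hasSum_single (f := fun n => rankOne ℂ (z n) (u n) (u m)) m (fun n hnm => by
        rw [InnerProductSpace.rankOne_apply, hu.2 hnm, zero_smul])
      rwa [InnerProductSpace.rankOne_apply, inner_self_eq_norm_sq_to_K, hu.1, RCLike.ofReal_one,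
        one_pow, one_smul] at this
    exact h.unique h'
  · refine (norm_tsum_le_tsum_norm hs).trans_eq ?_
    simp only [hn]

theorem HilbertBasis.clm_ext {ι : Type*} (b : HilbertBasis ι ℂ E) {S T : E →L[ℂ] F}
    (h : ∀ i, S (b i) = T (b i)) : S = T := by
  refine ContinuousLinearMap.ext_on (s := Set.range b) ?_ ?_
  · rw [Submodule.dense_iff_topologicalClosure_eq_top]
    exact b.dense_span
  · rintro _ ⟨i, rfl⟩
    exact h i

/-- Each new vector is chosen orthogonal to the earlier `x` and to their images under `adjoint K *
K`; infinite rank leaves room for `K x` to be nonzero. -/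
theorem exists_orthonormal_orthogonal_images [CompleteSpace E] {K : E →L[ℂ] E}
    (hK : ¬ FiniteDimensional ℂ (K : E →ₗ[ℂ] E).range) :
    ∃ x : ℕ → E, Orthonormal ℂ x ∧ (∀ n, K (x n) ≠ 0) ∧
      Pairwise fun i j => inner ℂ (K (x i)) (K (x j)) = 0 := by
  have key : ∀ W : Submodule ℂ E, FiniteDimensional ℂ W → ∃ x ∈ Wᗮ, ‖x‖ = 1 ∧ K x ≠ 0 := by
    intro W hW
    by_contra! hcon
    have h0 : ∀ x ∈ Wᗮ, K x = 0 := by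
      intro x hx
      by_cases hx0 : x = 0
      · rw [hx0, map_zero]
      · have hn : (‖x‖ : ℂ) ≠ 0 := by simpa using hx0
        have := hcon ((‖x‖ : ℂ)⁻¹ • x) (Submodule.smul_mem _ _ hx) (by
          rw [norm_smul, norm_inv, Complex.norm_real, norm_norm, inv_mul_cancel₀]
          simpa using hx0)
        rw [map_smul] at this
        exact (smul_eq_zero.1 this).resolve_left (inv_ne_zero hn)
    refine hK (Submodule.finiteDimensional_of_le (S₂ := W.map (K : E →ₗ[ℂ] E)) ?_)
    rintro _ ⟨x, rfl⟩
    obtain ⟨y, hy, z, hz, rfl⟩ := W.exists_add_mem_mem_orthogonal x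
    exact ⟨y, hy, by simp [h0 z hz]⟩
  obtain ⟨σ, hG, hR⟩ := exists_dependent_seq
    (fun (_ : ℕ) (a : Submodule ℂ E × E) => FiniteDimensional ℂ a.1 ∧ ‖a.2‖ = 1 ∧ K a.2 ≠ 0 ∧
      a.2 ∈ a.1 ∧ adjoint K (K a.2) ∈ a.1)
    (fun _ a a' => a.1 ≤ a'.1 ∧ a'.2 ∈ a.1ᗮ)
    (by
      obtain ⟨x, -, hx1, hx2⟩ := key ⊥ inferInstance
      exact ⟨⟨Submodule.span ℂ {x, adjoint K (K x)}, x⟩,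
        FiniteDimensional.span_of_finite ℂ (Set.toFinite _), hx1, hx2,
        Submodule.subset_span (by simp), Submodule.subset_span (by simp)⟩)
    (by
      rintro k ⟨W, y⟩ ⟨hW, -⟩
      have hW : FiniteDimensional ℂ W := hW
      obtain ⟨x, hx, hx1, hx2⟩ := key W hW
      have hfin : FiniteDimensional ℂ (Submodule.span ℂ {x, adjoint K (K x)}) :=
        FiniteDimensional.span_of_finite ℂ (Set.toFinite _)
      exact ⟨⟨W ⊔ Submodule.span ℂ {x, adjoint K (K x)}, x⟩,
        ⟨Submodule.finiteDimensional_sup _ _, hx1, hx2,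
        Submodule.mem_sup_right (Submodule.subset_span (by simp)),
        Submodule.mem_sup_right (Submodule.subset_span (by simp))⟩, le_sup_left, hx⟩)
  have hmono : Monotone fun n => (σ n).1 := monotone_nat_of_le_succ fun n => (hR n).1
  have hlt : ∀ i j, i < j → (σ j).2 ∈ (σ i).1ᗮ := by
    intro i j hij
    obtain ⟨m, rfl⟩ := Nat.exists_eq_add_of_lt hij
    exact Submodule.orthogonal_le (hmono (Nat.le_add_right i m)) (hR (i + m)).2
  have h1 : ∀ i j, i < j → inner ℂ (σ i).2 (σ j).2 = 0 := fun i j hij =>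
    hlt i j hij _ (hG i).2.2.2.1
  have h2 : ∀ i j, i < j → inner ℂ (K (σ i).2) (K (σ j).2) = 0 := fun i j hij => by
    rw [← ContinuousLinearMap.adjoint_inner_left]
    exact hlt i j hij _ (hG i).2.2.2.2
  refine ⟨fun n => (σ n).2, ⟨fun n => (hG n).2.1, fun i j hij => ?_⟩, fun n => (hG n).2.2.1,
    fun i j hij => ?_⟩
  · rcases lt_or_gt_of_ne hij with h | h
    · exact h1 i j h
    · exact inner_eq_zero_symm.1 (h1 j i h)
  · rcases lt_or_gt_of_ne hij with h | h
    · exact h2 i j h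
    · exact inner_eq_zero_symm.1 (h2 j i h)

/-- Diagonal operators with sufficiently fast decaying eigenvalues belong to every two-sided ideal
properly containing the finite-rank operators. -/
theorem exists_decay_memIdealCopy {H : Type*} [NormedAddCommGroup H] [InnerProductSpace ℂ H]
    [CompleteSpace H] (bH : HilbertBasis ℕ ℂ H)
    {J : TwoSidedIdeal (H →L[ℂ] H)} (hJ : finiteRankIdeal H < J) :
    ∃ s : ℕ → ℝ, (∀ n, 0 < s n) ∧ ∀ {K : Type*} [NormedAddCommGroup K] [InnerProductSpace ℂ K]
      (b : HilbertBasis ℕ ℂ K) (D : K →L[ℂ] K) (a : ℕ → ℂ), (∀ n, D (b n) = a n • b n) →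
      (∀ n, ‖a (n + 1)‖ ≤ s n) → MemIdealCopy J D := by
  obtain ⟨K₀, hK₀, hK₀'⟩ := Set.exists_of_ssubset (show (finiteRankIdeal H : Set (H →L[ℂ] H)) ⊂ J
    from hJ)
  have hinf : ¬ FiniteDimensional ℂ (K₀ : H →ₗ[ℂ] H).range := by
    intro h
    exact hK₀' (by simpa [finiteRankIdeal] using h)
  obtain ⟨x, hx, hKx, hort⟩ := exists_orthonormal_orthogonal_images hinf
  have hk : ∀ n, 0 < ‖K₀ (x n)‖ := fun n => norm_pos_iff.2 (hKx n)
  have hy : Orthonormal ℂ fun n => ((‖K₀ (x n)‖ : ℂ)⁻¹) • K₀ (x n) := by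
    refine ⟨fun n => ?_, fun i j hij => ?_⟩
    · rw [norm_smul, norm_inv, Complex.norm_real, norm_norm, inv_mul_cancel₀ (hk n).ne']
    · simp only [inner_smul_left, inner_smul_right, hort hij, mul_zero]
  -- The diagonal operator is factored as `L * K₀ * R`, where `R` carries weights `2⁻ⁿ` and `L` must
  -- carry `a n * 2 ^ n / ‖K₀ (x n)‖`; the factor `(1 / 4) ^ n` makes the latter summable. The shift
  -- leaves `a 0` unconstrained, as the eigenvalue of index zero need not be tiny.
  refine ⟨fun n => ‖K₀ (x (n + 1))‖ * (1 / 4) ^ (n + 1), fun n => by have := hk (n + 1); positivity,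
    fun {K} _ _ b D a hD ha => ?_⟩
  obtain ⟨R, hR, -⟩ := bH.orthonormal.exists_clm (z := fun n => ((1 / 2 : ℂ) ^ n) • x n) (by
    simp only [norm_smul, hx.1, mul_one, norm_pow]
    exact summable_geometric_of_lt_one (by norm_num) (by norm_num))
  obtain ⟨L, hL, -⟩ := hy.exists_clm
    (z := fun n => (a n * 2 ^ n * ((‖K₀ (x n)‖ : ℂ)⁻¹)) • bH n) (by
    rw [← summable_nat_add_iff 1]
    refine Summable.of_nonneg_of_le (fun n => norm_nonneg _) (fun n => ?_)
      ((summable_nat_add_iff 1).2 (summable_geometric_of_lt_one (r := (1 / 2 : ℝ)) (by norm_num)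
        (by norm_num)))
    rw [norm_smul, bH.orthonormal.1, mul_one, norm_mul, norm_mul, norm_inv, Complex.norm_real,
      norm_norm, norm_pow, Complex.norm_ofNat, mul_inv_le_iff₀ (hk _)]
    calc ‖a (n + 1)‖ * 2 ^ (n + 1) ≤ (‖K₀ (x (n + 1))‖ * (1 / 4) ^ (n + 1)) * 2 ^ (n + 1) := by
          gcongr; exact ha n
      _ = (1 / 2) ^ (n + 1) * ‖K₀ (x (n + 1))‖ := by
          rw [mul_assoc, ← mul_pow, mul_comm]; norm_num)
  refine ⟨b.repr.trans bH.repr.symm, ?_⟩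
  have hφ : ∀ n, (b.repr.trans bH.repr.symm).symm (bH n) = b n := fun n => by
    change b.repr.symm (bH.repr (bH n)) = b n
    rw [bH.repr_self, b.repr_symm_single]
  have hφ' : ∀ n, (b.repr.trans bH.repr.symm) (b n) = bH n := fun n => by
    rw [← hφ, LinearIsometryEquiv.apply_symm_apply]
  have hKy : ∀ n, L (K₀ (x n)) = (a n * 2 ^ n) • bH n := fun n => by
    have hne : (‖K₀ (x n)‖ : ℂ) ≠ 0 := by exact_mod_cast (hk n).ne'
    have h := hL n
    rw [map_smul, mul_comm (a n * 2 ^ n), mul_smul] at h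
    exact smul_right_injective H (inv_ne_zero hne) h
  convert J.mul_mem_right _ R (J.mul_mem_left L K₀ hK₀) using 1
  refine bH.clm_ext fun n => ?_
  change (b.repr.trans bH.repr.symm) (D ((b.repr.trans bH.repr.symm).symm (bH n))) =
    L (K₀ (R (bH n)))
  rw [hφ, hD, map_smul, hφ', hR, map_smul, map_smul, hKy, smul_smul]
  congr 1
  rw [mul_comm (a n), ← mul_assoc, ← mul_pow]
  norm_num

end DiagonalOperators

/-! ### Riesz sequences and their closed spans -/

section RieszFamilies

variable {E : Type*} [NormedAddCommGroup E] [InnerProductSpace ℂ E]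

/-- The closed linear span of a sequence. -/
abbrev closedSpan (h : ℕ → E) : Submodule ℂ E := (Submodule.span ℂ (Set.range h)).topologicalClosure

theorem mem_closedSpan (h : ℕ → E) (n : ℕ) : h n ∈ closedSpan h :=
  Submodule.le_topologicalClosure _ (Submodule.subset_span ⟨n, rfl⟩)

theorem closedSpan_le {h : ℕ → E} {K : Submodule ℂ E} (hK : IsClosed (K : Set E))
    (hh : ∀ n, h n ∈ K) : closedSpan h ≤ K :=
  Submodule.topologicalClosure_minimal _
    (Submodule.span_le.2 (by rintro _ ⟨n, rfl⟩; exact hh n)) hK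

theorem isClosed_closedSpan (h : ℕ → E) : IsClosed (closedSpan h : Set E) :=
  Submodule.isClosed_topologicalClosure _

theorem inner_eq_zero_of_mem_closedSpan {h : ℕ → E} {x z : E} (hx : ∀ n, inner ℂ (h n) x = 0)
    (hz : z ∈ closedSpan h) : inner ℂ z x = 0 := by
  have : closedSpan h ≤ (Submodule.span ℂ {x})ᗮ := by
    refine closedSpan_le (Submodule.isClosed_orthogonal _) fun n => ?_
    rw [Submodule.mem_orthogonal_singleton_iff_inner_left]
    exact hx n
  exact (Submodule.mem_orthogonal_singleton_iff_inner_left).1 (this hz)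

theorem eq_zero_of_mem_closedSpan {h : ℕ → E} {z : E} (hx : ∀ n, inner ℂ (h n) z = 0)
    (hz : z ∈ closedSpan h) : z = 0 :=
  inner_self_eq_zero.1 (inner_eq_zero_of_mem_closedSpan hx hz)

theorem map_mem_closedSpan {F : Type*} [NormedAddCommGroup F] [InnerProductSpace ℂ F]
    {h : ℕ → E} {h' : ℕ → F} (V : E →L[ℂ] F) (hV : ∀ n, V (h n) = h' n) {z : E}
    (hz : z ∈ closedSpan h) : V z ∈ closedSpan h' := by
  have : closedSpan h ≤ (closedSpan h').comap (V : E →ₗ[ℂ] F) :=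
    closedSpan_le ((isClosed_closedSpan h').preimage V.continuous) fun n => by
      change V (h n) ∈ closedSpan h'
      rw [hV]; exact mem_closedSpan h' n
  exact this hz

theorem not_finiteDimensional_of_linearIndependent {u : ℕ → E} (hu : LinearIndependent ℂ u)
    {X : Submodule ℂ E} (hX : ∀ n, u n ∈ X) : ¬ FiniteDimensional ℂ X := by
  intro _
  have : LinearIndependent ℂ fun n => (⟨u n, hX n⟩ : X) := by
    refine LinearIndependent.of_comp X.subtype ?_
    exact hu
  have := this.finite_of_isNoetherian
  exact not_finite ℕ

theorem exists_equiv_closedSpan [CompleteSpace E] {e h : ℕ → E} (he : Orthonormal ℂ e)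
    (V : E ≃L[ℂ] E)
    (hV : ∀ n, V (e n) = h n) (b : HilbertBasis ℕ ℂ (closedSpan h)) :
    ∃ W : closedSpan h ≃L[ℂ] closedSpan h, ∀ n, (W (b n) : E) = h n := by
  have hV' : ∀ n, V.symm (h n) = e n := fun n => by rw [← hV, V.symm_apply_apply]
  have : CompleteSpace (closedSpan e) := (isClosed_closedSpan e).completeSpace_coe
  let u : ℕ → closedSpan e := fun n => ⟨e n, mem_closedSpan e n⟩
  have hu : Orthonormal ℂ u := ⟨fun n => he.1 n, fun i j hij => he.2 hij⟩
  let bK : HilbertBasis ℕ ℂ (closedSpan e) := HilbertBasis.mkOfOrthogonalEqBot hu (by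
    rw [Submodule.eq_bot_iff]
    intro z hz
    refine Subtype.ext (eq_zero_of_mem_closedSpan (fun n => ?_) z.2)
    exact hz (u n) (Submodule.subset_span ⟨n, rfl⟩))
  have hbK : ∀ n, bK n = u n := fun n => by
    rw [HilbertBasis.coe_mkOfOrthogonalEqBot]
  let f : closedSpan e →L[ℂ] closedSpan h :=
    ((V : E →L[ℂ] E).comp (closedSpan e).subtypeL).codRestrict (closedSpan h)
      fun z => map_mem_closedSpan (V : E →L[ℂ] E) hV z.2
  let g : closedSpan h →L[ℂ] closedSpan e :=
    ((V.symm : E →L[ℂ] E).comp (closedSpan h).subtypeL).codRestrict (closedSpan e)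
      fun z => map_mem_closedSpan (V.symm : E →L[ℂ] E) hV' z.2
  let Vr : closedSpan e ≃L[ℂ] closedSpan h := ContinuousLinearEquiv.equivOfInverse f g
    (fun z => Subtype.ext (V.symm_apply_apply z)) (fun z => Subtype.ext (V.apply_symm_apply z))
  refine ⟨(b.repr.trans bK.repr.symm).toContinuousLinearEquiv.trans Vr, fun n => ?_⟩
  change V (bK.repr.symm (b.repr (b n)) : closedSpan e) = h n
  rw [b.repr_self, bK.repr_symm_single, hbK]
  exact hV n

/-- A family of eigenvectors, up to two error directions, equivalent to an orthonormal family. -/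
structure RieszFamily (A : E →L[ℂ] E) (τ : ℕ → ℝ) (ε : ℝ) (h : ℕ → E)
    (lam c xi : ℕ → ℂ) (v x : E) : Prop where
  riesz : ∃ (e : ℕ → E) (V : E ≃L[ℂ] E), Orthonormal ℂ e ∧ ∀ n, V (e n) = h n
  eq : ∀ n, A (h n) = lam n • h n + c n • v + xi n • x
  bound_zero : ‖lam 0‖ < ε
  bound : ∀ n, ‖lam (n + 1)‖ ≤ τ n
  mem : v ∈ closedSpan h → v = 0

/-- Skipping `L` terms absorbs the constant `C`. Index zero is retained because nondegeneracy is
stated there. -/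
theorem PerturbedFamily.exists_reindex {A : E →L[ℂ] E} {δ τ : ℕ → ℝ} {ε : ℝ} {e h : ℕ → E}
    {lam c xi : ℕ → ℂ} {v x : E} (P : PerturbedFamily A δ τ ε e h lam c xi v x)
    (hδ : ∀ n, δ n = 1 / 4 * (1 / 2) ^ n) :
    ∃ φ : ℕ → ℕ, StrictMono φ ∧ φ 0 = 0 ∧
      ∀ n, ‖h (φ n) - e (φ n)‖ ≤ 1 / 4 * (1 / 2) ^ n := by
  obtain ⟨C, hC⟩ := P.near
  obtain ⟨L, hL⟩ := exists_pow_lt_of_lt_one (show (0 : ℝ) < 1 / (2 * (|C| + 1)) by positivity)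
    (show (1 / 2 : ℝ) < 1 by norm_num)
  refine ⟨fun n => if n = 0 then 0 else L + n, ?_, if_pos rfl, fun n => ?_⟩
  · refine strictMono_nat_of_lt_succ fun n => ?_
    by_cases hn : n = 0
    · simp [hn]
    · simp [hn]
  · cases n with
    | zero => simpa [hδ] using P.near_zero
    | succ n =>
      change ‖h (L + (n + 1)) - e (L + (n + 1))‖ ≤ _
      refine (hC (L + n)).trans ?_
      rw [hδ, pow_add, pow_succ]
      have h1 : |C| * (1 / 2 : ℝ) ^ L ≤ 1 / 2 := by
        have : (1 / 2 : ℝ) ^ L * (2 * (|C| + 1)) < 1 := by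
          rwa [lt_div_iff₀ (by positivity)] at hL
        nlinarith [pow_pos (show (0 : ℝ) < 1 / 2 by norm_num) L]
      calc C * (1 / 4 * ((1 / 2) ^ L * (1 / 2) ^ n)) ≤ |C| * (1 / 4 * ((1 / 2) ^ L * (1 / 2) ^ n)) := by
            gcongr; exact le_abs_self C
        _ = (|C| * (1 / 2) ^ L) * (1 / 4 * (1 / 2) ^ n) := by ring
        _ ≤ 1 / 2 * (1 / 4 * (1 / 2) ^ n) := by gcongr
        _ = _ := by ring

/-- Small perturbations of orthonormal sequences are images under isomorphisms. -/
theorem Orthonormal.exists_equiv_of_near [CompleteSpace E] {e h : ℕ → E} (he : Orthonormal ℂ e)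
    (hh : ∀ n, ‖h n - e n‖ ≤ 1 / 4 * (1 / 2) ^ n) :
    ∃ V : E ≃L[ℂ] E, ∀ n, V (e n) = h n := by
  have hgeo : HasSum (fun n : ℕ => (1 / 4 : ℝ) * (1 / 2) ^ n) (1 / 4 * 2) :=
    hasSum_geometric_two.mul_left _
  have hs : Summable fun n => ‖e n - h n‖ := by
    refine Summable.of_nonneg_of_le (fun n => norm_nonneg _) (fun n => ?_) hgeo.summable
    rw [norm_sub_rev]; exact hh n
  obtain ⟨D, hD, hDn⟩ := he.exists_clm (z := fun n => e n - h n) hs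
  have hlt : ‖D‖ < 1 := by
    refine hDn.trans_lt ?_
    have := hs.tsum_le_tsum (fun n => by rw [norm_sub_rev]; exact hh n) hgeo.summable
    rw [hgeo.tsum_eq] at this
    linarith
  refine ⟨ContinuousLinearEquiv.ofUnit (Units.oneSub D hlt), fun n => ?_⟩
  change (1 - D) (e n) = h n
  rw [sub_apply, hD]
  simp

/-- Thinning the sequence serves two purposes: it keeps a nonzero error direction `v` out of the
closed span, and it discards infinitely many vectors, whose span `X` later makes the middle summand
infinite-dimensional. -/
theorem PerturbedFamily.exists_rieszFamily [CompleteSpace E] {A : E →L[ℂ] E} {δ τ : ℕ → ℝ} {ε : ℝ}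
    {e h : ℕ → E} {lam c xi : ℕ → ℂ} {v x : E} (P : PerturbedFamily A δ τ ε e h lam c xi v x)
    (hδ : ∀ n, δ n = 1 / 4 * (1 / 2) ^ n) (hτ : Antitone τ) (hτε : τ 0 < ε) {y : E}
    (hvy : inner ℂ v y = 0) (hy : (x = 0 ∧ y = 0) ∨ inner ℂ (h 0) y ≠ 0) :
    ∃ (h' : ℕ → E) (lam' c' xi' : ℕ → ℂ), RieszFamily A τ ε h' lam' c' xi' v x ∧
      (∀ n, h' n ∈ Set.range h) ∧ ((x = 0 ∧ y = 0) ∨ inner ℂ (h' 0) y ≠ 0) ∧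
      ∃ X : Submodule ℂ E, ¬ FiniteDimensional ℂ X ∧ X ≤ Submodule.span ℂ (Set.range h) ∧
        ∀ z ∈ X, z ∈ closedSpan h' → z = 0 := by
  obtain ⟨φ, hφ, hφ0, hnear⟩ := P.exists_reindex hδ
  have heφ : Orthonormal ℂ (e ∘ φ) := P.orth.comp φ hφ.injective
  obtain ⟨V, hV⟩ := heφ.exists_equiv_of_near hnear
  have hV' : ∀ n, V.symm (h (φ n)) = e (φ n) := fun n => by
    have := hV n
    rw [← this]
    exact V.symm_apply_apply _
  have hbound : ∀ n m, n < m → ‖lam m‖ ≤ τ n := by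
    intro n m hnm
    obtain ⟨m, rfl⟩ := Nat.exists_eq_succ_of_ne_zero (Nat.ne_of_gt (Nat.zero_lt_of_lt hnm))
    exact (P.bound m).trans (hτ (Nat.lt_succ_iff.1 hnm))
  -- The discarded indices include all `L + 2 * m + 2`. In the coordinates given by `V` the retained
  -- and discarded vectors are orthogonal, so their closed spans meet only in zero.
  have main : ∀ (ψ : ℕ → ℕ) (L : ℕ), StrictMono ψ → (∀ n m, ψ n ≠ L + 2 * m + 2) →
      (v ∈ closedSpan (fun n => h (φ (ψ n))) → v = 0) →
      ((x = 0 ∧ y = 0) ∨ inner ℂ (h (φ (ψ 0))) y ≠ 0) →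
      ∃ (h' : ℕ → E) (lam' c' xi' : ℕ → ℂ), RieszFamily A τ ε h' lam' c' xi' v x ∧
      (∀ n, h' n ∈ Set.range h) ∧ ((x = 0 ∧ y = 0) ∨ inner ℂ (h' 0) y ≠ 0) ∧
      ∃ X : Submodule ℂ E, ¬ FiniteDimensional ℂ X ∧ X ≤ Submodule.span ℂ (Set.range h) ∧
        ∀ z ∈ X, z ∈ closedSpan h' → z = 0 := by
    intro ψ L hψ hψL hv h0
    have hψφ := hφ.comp hψ
    refine ⟨fun n => h (φ (ψ n)), fun n => lam (φ (ψ n)), fun n => c (φ (ψ n)),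
      fun n => xi (φ (ψ n)), ⟨⟨fun n => e (φ (ψ n)), V, heφ.comp ψ hψ.injective, fun n => hV _⟩,
        fun n => P.eq _, ?_, fun n => hbound _ _ ?_, hv⟩, fun n => ⟨_, rfl⟩, h0,
      Submodule.span ℂ (Set.range fun m => h (φ (L + 2 * m + 2))), ?_, ?_, ?_⟩
    · rcases Nat.eq_zero_or_pos (φ (ψ 0)) with h | h
      · rw [h]; exact P.bound_zero
      · exact (hbound 0 _ h).trans_lt hτε
    · exact (Nat.lt_succ_self n).trans_le (hψφ.id_le (n + 1))
    · refine not_finiteDimensional_of_linearIndependent (u := fun m => h (φ (L + 2 * m + 2))) ?_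
        fun m => Submodule.subset_span ⟨m, rfl⟩
      refine LinearIndependent.of_comp (V.symm : E →ₗ[ℂ] E) ?_
      have : ((V.symm : E →ₗ[ℂ] E) ∘ fun m => h (φ (L + 2 * m + 2))) =
          fun m => e (φ (L + 2 * m + 2)) := by
        funext m
        exact hV' _
      rw [this]
      refine (heφ.comp (fun m : ℕ => L + 2 * m + 2) fun a b hab => ?_).linearIndependent
      have hab : L + 2 * a + 2 = L + 2 * b + 2 := hab
      omega
    · refine Submodule.span_mono ?_
      rintro _ ⟨m, rfl⟩
      exact ⟨_, rfl⟩
    · intro z hz hz'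
      have h1 : V.symm z ∈ closedSpan fun n => e (φ (ψ n)) :=
        map_mem_closedSpan (V.symm : E →L[ℂ] E) (fun n => hV' _) hz'
      have h2 : V.symm z ∈ closedSpan fun m => e (φ (L + 2 * m + 2)) :=
        map_mem_closedSpan (V.symm : E →L[ℂ] E) (fun n => hV' _)
          (Submodule.le_topologicalClosure _ hz)
      have h3 := eq_zero_of_mem_closedSpan (fun n => inner_eq_zero_symm.1
        (inner_eq_zero_of_mem_closedSpan (fun m => heφ.2 (hψL n m).symm) h2)) h1
      simpa using h3
  have hvV : ∀ ψ : ℕ → ℕ, v ∈ closedSpan (fun n => h (φ (ψ n))) →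
      V.symm v ∈ closedSpan fun n => e (φ (ψ n)) := fun ψ hv =>
    map_mem_closedSpan (V.symm : E →L[ℂ] E) (fun n => hV' _) hv
  have hmono : ∀ L : ℕ, StrictMono fun n : ℕ => if n = 0 then 0 else L + 2 * n - 1 := by
    intro L
    refine strictMono_nat_of_lt_succ fun n => ?_
    by_cases hn : n = 0
    · simp [hn]
    · simp only [hn, if_false, Nat.add_eq_zero_iff, one_ne_zero, and_false]
      omega
  have havoid : ∀ L n m : ℕ, (if n = 0 then 0 else L + 2 * n - 1) ≠ L + 2 * m + 2 := by
    intro L n m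
    split_ifs <;> omega
  have hstart : (x = 0 ∧ y = 0) ∨ inner ℂ (h (φ 0)) y ≠ 0 := by rwa [hφ0]
  -- A nonzero coordinate of `v` at some `L ≥ 1` is dealt with by dropping index `L`. If only the
  -- coordinate at zero can be nonzero, index zero is dropped when it carries no condition;
  -- otherwise `v` in the span is a multiple of `h 0`, and the pairings with `y` force it to vanish.
  by_cases hn₀ : ∃ n, 1 ≤ n ∧ inner ℂ (e (φ n)) (V.symm v) ≠ 0
  · obtain ⟨L, hL, hLv⟩ := hn₀
    refine main _ L (hmono L) (havoid L) (fun hv => absurd ?_ hLv) hstart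
    refine inner_eq_zero_symm.1 (inner_eq_zero_of_mem_closedSpan (fun n => heφ.2 ?_) (hvV _ hv))
    split_ifs <;> omega
  · push Not at hn₀
    rcases hy with hy | hy
    · refine main (fun n => 2 * n + 1) 0 (strictMono_nat_of_lt_succ fun n => by omega)
        (fun n m => by omega) (fun hv => ?_) (Or.inl hy)
      have := eq_zero_of_mem_closedSpan (fun n => hn₀ (2 * n + 1) (by omega)) (hvV _ hv)
      simpa using this
    · refine main _ 0 (hmono 0) (havoid 0) (fun hv => ?_) hstart
      have h1 := hvV _ hv
      have h2 : V.symm v = inner ℂ (e (φ 0)) (V.symm v) • e (φ 0) := by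
        rw [← sub_eq_zero]
        refine eq_zero_of_mem_closedSpan (fun n => ?_)
          (Submodule.sub_mem _ h1 (Submodule.smul_mem _ _ (mem_closedSpan _ 0)))
        rw [inner_sub_right, inner_smul_right]
        by_cases hn : n = 0
        · subst hn
          simp only [if_true]
          rw [inner_self_eq_norm_sq_to_K, P.orth.1]
          simp
        · have h3 : inner ℂ (e (φ (0 + 2 * n - 1))) (e (φ 0)) = 0 :=
            heφ.2 (show 0 + 2 * n - 1 ≠ 0 by omega)
          simp only [hn, if_false]
          rw [h3, hn₀ _ (by omega)]
          simp
      have h3 : v = inner ℂ (e (φ 0)) (V.symm v) • h 0 := by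
        have := congrArg V h2
        rw [V.apply_symm_apply, map_smul] at this
        have h4 : V (e (φ 0)) = h 0 := (hV 0).trans (congrArg h hφ0)
        exact this.trans (by rw [h4])
      have h5 := hvy
      rw [h3, inner_smul_left] at h5
      rw [h3, (_root_.map_eq_zero _).1 ((mul_eq_zero.1 h5).resolve_right hy), zero_smul]

end RieszFamilies

/-! ### Block unitriangular similarities and extensions -/

section Shears

variable {E : Type*} [NormedAddCommGroup E] [InnerProductSpace ℂ E] [CompleteSpace E]

/-- An operator `U → V` with prescribed value at `a` and prescribed value of the adjoint at `c`. -/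
theorem exists_clm_apply_adjoint_apply {U V : Submodule ℂ E} {a b c d : E} (ha : a ∈ U)
    (hd : d ∈ U) (hb : b ∈ V) (hc : c ∈ V) (h : inner ℂ d a = inner ℂ c b) (hab : a = 0 → b = 0)
    (hcd : c = 0 → d = 0) :
    ∃ f : E →L[ℂ] E, f a = b ∧ adjoint f c = d ∧ (∀ z, f z ∈ V) ∧ (∀ z ∈ Uᗮ, f z = 0) ∧
      ∀ z ∈ Vᗮ, adjoint f z = 0 := by
  by_cases ha0 : a = 0
  · have hb0 := hab ha0
    by_cases hc0 : c = 0
    · refine ⟨0, by rw [hb0]; simp, ?_, fun z => by simp, fun z _ => by simp, fun z _ => by simp⟩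
      rw [hcd hc0, hc0, map_zero]
    · have hcc : inner ℂ c c ≠ 0 := inner_self_ne_zero.2 hc0
      refine ⟨(inner ℂ c c)⁻¹ • rankOne ℂ c d, ?_, ?_, fun z => ?_, fun z hz => ?_, fun z hz => ?_⟩
      · rw [ha0, hb0, map_zero]
      · rw [map_smulₛₗ, InnerProductSpace.adjoint_rankOne]
        simp only [smul_apply, InnerProductSpace.rankOne_apply, map_inv₀,
          inner_conj_symm]
        rw [inv_smul_smul₀ hcc]
      · exact V.smul_mem _ (V.smul_mem _ hc)
      · simp [hz d hd]
      · rw [map_smulₛₗ, InnerProductSpace.adjoint_rankOne]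
        simp [hz c hc]
  · have haa : inner ℂ a a ≠ 0 := inner_self_ne_zero.2 ha0
    by_cases hc0 : c = 0
    · have hd0 := hcd hc0
      refine ⟨(inner ℂ a a)⁻¹ • rankOne ℂ b a, ?_, ?_, fun z => ?_, fun z hz => ?_, fun z hz => ?_⟩
      · simp only [smul_apply, InnerProductSpace.rankOne_apply]
        rw [inv_smul_smul₀ haa]
      · rw [hc0, hd0, map_zero]
      · exact V.smul_mem _ (V.smul_mem _ hb)
      · simp [hz a ha]
      · rw [map_smulₛₗ, InnerProductSpace.adjoint_rankOne]
        simp [hz b hb]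
    · have hcc : inner ℂ c c ≠ 0 := inner_self_ne_zero.2 hc0
      have h' : inner ℂ a d = inner ℂ b c := by
        rw [← inner_conj_symm, h, inner_conj_symm]
      -- Each of the first two terms realizes one prescribed value and disturbs the other; the third
      -- removes the overlap, which by `h` is the same seen from either side.
      refine ⟨(inner ℂ a a)⁻¹ • rankOne ℂ b a + (inner ℂ c c)⁻¹ • rankOne ℂ c d -
        (inner ℂ c b * (inner ℂ a a)⁻¹ * (inner ℂ c c)⁻¹) • rankOne ℂ c a, ?_, ?_, fun z => ?_,
        fun z hz => ?_, fun z hz => ?_⟩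
      · simp only [sub_apply, add_apply,
          smul_apply, InnerProductSpace.rankOne_apply, smul_smul, h]
        rw [inv_mul_cancel₀ haa, one_smul, add_sub_assoc, ← sub_smul]
        convert add_zero b
        rw [smul_eq_zero]
        left
        field_simp
        ring
      · rw [map_sub, map_add, map_smulₛₗ, map_smulₛₗ, map_smulₛₗ]
        simp only [InnerProductSpace.adjoint_rankOne]
        simp only [sub_apply, add_apply,
          smul_apply, InnerProductSpace.rankOne_apply, smul_smul, map_mul,
          map_inv₀, inner_conj_symm]
        rw [inv_mul_cancel₀ hcc, one_smul, add_comm, add_sub_assoc, ← sub_smul]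
        convert add_zero d
        rw [smul_eq_zero]
        left
        field_simp
        ring
      · exact V.sub_mem (V.add_mem (V.smul_mem _ (V.smul_mem _ hb))
          (V.smul_mem _ (V.smul_mem _ hc))) (V.smul_mem _ (V.smul_mem _ hc))
      · simp [hz a ha, hz d hd]
      · rw [map_sub, map_add, map_smulₛₗ, map_smulₛₗ, map_smulₛₗ]
        simp only [InnerProductSpace.adjoint_rankOne]
        simp [hz b hb, hz c hc]

/-- The operator is `1 + f + p + q` with `f` from `E₂` to `E₁`, `p` from `E₃` to `E₂` and `q` from
`E₃` to `E₁`. Each entry has one prescribed value and one prescribed adjoint value, and the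
orthogonality relations among `v`, `w`, `x`, `y` are exactly the compatibility conditions. The entry
`q` must also compensate the contribution of `p` to the adjoint at `y₂`. -/
theorem exists_unipotent {E₁ E₂ E₃ : Submodule ℂ E} (h12 : E₁ ⟂ E₂) (h13 : E₁ ⟂ E₃) (h23 : E₂ ⟂ E₃)
    {v₁ v₂ w₂ w₃ x₁ x₂ x₃ y₁ y₂ y₃ : E} (hv₁ : v₁ ∈ E₁) (hv₂ : v₂ ∈ E₂) (hw₂ : w₂ ∈ E₂)
    (hw₃ : w₃ ∈ E₃) (hx₁ : x₁ ∈ E₁) (hx₂ : x₂ ∈ E₂) (hx₃ : x₃ ∈ E₃) (hy₁ : y₁ ∈ E₁)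
    (hy₂ : y₂ ∈ E₂) (hy₃ : y₃ ∈ E₃) (hvy : inner ℂ y₁ v₁ + inner ℂ y₂ v₂ = 0)
    (hwx : inner ℂ w₂ x₂ + inner ℂ w₃ x₃ = 0)
    (hxy : inner ℂ y₁ x₁ + inner ℂ y₂ x₂ + inner ℂ y₃ x₃ = 0) (hv : v₂ = 0 → v₁ = 0)
    (hw : w₂ = 0 → w₃ = 0) (hx : x₃ = 0 → x₁ = 0 ∧ x₂ = 0) (hy : y₁ = 0 → y₂ = 0 ∧ y₃ = 0) :
    ∃ S : (E →L[ℂ] E)ˣ, (∀ u ∈ E₁, (S : E →L[ℂ] E) u = u) ∧ (S : E →L[ℂ] E) v₂ = v₁ + v₂ ∧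
      (S : E →L[ℂ] E) x₃ = x₁ + x₂ + x₃ ∧ (∀ u ∈ E₃, adjoint (S : E →L[ℂ] E) u = u) ∧
      adjoint (S : E →L[ℂ] E) (w₂ + w₃) = w₂ ∧ adjoint (S : E →L[ℂ] E) (y₁ + y₂ + y₃) = y₁ := by
  obtain ⟨f, f1, f2, f3, f4, f5⟩ := exists_clm_apply_adjoint_apply (U := E₂) (V := E₁) (a := v₂)
    (b := v₁) (c := y₁) (d := -y₂) hv₂ (E₂.neg_mem hy₂) hv₁ hy₁
    (by rw [inner_neg_left]; linear_combination -hvy) hv (fun h => by rw [(hy h).1, neg_zero])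
  obtain ⟨p, p1, p2, p3, p4, p5⟩ := exists_clm_apply_adjoint_apply (U := E₃) (V := E₂) (a := x₃)
    (b := x₂) (c := w₂) (d := -w₃) hx₃ (E₃.neg_mem hw₃) hx₂ hw₂
    (by rw [inner_neg_left]; linear_combination -hwx) (fun h => (hx h).2)
    (fun h => by rw [hw h, neg_zero])
  have hp : adjoint p y₂ ∈ E₃ᗮᗮ := fun z hz => by
    rw [ContinuousLinearMap.adjoint_inner_right, p4 z hz, inner_zero_left]
  have hp' : inner ℂ (adjoint p y₂) x₃ = inner ℂ y₂ x₂ := by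
    rw [ContinuousLinearMap.adjoint_inner_left, p1]
  obtain ⟨q, q1, q2, q3, q4, q5⟩ := exists_clm_apply_adjoint_apply (U := E₃ᗮᗮ) (V := E₁) (a := x₃)
    (b := x₁) (c := y₁) (d := -y₃ - adjoint p y₂) (E₃.le_orthogonal_orthogonal hx₃)
    (Submodule.sub_mem _ (Submodule.neg_mem _ (E₃.le_orthogonal_orthogonal hy₃)) hp) hx₁ hy₁
    (by rw [inner_sub_left, inner_neg_left, hp']; linear_combination -hxy) (fun h => (hx h).1)
    (fun h => by rw [(hy h).1, (hy h).2]; simp)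
  have q4' : ∀ z ∈ E₃ᗮ, q z = 0 := fun z hz => q4 z (Submodule.le_orthogonal_orthogonal _ hz)
  have zf : IsNilpotent f := ⟨2, by
    ext z
    rw [pow_two]
    exact f4 _ (h12 (f3 z))⟩
  have zp : IsNilpotent p := ⟨2, by
    ext z
    rw [pow_two]
    exact p4 _ (h23 (p3 z))⟩
  have zq : IsNilpotent q := ⟨2, by
    ext z
    rw [pow_two]
    exact q4' _ (h13 (q3 z))⟩
  -- In this order all mixed products vanish, so the product of three invertible factors is the
  -- desired sum.
  obtain ⟨S, hS⟩ := (zq.isUnit_one_add.mul zp.isUnit_one_add).mul zf.isUnit_one_add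
  have hS' : (S : E →L[ℂ] E) = 1 + f + p + q := by
    rw [hS]
    have e1 : p * f = 0 := ContinuousLinearMap.ext fun z => p4 _ (h13 (f3 z))
    have e2 : q * f = 0 := ContinuousLinearMap.ext fun z => q4' _ (h13 (f3 z))
    have e3 : q * p = 0 := ContinuousLinearMap.ext fun z => q4' _ (h23 (p3 z))
    have : (1 + q) * (1 + p) * (1 + f) = 1 + f + p + q + p * f + q * f + q * p + q * p * f := by
      noncomm_ring
    rw [this, e1, e2, e3]
    simp
  have hA : adjoint (S : E →L[ℂ] E) = 1 + adjoint f + adjoint p + adjoint q := by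
    rw [hS', map_add, map_add, map_add, ContinuousLinearMap.one_def, ContinuousLinearMap.adjoint_id]
  refine ⟨S, fun u hu => ?_, ?_, ?_, fun u hu => ?_, ?_, ?_⟩
  · rw [hS']
    simp [f4 u (h12 hu), p4 u (h13 hu), q4' u (h13 hu)]
  · rw [hS']
    simp [f1, p4 _ (h23 hv₂), q4' _ (h23 hv₂), add_comm]
  · rw [hS']
    simp only [add_apply, one_apply_eq_self, f4 _ (h23.symm hx₃),
      p1, q1]
    abel
  · rw [hA]
    simp [f5 u (h13.symm hu), p5 u (h23.symm hu), q5 u (h13.symm hu)]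
  · rw [hA]
    simp only [add_apply, one_apply_eq_self, map_add,
      f5 _ (h12.symm hw₂), f5 _ (h13.symm hw₃), p2, p5 _ (h23.symm hw₃), q5 _ (h12.symm hw₂),
      q5 _ (h13.symm hw₃)]
    abel
  · rw [hA]
    simp only [add_apply, one_apply_eq_self, map_add,
      f2, f5 _ (h12.symm hy₂), f5 _ (h13.symm hy₃), p5 _ (h12 hy₁), p5 _ (h23.symm hy₃), q2,
      q5 _ (h12.symm hy₂), q5 _ (h13.symm hy₃)]
    abel

/-- The extension of an automorphism of a closed subspace by the identity on the orthogonal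
complement. -/
theorem exists_extension_unit {K : Submodule ℂ E} [CompleteSpace K] (W : K ≃L[ℂ] K) :
    ∃ U : (E →L[ℂ] E)ˣ, (∀ u : K, (U : E →L[ℂ] E) u = W u) ∧
      (∀ z ∈ Kᗮ, (U : E →L[ℂ] E) z = z) ∧ (∀ u ∈ K, adjoint (U : E →L[ℂ] E) u ∈ K) ∧
      ∀ z ∈ Kᗮ, adjoint (U : E →L[ℂ] E) z = z := by
  let F : (K →L[ℂ] K) → (E →L[ℂ] E) := fun T =>
    K.subtypeL ∘L T ∘L K.orthogonalProjectionOnto + Kᗮ.starProjection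
  have h1 : ∀ T, ∀ u : K, F T u = T u := fun T u => by
    simp only [F, add_apply, ContinuousLinearMap.comp_apply,
      Submodule.orthogonalProjectionOnto_mem_subspace_eq_self]
    rw [(Submodule.starProjection_apply_eq_zero_iff _).2 (K.le_orthogonal_orthogonal u.2), add_zero]
    rfl
  have h2 : ∀ T, ∀ z ∈ Kᗮ, F T z = z := fun T z hz => by
    simp only [F, add_apply, ContinuousLinearMap.comp_apply,
      K.orthogonalProjectionOnto_eq_zero_iff.2 hz, map_zero, zero_add]
    exact Submodule.starProjection_eq_self_iff.2 hz
  have hmul : ∀ S T : K →L[ℂ] K, (∀ z, S (T z) = z) → F S * F T = 1 := fun S T hST => by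
    ext z
    obtain ⟨u, hu, y, hy, rfl⟩ := K.exists_add_mem_mem_orthogonal z
    change F S (F T (u + y)) = u + y
    rw [map_add, h2 T y hy, h1 T ⟨u, hu⟩, map_add, h2 S y hy, h1 S, hST]
  let U : (E →L[ℂ] E)ˣ := ⟨F W, F W.symm, hmul _ _ W.apply_symm_apply, hmul _ _ W.symm_apply_apply⟩
  refine ⟨U, h1 _, h2 _, fun u hu => ?_, fun z hz => ?_⟩
  · rw [← K.orthogonal_orthogonal]
    intro z hz
    rw [ContinuousLinearMap.adjoint_inner_right]
    change inner ℂ (F W z) u = 0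
    rw [h2 _ z hz]
    exact inner_eq_zero_symm.1 (hz u hu)
  · refine ext_inner_right ℂ fun t => ?_
    obtain ⟨u, hu, y, hy, rfl⟩ := K.exists_add_mem_mem_orthogonal t
    rw [ContinuousLinearMap.adjoint_inner_left]
    change inner ℂ z (F (W : K →L[ℂ] K) (u + y)) = _
    rw [map_add, h2 _ y hy, h1 _ ⟨u, hu⟩, inner_add_right, inner_add_right,
      (Submodule.mem_orthogonal' K z).1 hz _ ((W : K →L[ℂ] K) ⟨u, hu⟩).2, (Submodule.mem_orthogonal' K z).1 hz u hu]

end Shears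

/-! ### Diagonal operators, rank one and compressions -/

section Blocks

variable {E : Type*} [NormedAddCommGroup E] [InnerProductSpace ℂ E] [CompleteSpace E]

theorem HilbertBasis.adjoint_apply_of_diagonal (b : HilbertBasis ℕ ℂ E) {D : E →L[ℂ] E}
    {a : ℕ → ℂ} (h : ∀ n, D (b n) = a n • b n) (n : ℕ) :
    adjoint D (b n) = (starRingEnd ℂ) (a n) • b n := by
  have : ∀ m, inner ℂ (b m) (adjoint D (b n)) = inner ℂ (b m) ((starRingEnd ℂ) (a n) • b n) := by
    intro m
    rw [ContinuousLinearMap.adjoint_inner_right, h, inner_smul_left, inner_smul_right]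
    by_cases hmn : m = n
    · rw [hmn]
    · rw [b.orthonormal.2 hmn, mul_zero, mul_zero]
  refine b.repr.injective (lp.ext (funext fun m => ?_))
  rw [b.repr_apply_apply, b.repr_apply_apply, this]

theorem HilbertBasis.isStarNormal_of_diagonal (b : HilbertBasis ℕ ℂ E) {D : E →L[ℂ] E}
    {a : ℕ → ℂ} (h : ∀ n, D (b n) = a n • b n) : IsStarNormal D := by
  refine ⟨b.clm_ext fun n => ?_⟩
  change adjoint D (D (b n)) = D (adjoint D (b n))
  rw [b.adjoint_apply_of_diagonal h, h, map_smul, map_smul, b.adjoint_apply_of_diagonal h, h,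
    smul_comm]

theorem HilbertBasis.hasSum_norm_sq (b : HilbertBasis ℕ ℂ E) (z : E) :
    HasSum (fun n => ‖(inner ℂ (b n) z : ℂ)‖ ^ 2) (‖z‖ ^ 2) := by
  have h := b.hasSum_inner_mul_inner z z
  have h2 : ∀ n, (inner ℂ z (b n) : ℂ) * inner ℂ (b n) z = ((‖(inner ℂ (b n) z : ℂ)‖ ^ 2 : ℝ) : ℂ) :=
    fun n => by
      rw [← inner_conj_symm, RCLike.conj_mul]
      norm_cast
  rw [inner_self_eq_norm_sq_to_K] at h
  simp only [h2] at h
  refine Complex.hasSum_ofReal.1 ?_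
  rw [Complex.ofReal_pow]
  exact h

theorem HilbertBasis.norm_le_of_diagonal (b : HilbertBasis ℕ ℂ E) {D : E →L[ℂ] E}
    {a : ℕ → ℂ} (h : ∀ n, D (b n) = a n • b n) {M : ℝ} (hM : ∀ n, ‖a n‖ ≤ M) : ‖D‖ ≤ M := by
  have hM0 : 0 ≤ M := (norm_nonneg _).trans (hM 0)
  refine D.opNorm_le_bound hM0 fun z => ?_
  have h1 : ∀ n, ‖(inner ℂ (b n) (D z) : ℂ)‖ ^ 2 ≤ M ^ 2 * ‖(inner ℂ (b n) z : ℂ)‖ ^ 2 := by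
    intro n
    rw [← ContinuousLinearMap.adjoint_inner_left, b.adjoint_apply_of_diagonal h, inner_smul_left,
      norm_mul, mul_pow, Complex.conj_conj]
    gcongr
    exact hM n
  have h2 := hasSum_le h1 (b.hasSum_norm_sq (D z)) ((b.hasSum_norm_sq z).mul_left (M ^ 2))
  rw [← mul_pow] at h2
  exact le_of_sq_le_sq h2 (by positivity)

theorem rank_le_one_of_forall_mem_span {F G : Type*} [NormedAddCommGroup F]
    [InnerProductSpace ℂ F] [NormedAddCommGroup G] [InnerProductSpace ℂ G] {D : F →L[ℂ] G} (p : G)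
    (h : ∀ z, D z ∈ Submodule.span ℂ {p}) : D.rank ≤ 1 := by
  refine (Submodule.rank_mono (t := Submodule.span ℂ {p}) ?_).trans
    ((rank_span_le _).trans (by simp))
  rintro _ ⟨z, rfl⟩
  exact h z

theorem HilbertBasis.forall_mem_span {F G : Type*} [NormedAddCommGroup F]
    [InnerProductSpace ℂ F] [NormedAddCommGroup G] [InnerProductSpace ℂ G] (b : HilbertBasis ℕ ℂ F)
    {D : F →L[ℂ] G} {p : G} (h : ∀ n, D (b n) ∈ Submodule.span ℂ {p}) (z : F) :
    D z ∈ Submodule.span ℂ {p} := by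
  have hcl : IsClosed ((Submodule.span ℂ {p} : Submodule ℂ G) : Set G) :=
    Submodule.closed_of_finiteDimensional _
  have : (Submodule.span ℂ (Set.range b)).topologicalClosure ≤
      (Submodule.span ℂ {p}).comap (D : F →ₗ[ℂ] G) :=
    Submodule.topologicalClosure_minimal _ (Submodule.span_le.2 (by
      rintro _ ⟨n, rfl⟩; exact h n)) (hcl.preimage D.continuous)
  rw [b.dense_span] at this
  exact this trivial

theorem forall_mem_span_of_inner_eq_zero {F G : Type*} [NormedAddCommGroup F]
    [InnerProductSpace ℂ F] [NormedAddCommGroup G] [InnerProductSpace ℂ G] {D : F →L[ℂ] G} (w : F)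
    (h : ∀ z, inner ℂ w z = 0 → D z = 0) (z : F) : D z ∈ Submodule.span ℂ {D w} := by
  have h1 : D (z - (inner ℂ w z / inner ℂ w w : ℂ) • w) = 0 := by
    refine h _ ?_
    rw [inner_sub_right, inner_smul_right]
    by_cases hw : w = 0
    · simp [hw]
    · rw [div_mul_cancel₀ _ (inner_self_ne_zero.2 hw), sub_self]
  rw [map_sub, map_smul, sub_eq_zero] at h1
  rw [h1]
  exact Submodule.smul_mem _ _ (Submodule.mem_span_singleton_self _)

/-- The block of an operator between two closed subspaces. -/
noncomputable abbrev compress (K L : Submodule ℂ E) [CompleteSpace L] (C : E →L[ℂ] E) : K →L[ℂ] L :=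
  L.orthogonalProjectionOnto ∘L C ∘L K.subtypeL

theorem adjoint_compress (K L : Submodule ℂ E) [CompleteSpace K] [CompleteSpace L] (C : E →L[ℂ] E) :
    adjoint (compress K L C) = compress L K (adjoint C) := by
  rw [compress, ContinuousLinearMap.adjoint_comp, ContinuousLinearMap.adjoint_comp,
    Submodule.adjoint_orthogonalProjectionOnto, Submodule.adjoint_subtypeL]
  rfl

theorem compress_apply_eq {K L : Submodule ℂ E} [CompleteSpace L] {C : E →L[ℂ] E} {u : K} {p : L}
    {z : E} (hz : z ∈ Lᗮ) (h : C u = p + z) : compress K L C u = p := by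
  change L.orthogonalProjectionOnto (C u) = p
  rw [h, map_add, Submodule.orthogonalProjectionOnto_mem_subspace_eq_self,
    L.orthogonalProjectionOnto_eq_zero_iff.2 hz, add_zero]

end Blocks

/-! ### The similarity that makes both families orthonormal -/

section BlockForm

variable {E : Type*} [NormedAddCommGroup E] [InnerProductSpace ℂ E] [CompleteSpace E]

theorem Submodule.IsOrtho.exists_decomposition {U V : Submodule ℂ E} [CompleteSpace U]
    [CompleteSpace V] (h : U ⟂ V) (z : E) :
    ∃ z₁ ∈ U, ∃ z₂ ∈ Uᗮ ⊓ Vᗮ, ∃ z₃ ∈ V, z = z₁ + z₂ + z₃ := by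
  obtain ⟨z₁, h₁, u, hu, rfl⟩ := U.exists_add_mem_mem_orthogonal z
  obtain ⟨z₃, h₃, z₂, h₂, rfl⟩ := V.exists_add_mem_mem_orthogonal u
  refine ⟨z₁, h₁, z₂, ⟨?_, h₂⟩, z₃, h₃, by abel⟩
  have := Submodule.sub_mem _ hu (h.symm h₃)
  rwa [add_sub_cancel_left] at this

theorem inner_add_add_of_isOrtho {U V W : Submodule ℂ E} (h12 : U ⟂ V) (h13 : U ⟂ W) (h23 : V ⟂ W)
    {a₁ a₂ a₃ b₁ b₂ b₃ : E} (ha₁ : a₁ ∈ U) (ha₂ : a₂ ∈ V) (ha₃ : a₃ ∈ W) (hb₁ : b₁ ∈ U)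
    (hb₂ : b₂ ∈ V) (hb₃ : b₃ ∈ W) :
    inner ℂ (a₁ + a₂ + a₃) (b₁ + b₂ + b₃) = inner ℂ a₁ b₁ + inner ℂ a₂ b₂ + inner ℂ a₃ b₃ := by
  simp only [inner_add_left, inner_add_right, h12.inner_eq ha₁ hb₂, h13.inner_eq ha₁ hb₃,
    h12.symm.inner_eq ha₂ hb₁, h23.inner_eq ha₂ hb₃, h13.symm.inner_eq ha₃ hb₁,
    h23.symm.inner_eq ha₃ hb₂]
  ring

theorem RieszFamily.not_finiteDimensional {A : E →L[ℂ] E} {τ : ℕ → ℝ} {ε : ℝ} {h : ℕ → E}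
    {lam c xi : ℕ → ℂ} {v x : E} (R : RieszFamily A τ ε h lam c xi v x) :
    ¬ FiniteDimensional ℂ (closedSpan h) := by
  obtain ⟨e, V, he, hV⟩ := R.riesz
  refine not_finiteDimensional_of_linearIndependent (u := h) ?_ (mem_closedSpan h)
  refine LinearIndependent.of_comp (V.symm : E →ₗ[ℂ] E) ?_
  have : ((V.symm : E →ₗ[ℂ] E) ∘ h) = e := by
    funext n
    change V.symm (h n) = e n
    rw [← hV, V.symm_apply_apply]
  rw [this]
  exact he.linearIndependent

theorem RieszFamily.exists_basis [TopologicalSpace.SeparableSpace E] {A : E →L[ℂ] E} {τ : ℕ → ℝ}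
    {ε : ℝ} {h : ℕ → E} {lam c xi : ℕ → ℂ} {v x : E} (R : RieszFamily A τ ε h lam c xi v x) :
    ∃ (b : HilbertBasis ℕ ℂ (closedSpan h)) (U : (E →L[ℂ] E)ˣ),
      (∀ n, (U : E →L[ℂ] E) (b n) = h n) ∧
      (∀ z ∈ (closedSpan h)ᗮ, (U : E →L[ℂ] E) z = z) ∧
      (∀ u ∈ closedSpan h, adjoint (U : E →L[ℂ] E) u ∈ closedSpan h) ∧
      ∀ z ∈ (closedSpan h)ᗮ, adjoint (U : E →L[ℂ] E) z = z := by
  have : CompleteSpace (closedSpan h) := (isClosed_closedSpan h).completeSpace_coe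
  have : SecondCountableTopology E := UniformSpace.secondCountable_of_separable E
  obtain ⟨b⟩ := exists_hilbertBasis_nat R.not_finiteDimensional
  obtain ⟨e, V, he, hV⟩ := R.riesz
  obtain ⟨W, hW⟩ := exists_equiv_closedSpan he V hV b
  obtain ⟨U, h1, h2, h3, h4⟩ := exists_extension_unit W
  exact ⟨b, U, fun n => (h1 _).trans (hW n), h2, h3, h4⟩

theorem unit_apply_inv_apply (U : (E →L[ℂ] E)ˣ) (z : E) :
    (U : E →L[ℂ] E) ((↑U⁻¹ : E →L[ℂ] E) z) = z := by
  have := congrArg (fun T : E →L[ℂ] E => T z) U.mul_inv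
  exact this

theorem unit_inv_apply_of_apply_eq {U : (E →L[ℂ] E)ˣ} {z y : E} (h : (U : E →L[ℂ] E) z = y) :
    (↑U⁻¹ : E →L[ℂ] E) y = z := by
  have := congrArg (fun T : E →L[ℂ] E => T z) U.inv_mul
  rw [← h]
  exact this

theorem adjoint_inv_apply_of_apply_eq {U : (E →L[ℂ] E)ˣ} {z y : E}
    (h : adjoint (U : E →L[ℂ] E) z = y) : adjoint (↑U⁻¹ : E →L[ℂ] E) y = z := by
  rw [← h]
  refine ext_inner_right ℂ fun t => ?_
  rw [ContinuousLinearMap.adjoint_inner_left, ContinuousLinearMap.adjoint_inner_left,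
    unit_apply_inv_apply]

theorem adjoint_apply_adjoint_inv (U : (E →L[ℂ] E)ˣ) (z : E) :
    adjoint (↑U⁻¹ : E →L[ℂ] E) (adjoint (U : E →L[ℂ] E) z) = z :=
  adjoint_inv_apply_of_apply_eq rfl

/-- After a similarity, the two families become orthonormal bases of their closed spans, and the
error directions become orthogonal to the spans they have to avoid. -/
theorem exists_similarity [TopologicalSpace.SeparableSpace E] {A : E →L[ℂ] E} {τ : ℕ → ℝ} {ε : ℝ}
    {h g : ℕ → E} {lam c xi mu d eta : ℕ → ℂ} {v x w y : E}
    (R : RieszFamily A τ ε h lam c xi v x) (R' : RieszFamily (adjoint A) τ ε g mu d eta w y)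
    (hhg : ∀ i j, inner ℂ (h i) (g j) = 0) (hvg : ∀ j, inner ℂ v (g j) = 0)
    (hvy : inner ℂ v y = 0) (hhw : ∀ j, inner ℂ (h j) w = 0) (hxw : inner ℂ x w = 0)
    (hxy : inner ℂ x y = 0)
    (hnd : (x = 0 ∧ y = 0) ∨ (inner ℂ (g 0) x ≠ 0 ∧ inner ℂ (h 0) y ≠ 0)) :
    ∃ (S : (E →L[ℂ] E)ˣ) (b : HilbertBasis ℕ ℂ (closedSpan h))
      (f : HilbertBasis ℕ ℂ (closedSpan g)),
      ∃ v' ∈ (closedSpan h)ᗮ ⊓ (closedSpan g)ᗮ, ∃ w' ∈ (closedSpan h)ᗮ ⊓ (closedSpan g)ᗮ,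
      ∃ x' ∈ closedSpan g, ∃ y' ∈ closedSpan h,
      (∀ n, ((↑S⁻¹ : E →L[ℂ] E) * A * (S : E →L[ℂ] E)) (b n) = lam n • (b n : E) + c n • v' + xi n • x') ∧
      ∀ n, adjoint ((↑S⁻¹ : E →L[ℂ] E) * A * (S : E →L[ℂ] E)) (f n) = mu n • (f n : E) + d n • w' + eta n • y' := by
  have : CompleteSpace (closedSpan h) := (isClosed_closedSpan h).completeSpace_coe
  have : CompleteSpace (closedSpan g) := (isClosed_closedSpan g).completeSpace_coe
  have h13 : closedSpan h ⟂ closedSpan g := by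
    refine closedSpan_le (Submodule.isClosed_orthogonal _) fun i => ?_
    intro z hz
    exact inner_eq_zero_of_mem_closedSpan (fun j => inner_eq_zero_symm.1 (hhg i j)) hz
  have h12 : closedSpan h ⟂ (closedSpan h)ᗮ ⊓ (closedSpan g)ᗮ :=
    (Submodule.isOrtho_orthogonal_right _).mono_right inf_le_left
  have h23 : (closedSpan h)ᗮ ⊓ (closedSpan g)ᗮ ⟂ closedSpan g :=
    (Submodule.isOrtho_orthogonal_left _).mono_left inf_le_right
  have hin := fun {a₁ a₂ a₃ b₁ b₂ b₃ : E} => inner_add_add_of_isOrtho (a₁ := a₁) (a₂ := a₂)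
    (a₃ := a₃) (b₁ := b₁) (b₂ := b₂) (b₃ := b₃) h12 h13 h23
  have hzero : ∀ {z₁ z₂ z₃ : E}, z₁ ∈ closedSpan h → z₂ ∈ (closedSpan h)ᗮ ⊓ (closedSpan g)ᗮ →
      z₃ ∈ closedSpan g → z₁ + z₂ + z₃ = 0 → z₁ = 0 ∧ z₂ = 0 ∧ z₃ = 0 := by
    intro z₁ z₂ z₃ h1 h2 h3 hz
    refine ⟨?_, ?_, ?_⟩
    · have := hin h1 (zero_mem _) (zero_mem _) h1 h2 h3
      rw [hz] at this
      simpa using this.symm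
    · have := hin (zero_mem _) h2 (zero_mem _) h1 h2 h3
      rw [hz] at this
      simpa using this.symm
    · have := hin (zero_mem _) (zero_mem _) h3 h1 h2 h3
      rw [hz] at this
      simpa using this.symm
  obtain ⟨v₁, hv₁, v₂, hv₂, v₃, hv₃, hv⟩ := h13.exists_decomposition v
  obtain ⟨w₁, hw₁, w₂, hw₂, w₃, hw₃, hw⟩ := h13.exists_decomposition w
  obtain ⟨x₁, hx₁, x₂, hx₂, x₃, hx₃, hx⟩ := h13.exists_decomposition x
  obtain ⟨y₁, hy₁, y₂, hy₂, y₃, hy₃, hy⟩ := h13.exists_decomposition y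
  -- Orthogonality of `v` to `g` removes its third component; likewise `w` loses its first.
  have hv0 : v₃ = 0 := by
    have h1 := hin (zero_mem _) (zero_mem _) hv₃ hv₁ hv₂ hv₃
    rw [← hv, zero_add, zero_add, inner_eq_zero_of_mem_closedSpan
      (fun j => inner_eq_zero_symm.1 (hvg j)) hv₃] at h1
    simpa using h1.symm
  have hw0 : w₁ = 0 := by
    have h1 := hin hw₁ (zero_mem _) (zero_mem _) hw₁ hw₂ hw₃
    rw [← hw, add_zero, add_zero, inner_eq_zero_of_mem_closedSpan hhw hw₁] at h1
    simpa using h1.symm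
  rw [hv0, add_zero] at hv
  rw [hw0, zero_add] at hw
  have hvy' : inner ℂ y₁ v₁ + inner ℂ y₂ v₂ = 0 := by
    have h1 := hin hy₁ hy₂ hy₃ hv₁ hv₂ (zero_mem _)
    rw [add_zero, ← hv, ← hy, inner_eq_zero_symm.1 hvy] at h1
    simpa using h1.symm
  have hwx' : inner ℂ w₂ x₂ + inner ℂ w₃ x₃ = 0 := by
    have h1 := hin (zero_mem _) hw₂ hw₃ hx₁ hx₂ hx₃
    rw [zero_add, ← hx, ← hw, inner_eq_zero_symm.1 hxw] at h1
    simpa using h1.symm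
  have hxy' : inner ℂ y₁ x₁ + inner ℂ y₂ x₂ + inner ℂ y₃ x₃ = 0 := by
    rw [← hin hy₁ hy₂ hy₃ hx₁ hx₂ hx₃, ← hx, ← hy]
    exact inner_eq_zero_symm.1 hxy
  have hv' : v₂ = 0 → v₁ = 0 := fun h0 => by
    rw [h0, add_zero] at hv
    rw [← hv]
    exact R.mem (hv ▸ hv₁)
  have hw' : w₂ = 0 → w₃ = 0 := fun h0 => by
    rw [h0, zero_add] at hw
    rw [← hw]
    exact R'.mem (hw ▸ hw₃)
  have hx' : x₃ = 0 → x₁ = 0 ∧ x₂ = 0 := fun h0 => by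
    rcases hnd with hnd | hnd
    · have := hzero hx₁ hx₂ hx₃ (hx ▸ hnd.1)
      exact ⟨this.1, this.2.1⟩
    · refine absurd ?_ hnd.1
      have h1 := hin (zero_mem _) (zero_mem _) (mem_closedSpan g 0) hx₁ hx₂ hx₃
      rw [← hx, h0] at h1
      simpa using h1
  have hy' : y₁ = 0 → y₂ = 0 ∧ y₃ = 0 := fun h0 => by
    rcases hnd with hnd | hnd
    · have := hzero hy₁ hy₂ hy₃ (hy ▸ hnd.2)
      exact this.2
    · refine absurd ?_ hnd.2
      have h1 := hin (mem_closedSpan h 0) (zero_mem _) (zero_mem _) hy₁ hy₂ hy₃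
      rw [← hy, h0] at h1
      simpa using h1
  obtain ⟨S, s1, s2, s3, s4, s5, s6⟩ := exists_unipotent h12 h13 h23 hv₁ hv₂ hw₂ hw₃ hx₁ hx₂ hx₃ hy₁
    hy₂ hy₃ hvy' hwx' hxy' hv' hw' hx' hy'
  rw [← hv] at s2
  rw [← hx] at s3
  rw [← hw] at s5
  rw [← hy] at s6
  obtain ⟨b, U, u1, u2, u3, u4⟩ := R.exists_basis
  obtain ⟨f, W, t1, t2, t3, t4⟩ := R'.exists_basis
  -- The adjoint of the similarity must send `g n` to `f n`, that is, act as the inverse of `W`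
  -- there; hence the inverse adjoint of `W` is the factor to use. It fixes the complement of the
  -- span of `g`, so it does not interfere with `U`.
  have hWu : IsUnit (adjoint (↑W⁻¹ : E →L[ℂ] E)) := (W⁻¹).isUnit.star
  obtain ⟨W', hW'⟩ := hWu
  have hW'a : adjoint (W' : E →L[ℂ] E) = ↑W⁻¹ := by
    rw [hW', ContinuousLinearMap.adjoint_adjoint]
  have hW'K : ∀ z ∈ (closedSpan g)ᗮ, (W' : E →L[ℂ] E) z = z := fun z hz => by
    rw [hW']
    exact adjoint_inv_apply_of_apply_eq (t4 z hz)
  have hWK : ∀ z ∈ (closedSpan g)ᗮ, (↑W⁻¹ : E →L[ℂ] E) z = z := fun z hz =>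
    unit_inv_apply_of_apply_eq (t2 z hz)
  obtain ⟨P, hPdef⟩ : ∃ P : (E →L[ℂ] E)ˣ, P = S * U * W' := ⟨_, rfl⟩
  have hP : ∀ z, (P : E →L[ℂ] E) z = (S : E →L[ℂ] E) ((U : E →L[ℂ] E) ((W' : E →L[ℂ] E) z)) :=
    fun z => by rw [hPdef]; rfl
  have hPa : ∀ z, adjoint (P : E →L[ℂ] E) z = (↑W⁻¹ : E →L[ℂ] E)
      (adjoint (U : E →L[ℂ] E) (adjoint (S : E →L[ℂ] E) z)) := fun z => by
    have : (P : E →L[ℂ] E) = (S : E →L[ℂ] E) ∘L (U : E →L[ℂ] E) ∘L (W' : E →L[ℂ] E) := by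
      rw [hPdef]; rfl
    rw [this, ContinuousLinearMap.adjoint_comp, ContinuousLinearMap.adjoint_comp, hW'a]
    rfl
  have p1 : ∀ n, (P : E →L[ℂ] E) (b n) = h n := fun n => by
    rw [hP, hW'K _ (h13 (b n).2), u1, s1 _ (mem_closedSpan h n)]
  have p2 : (P : E →L[ℂ] E) v₂ = v := by
    rw [hP, hW'K _ hv₂.2, u2 _ hv₂.1, s2]
  have p3 : (P : E →L[ℂ] E) (adjoint (W : E →L[ℂ] E) x₃) = x := by
    rw [hP, hW', adjoint_apply_adjoint_inv, u2 _ (h13.symm hx₃), s3]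
  have q1 : ∀ n, adjoint (P : E →L[ℂ] E) (g n) = f n := fun n => by
    rw [hPa, s4 _ (mem_closedSpan g n), u4 _ (h13.symm (mem_closedSpan g n))]
    exact unit_inv_apply_of_apply_eq (t1 n)
  have q2 : adjoint (P : E →L[ℂ] E) w = w₂ := by
    rw [hPa, s5, u4 _ hw₂.1, hWK _ hw₂.2]
  have q3 : adjoint (P : E →L[ℂ] E) y = adjoint (U : E →L[ℂ] E) y₁ := by
    rw [hPa, s6, hWK _ (h13 (u3 _ hy₁))]
  refine ⟨P, b, f, v₂, hv₂, w₂, hw₂, adjoint (W : E →L[ℂ] E) x₃, t3 _ hx₃,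
    adjoint (U : E →L[ℂ] E) y₁, u3 _ hy₁, fun n => ?_, fun n => ?_⟩
  · refine unit_inv_apply_of_apply_eq (U := P) (y := A ((P : E →L[ℂ] E) (b n))) ?_
    rw [p1, map_add, map_add, map_smul, map_smul, map_smul, p1, p2, p3, R.eq]
  · have : (↑P⁻¹ : E →L[ℂ] E) * A * (P : E →L[ℂ] E) = (↑P⁻¹ : E →L[ℂ] E) ∘L A ∘L (P : E →L[ℂ] E) := rfl
    rw [this, ContinuousLinearMap.adjoint_comp, ContinuousLinearMap.adjoint_comp]
    change adjoint (P : E →L[ℂ] E) (adjoint A (adjoint (↑P⁻¹ : E →L[ℂ] E) (f n))) = _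
    rw [adjoint_inv_apply_of_apply_eq (q1 n), R'.eq, map_add, map_add, map_smul, map_smul, map_smul,
      q1, q2, q3]

end BlockForm

/-! ### Assembling the theorem -/

section Conclusion

variable {E : Type*} [NormedAddCommGroup E] [InnerProductSpace ℂ E] [CompleteSpace E]

theorem exists_antitone_minorant {s : ℕ → ℝ} (hs : ∀ n, 0 < s n) {c : ℝ} (hc : 0 < c) :
    ∃ τ : ℕ → ℝ, Antitone τ ∧ (∀ n, 0 < τ n) ∧ (∀ n, τ n ≤ s n) ∧ τ 0 ≤ c := by
  obtain ⟨τ, h1, h2⟩ := exists_dependent_seq (fun k (a : ℝ) => 0 < a ∧ a ≤ s k ∧ a ≤ c)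
    (fun _ a a' => a' ≤ a) ⟨min (s 0) c, lt_min (hs 0) hc, min_le_left _ _, min_le_right _ _⟩
    (fun k a ha => ⟨min (s (k + 1)) a, ⟨lt_min (hs _) ha.1, min_le_left _ _,
      (min_le_right _ _).trans ha.2.2⟩, min_le_right _ _⟩)
  exact ⟨τ, antitone_nat_of_succ_le h2, fun n => (h1 n).1, fun n => (h1 n).2.1, (h1 0).2.2⟩

/-- Projecting `X` away from `U` is injective and stays orthogonal to `V`. -/
theorem not_finiteDimensional_inf_orthogonal {U V X : Submodule ℂ E} [CompleteSpace U]
    (hUV : U ≤ Vᗮ) (hXV : X ≤ Vᗮ) (hX : ¬ FiniteDimensional ℂ X) (hXU : ∀ z ∈ X, z ∈ U → z = 0) :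
    ¬ FiniteDimensional ℂ (Uᗮ ⊓ Vᗮ : Submodule ℂ E) := by
  intro _
  let f : X →ₗ[ℂ] (Uᗮ ⊓ Vᗮ : Submodule ℂ E) :=
    (((1 - U.starProjection : E →L[ℂ] E) : E →ₗ[ℂ] E).comp X.subtype).codRestrict _ (fun z =>
      ⟨U.sub_starProjection_mem_orthogonal (z : E),
        Submodule.sub_mem _ (hXV z.2) (hUV (U.starProjection_apply_mem _))⟩)
  refine hX (FiniteDimensional.of_injective f ?_)
  rw [← LinearMap.ker_eq_bot, Submodule.eq_bot_iff]
  intro z hz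
  have h1 : (z : E) - U.starProjection (z : E) = 0 := congrArg Subtype.val hz
  rw [sub_eq_zero] at h1
  refine Subtype.ext (hXU z z.2 ?_)
  rw [h1]
  exact U.starProjection_apply_mem _

theorem HilbertBasis.norm_lt_of_diagonal (b : HilbertBasis ℕ ℂ E) {D : E →L[ℂ] E} {a : ℕ → ℂ}
    (h : ∀ n, D (b n) = a n • b n) {τ : ℕ → ℝ} {ε : ℝ} (hτ : Antitone τ) (hτε : τ 0 < ε)
    (h0 : ‖a 0‖ < ε) (ha : ∀ n, ‖a (n + 1)‖ ≤ τ n) : ‖D‖ < ε := by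
  refine (b.norm_le_of_diagonal h (M := max ‖a 0‖ (τ 0)) fun n => ?_).trans_lt (max_lt h0 hτε)
  cases n with
  | zero => exact le_max_left _ _
  | succ n => exact ((ha n).trans (hτ (Nat.zero_le n))).trans (le_max_right _ _)

theorem compress_diagonal {K : Submodule ℂ E} [CompleteSpace K] (b : HilbertBasis ℕ ℂ K)
    {C : E →L[ℂ] E} {a : ℕ → ℂ} {z : ℕ → E} (hz : ∀ n, z n ∈ Kᗮ)
    (h : ∀ n, C (b n) = a n • (b n : E) + z n) (n : ℕ) : compress K K C (b n) = a n • b n :=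
  compress_apply_eq (hz n) (h n)

end Conclusion

theorem theorem3p1 {H : Type*} [NormedAddCommGroup H] [InnerProductSpace ℂ H] [CompleteSpace H]
    [TopologicalSpace.SeparableSpace H] (hH : ¬ FiniteDimensional ℂ H)
    (T' : H →L[ℂ] H) (ε : ℝ) (hε : 0 < ε)
    (J : TwoSidedIdeal (H →L[ℂ] H)) (hJ : J ≠ ⊤) (hFJ : finiteRankIdeal H < J) :
    ∃ (β : ℂ) (S : (H →L[ℂ] H)ˣ) (M : Fin 3 → ClosedSubmodule ℂ H),
      (∀ i, ¬ FiniteDimensional ℂ (M i).toSubmodule) ∧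
      (Pairwise fun i j => (M i).toSubmodule ⟂ (M j).toSubmodule) ∧
      (⨆ i, (M i).toSubmodule) = ⊤ ∧
      let B : ∀ i j : Fin 3, (M j).toSubmodule →L[ℂ] (M i).toSubmodule :=
        blockEntry M ((↑S⁻¹ : H →L[ℂ] H) * (T' - β • (1 : H →L[ℂ] H)) * (S : H →L[ℂ] H))
      (MemIdealCopy J (B 0 0) ∧ MemIdealCopy J (B 2 2) ∧ ‖B 0 0‖ < ε ∧ ‖B 2 2‖ < ε) ∧
      ((B 1 0).rank ≤ 1 ∧ (B 2 0).rank ≤ 1 ∧ (B 2 1).rank ≤ 1) ∧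
      (IsDiagonalizable (B 0 0) ∧ IsStarNormal (B 0 0) ∧
        IsDiagonalizable (B 2 2) ∧ IsStarNormal (B 2 2)) := by
  obtain ⟨bH⟩ := exists_hilbertBasis_nat hH
  obtain ⟨s, hs, hsJ⟩ := exists_decay_memIdealCopy bH hFJ
  -- `τ` lies below the decay rate that forces membership in `J`, and below `ε / 4` to stay away
  -- from the possible extra eigenvalue `ε / 2`.
  obtain ⟨τ, hτ, hτ0, hτs, hτε⟩ := exists_antitone_minorant hs (show 0 < ε / 4 by positivity)
  obtain ⟨β, κ, r, hB, hR⟩ := exists_not_browder_resolventSeq hH T'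
  -- The sum is `1 / 2`, so the perturbation of an orthonormal sequence has norm less than one and
  -- is invertible.
  let δ : ℕ → ℝ := fun n => 1 / 4 * (1 / 2) ^ n
  have T : Tolerance δ τ ε := by
    refine ⟨fun n => by positivity, fun m n hmn => ?_, hτ0, hτ, hε, hτε⟩
    exact mul_le_mul_of_nonneg_left (pow_le_pow_of_le_one (by norm_num) (by norm_num) hmn)
      (by norm_num)
  obtain ⟨e₀, h₀, lam₀, c₀, xi₀, v, x, f₀, g₀, mu₀, d₀, eta₀, w, y, P, P', hhg, hvg, hvy, hhw, hxw,
    hxy, hnd⟩ := hasCoupledFamilies_of_not_browder hR hB T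
  obtain ⟨h, lam, c, xi, F, hh, hh0, X, hX1, hX2, hX3⟩ := P.exists_rieszFamily (fun _ => rfl) hτ T.lt
    hvy (hnd.imp_right fun hn => hn.2)
  obtain ⟨g, mu, d, eta, F', hg, hg0, -⟩ := P'.exists_rieszFamily (fun _ => rfl) hτ T.lt
    (inner_eq_zero_symm.1 hxw) (hnd.imp And.symm fun hn => hn.1)
  have hhg' : ∀ i j, inner ℂ (h i) (g j) = 0 := fun i j => by
    obtain ⟨i', hi⟩ := hh i
    obtain ⟨j', hj⟩ := hg j
    rw [← hi, ← hj, hhg]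
  have hnd' : (x = 0 ∧ y = 0) ∨ (inner ℂ (g 0) x ≠ 0 ∧ inner ℂ (h 0) y ≠ 0) := by
    rcases hh0 with h1 | h1
    · exact Or.inl h1
    · rcases hg0 with h2 | h2
      · exact Or.inl h2.symm
      · exact Or.inr ⟨h2, h1⟩
  obtain ⟨S, b, f, v', hv', w', hw', x', hx', y', hy', hC, hC'⟩ := exists_similarity F F' hhg'
    (fun j => by obtain ⟨j', hj⟩ := hg j; rw [← hj, hvg]) hvy
    (fun j => by obtain ⟨j', hj⟩ := hh j; rw [← hj, hhw]) hxw hxy hnd'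
  have : CompleteSpace (closedSpan h) := (isClosed_closedSpan h).completeSpace_coe
  have : CompleteSpace (closedSpan g) := (isClosed_closedSpan g).completeSpace_coe
  have h13 : closedSpan h ⟂ closedSpan g := by
    refine closedSpan_le (Submodule.isClosed_orthogonal _) fun i => ?_
    intro z hz
    exact inner_eq_zero_of_mem_closedSpan (fun j => inner_eq_zero_symm.1 (hhg' i j)) hz
  have h12 : closedSpan h ⟂ (closedSpan h)ᗮ ⊓ (closedSpan g)ᗮ :=
    (Submodule.isOrtho_orthogonal_right _).mono_right inf_le_left
  have h23 : (closedSpan h)ᗮ ⊓ (closedSpan g)ᗮ ⟂ closedSpan g :=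
    (Submodule.isOrtho_orthogonal_left _).mono_left inf_le_right
  have hcl : IsClosed (((closedSpan h)ᗮ ⊓ (closedSpan g)ᗮ : Submodule ℂ H) : Set H) :=
    (Submodule.isClosed_orthogonal _).inter (Submodule.isClosed_orthogonal _)
  have : CompleteSpace ((closedSpan h)ᗮ ⊓ (closedSpan g)ᗮ : Submodule ℂ H) := hcl.completeSpace_coe
  have hXg : X ≤ (closedSpan g)ᗮ := by
    refine hX2.trans (Submodule.span_le.2 ?_)
    rintro _ ⟨i, rfl⟩ z hz
    refine inner_eq_zero_of_mem_closedSpan (fun j => ?_) hz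
    obtain ⟨j', hj⟩ := hg j
    rw [← hj]
    exact inner_eq_zero_symm.1 (hhg i j')
  have hinf := not_finiteDimensional_inf_orthogonal h13 hXg hX1 hX3
  set C : H →L[ℂ] H :=
    (↑S⁻¹ : H →L[ℂ] H) * (T' - β • (1 : H →L[ℂ] H)) * (S : H →L[ℂ] H) with hCdef
  have hD := compress_diagonal b (C := C) (a := lam) (z := fun n => c n • v' + xi n • x')
    (fun n => Submodule.add_mem _ (Submodule.smul_mem _ _ hv'.1)
      (Submodule.smul_mem _ _ (h13.symm hx'))) (fun n => by rw [hC, add_assoc])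
  have hD' : ∀ n, compress (closedSpan g) (closedSpan g) C (f n) =
      (starRingEnd ℂ) (mu n) • f n := by
    have h1 := compress_diagonal f (C := adjoint C) (a := mu) (z := fun n => d n • w' + eta n • y')
      (fun n => Submodule.add_mem _ (Submodule.smul_mem _ _ hw'.2)
        (Submodule.smul_mem _ _ (h13 hy'))) (fun n => by rw [hC', add_assoc])
    have h2 := f.adjoint_apply_of_diagonal h1
    rwa [adjoint_compress, ContinuousLinearMap.adjoint_adjoint] at h2
  have hb' : ∀ n, ‖(starRingEnd ℂ) (mu (n + 1))‖ ≤ τ n := fun n => by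
    rw [RCLike.norm_conj]; exact F'.bound n
  have hr10 : (compress (closedSpan h) ((closedSpan h)ᗮ ⊓ (closedSpan g)ᗮ) C).rank ≤ 1 := by
    refine rank_le_one_of_forall_mem_span ⟨v', hv'⟩ (b.forall_mem_span fun n => ?_)
    have : compress (closedSpan h) ((closedSpan h)ᗮ ⊓ (closedSpan g)ᗮ) C (b n) =
        c n • ⟨v', hv'⟩ := by
      refine compress_apply_eq (z := lam n • (b n : H) + xi n • x') ?_ ?_
      · exact Submodule.add_mem _ (Submodule.smul_mem _ _ (h12 (b n).2))
          (Submodule.smul_mem _ _ (h23.symm hx'))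
      · rw [hC, Submodule.coe_smul]; abel
    rw [this]
    exact Submodule.smul_mem _ _ (Submodule.mem_span_singleton_self _)
  have hr20 : (compress (closedSpan h) (closedSpan g) C).rank ≤ 1 := by
    refine rank_le_one_of_forall_mem_span ⟨x', hx'⟩ (b.forall_mem_span fun n => ?_)
    have : compress (closedSpan h) (closedSpan g) C (b n) = xi n • ⟨x', hx'⟩ := by
      refine compress_apply_eq (z := lam n • (b n : H) + c n • v') ?_ ?_
      · exact Submodule.add_mem _ (Submodule.smul_mem _ _ (h13 (b n).2))
          (Submodule.smul_mem _ _ hv'.2)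
      · rw [hC, Submodule.coe_smul]; abel
    rw [this]
    exact Submodule.smul_mem _ _ (Submodule.mem_span_singleton_self _)
  -- This block is read off its adjoint, which maps every `f n` into the line of `w'`; so the block
  -- kills all vectors orthogonal to `w'`.
  have hr21 : (compress ((closedSpan h)ᗮ ⊓ (closedSpan g)ᗮ) (closedSpan g) C).rank ≤ 1 := by
    refine rank_le_one_of_forall_mem_span _ (forall_mem_span_of_inner_eq_zero ⟨w', hw'⟩ ?_)
    intro z hz
    have hz' : inner ℂ w' (z : H) = 0 := hz
    refine f.repr.injective (lp.ext (funext fun n => ?_))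
    rw [f.repr_apply_apply, f.repr_apply_apply, inner_zero_right,
      ← ContinuousLinearMap.adjoint_inner_left, adjoint_compress]
    have h1 : compress (closedSpan g) ((closedSpan h)ᗮ ⊓ (closedSpan g)ᗮ) (adjoint C) (f n) =
        d n • ⟨w', hw'⟩ := by
      refine compress_apply_eq (z := mu n • (f n : H) + eta n • y') ?_ ?_
      · exact Submodule.add_mem _ (Submodule.smul_mem _ _ (h23.symm (f n).2))
          (Submodule.smul_mem _ _ (h12 hy'))
      · rw [hC', Submodule.coe_smul]; abel
    rw [h1, inner_smul_left, hz, mul_zero]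
  refine ⟨β, S, ![⟨closedSpan h, isClosed_closedSpan h⟩,
    ⟨(closedSpan h)ᗮ ⊓ (closedSpan g)ᗮ, hcl⟩, ⟨closedSpan g, isClosed_closedSpan g⟩], ?_, ?_, ?_,
    ⟨hsJ b _ lam hD fun n => (F.bound n).trans (hτs n),
      hsJ f _ _ hD' fun n => (hb' n).trans (hτs n),
      b.norm_lt_of_diagonal hD hτ T.lt F.bound_zero F.bound,
      f.norm_lt_of_diagonal hD' hτ T.lt (by rw [RCLike.norm_conj]; exact F'.bound_zero) hb'⟩,
    ⟨hr10, hr20, hr21⟩, ⟨ℕ, b, lam, hD⟩, b.isStarNormal_of_diagonal hD, ⟨ℕ, f, _, hD'⟩,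
    f.isStarNormal_of_diagonal hD'⟩
  · intro i
    fin_cases i
    · exact F.not_finiteDimensional
    · exact hinf
    · exact F'.not_finiteDimensional
  · intro i j hij
    fin_cases i <;> fin_cases j
    · exact absurd rfl hij
    · exact h12
    · exact h13
    · exact h12.symm
    · exact absurd rfl hij
    · exact h23
    · exact h13.symm
    · exact h23.symm
    · exact absurd rfl hij
  · rw [eq_top_iff]
    intro z _
    obtain ⟨z₁, h₁, z₂, h₂, z₃, h₃, rfl⟩ := h13.exists_decomposition z
    exact Submodule.add_mem _ (Submodule.add_mem _ (Submodule.mem_iSup_of_mem 0 h₁)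
      (Submodule.mem_iSup_of_mem 1 h₂)) (Submodule.mem_iSup_of_mem 2 h₃)
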